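/- Let $A_1,\dots,A_c$ be simple undirected graphs ("atoms") on a common finite vertex set $V$. Write $\underline{A}_j$ for $A_j$ with its isolated vertices removed; assume that every $\underline{A}_j$ is nonempty and connected and that the sum graph $H=A_1+\cdots+A_c$ (the multigraph on $V$ whose adjacency matrix is the sum of the adjacency matrices of the $A_j$) is connected. Additive product. Fix a root $v_1\in V$. The graph $A_1 \mathbin{\overset{\circ}{+}} \cdots \mathbin{\overset{\circ}{+}} A_c$ has as vertices the strings $v_1C_1v_2C_2\cdots v_kC_kv_{k+1}$, $k\ge 0$, with $v_i\in V$, $C_i\in\{1,\dots,c\}$, $C_i\neq C_{i+1}$, and with $v_i\ne v_{i+1}$ both vertices of $\underline{A}_{C_i}$ for every $i\le k$. Its edges are the pairs of such strings of the form $\{sCu,sCv\}$ with $\{u,v\}$ an edge of $A_C$, or $\{s,sCv\}$ with $\{u,v\}$ an edge of $A_C$, where $u$ is the last vertex of $s$. Up to isomorphism this graph does not depend on $v_1$. Its spectral radius is $\rho=\limsup_{t\to\infty}(c^{(t)}_{xy})^{1/t}$, where $c^{(t)}_{xy}$ is the number of walks of length $t$ from $x$ to $y$; it does not depend on the vertices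 $x,y$. Additive lifts. For $N\ge 1$ and maps $Q_1,\dots,Q_c:V\to S_N$, the additive $N$-lift of $H$ by $(Q_1,\dots,Q_c)$ is the sum graph $A_1^{Q_1}+\cdots+A_c^{Q_c}$ on $V\times\{1,\dots,N\}$, where $(u,i)$ and $(v,j)$ are adjacent in $A_m^{Q_m}$ if and only if $\{u,v\}$ is an edge of $A_m$ and $Q_m(v)(j)=Q_m(u)(i)$. The spectrum $\mathrm{spec}$ of a finite (multi)graph is the multiset of roots of the characteristic polynomial of its adjacency matrix. Theorem. For every $N\ge 1$ there is an additive $N$-lift $G$ of $H$ such that every new eigenvalue $\lambda\in\mathrm{spec}(G)\setminus\mathrm{spec}(H)$ (difference of multisets) satisfies $\lambda\le\rho(A_1 \mathbin{\overset{\circ}{+}} \cdots \mathbin{\overset{\circ}{+}} A_c)$. (The same lift serves for every choice of the root $v_1$ and of the vertices $x,y$ that enter the definition of $\rho$.) -/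

import Mathlib

namespace AdditiveProduct

/-- The standing assumptions on a sequence of plain atoms (simple graphs) `A 0, …, A (c - 1)` on a common
vertex set: the sum graph is connected, and each atom, with isolated vertices removed, is nonempty
and connected (`SimpleGraph.Connected` includes nonemptiness). The multigraph sum has the same
connectivity as the union `⨆ j, A j`, and the non-isolated vertices of `A j` form
`(A j).support`. -/
structure IsConnectedSumGraph {V : Type*} {c : ℕ} (A : Fin c → SimpleGraph V) : Prop where
  sum_connected : (⨆ j, A j).Connected
  atom_connected : ∀ j, ((A j).induce (A j).support).Connected

section Product

variable {V : Type*} {c : ℕ}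

/-- A string `r C₁ v₂ C₂ v₃ ⋯ C_k v_{k+1}` is represented by the list of its steps
`(C_i, v_{i+1})`, **last step first**; the root `r = v₁` is kept separately.
`endpoint r s` is the last vertex `v_{k+1}` of the string. -/
def endpoint (r : V) : List (Fin c × V) → V
  | [] => r
  | p :: _ => p.2

/-- The strings that are vertices of the additive product: consecutive colours differ, and in each
step `u C v` the vertices `u ≠ v` are both non-isolated in the atom of colour `C`
(they need not be adjacent). -/
def IsWord (A : Fin c → SimpleGraph V) (r : V) : List (Fin c × V) → Prop
  | [] => True
  | (C, v) :: s =>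
      IsWord A r s ∧ (∀ p ∈ s.head?, p.1 ≠ C) ∧
        endpoint r s ∈ (A C).support ∧ v ∈ (A C).support ∧ endpoint r s ≠ v

/-- The edges of the additive product, each listed in (at least) one direction:
`{sCu, sCv}` for `{u, v}` an edge of the atom `C`, and `{s, sCv}` for `{u, v}` an edge of the
atom `C`, where `u` is the last vertex of `s` (this includes `s = r`, the root string). -/
inductive Arc (A : Fin c → SimpleGraph V) (r : V) :
    List (Fin c × V) → List (Fin c × V) → Prop
  | sibling (s : List (Fin c × V)) (C : Fin c) (u v : V) (h : (A C).Adj u v) :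
      Arc A r ((C, u) :: s) ((C, v) :: s)
  | child (s : List (Fin c × V)) (C : Fin c) (v : V) (h : (A C).Adj (endpoint r s) v) :
      Arc A r s ((C, v) :: s)

theorem Arc.irrefl (A : Fin c → SimpleGraph V) (r : V) (s : List (Fin c × V)) :
    ¬ Arc A r s s := by
  intro h
  generalize hs : s = t at h
  have key : ∀ a b : List (Fin c × V), Arc A r a b → a ≠ b := by
    intro a b hab
    cases hab with
    | sibling s C u v h =>
        intro he
        simp only [List.cons.injEq, Prod.mk.injEq, true_and, and_true] at he
        exact h.ne he
    | child s C v h => exact fun he => List.cons_ne_self _ _ he.symm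
  exact key t t h rfl

/-- The vertex set of the additive product, with strings starting at `r`. -/
def Word (A : Fin c → SimpleGraph V) (r : V) : Type _ := {s : List (Fin c × V) // IsWord A r s}

/-- The additive product graph of the atoms `A 0, …, A (c - 1)`, with strings starting at `r`. -/
def additiveProduct (A : Fin c → SimpleGraph V) (r : V) : SimpleGraph (Word A r) where
  Adj s t := Arc A r s.1 t.1 ∨ Arc A r t.1 s.1
  symm := ⟨fun _ _ h => h.symm⟩
  loopless := ⟨fun s h => h.elim (Arc.irrefl A r s.1) (Arc.irrefl A r s.1)⟩

end Product

/-- `limsup_t (c_{uv}^{(t)})^{1/t}`, where `c_{uv}^{(t)}` is the number of walks of length `t` from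
`u` to `v`. For a connected graph of bounded degree the sequence is bounded and the value is the
spectral radius of the graph; it does not depend on `u` and `v`. -/
noncomputable def rho {W : Type*} (X : SimpleGraph W) (u v : W) : ℝ :=
  Filter.limsup
    (fun t : ℕ => (Set.ncard {p : X.Walk u v | p.length = t} : ℝ) ^ (1 / (t : ℝ))) Filter.atTop

/-- The balanced `N`-lift `G^Q` of `G` by the potential `Q : V → S_N`: a disjoint union of `N`
copies of `G`. -/
def balancedLift {V : Type*} {N : ℕ} (G : SimpleGraph V) (Q : V → Equiv.Perm (Fin N)) :
    SimpleGraph (V × Fin N) where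
  Adj x y := G.Adj x.1 y.1 ∧ Q y.1 y.2 = Q x.1 x.2
  symm := ⟨fun _ _ h => ⟨h.1.symm, h.2.symm⟩⟩
  loopless := ⟨fun _ h => h.1.ne rfl⟩

/-- The additive `N`-lift of the sum graph of `A` by `Q = (Q_1, …, Q_c)`: the sum graph of the
balanced `N`-lifts of the atoms, given by its sequence of summands. -/
def additiveLift {V : Type*} {c N : ℕ} (A : Fin c → SimpleGraph V)
    (Q : Fin c → V → Equiv.Perm (Fin N)) : Fin c → SimpleGraph (V × Fin N) :=
  fun j => balancedLift (A j) (Q j)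

open Classical in
/-- The adjacency matrix of the sum graph `A 0 + ⋯ + A (c - 1)` (parallel edges are counted with
multiplicity). -/
noncomputable def sumAdj {W : Type*} {c : ℕ} (A : Fin c → SimpleGraph W) : Matrix W W ℝ :=
  ∑ j, (A j).adjMatrix ℝ

/-- The spectrum of a finite sum graph: the multiset of roots of its characteristic polynomial,
with multiplicity. (The matrix is real symmetric, so all roots are real.) -/
noncomputable def sumSpec {W : Type*} [Fintype W] [DecidableEq W] {c : ℕ}
    (A : Fin c → SimpleGraph W) : Multiset ℝ :=
  (sumAdj A).charpoly.roots

end AdditiveProduct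

/-! ### Real-rooted polynomials and their convex combinations -/

namespace AdditiveProduct

section RealRooted

open Polynomial Filter Topology

/-! The proof is an interlacing-family argument in which the additive product bounds the roots of
the averaged polynomial.

Write N = d + 1. The permutation representation of S_N is the trivial one plus the d-dimensional
standard one. The trivial part accounts for the spectrum of H, so the new eigenvalues of a lift are
the eigenvalues of ∑ₘ Dₘ Aₘ Dₘᵀ, where Aₘ stands for d disjoint copies of the atom and Dₘ is block
diagonal, its blocks being the standard matrices of the chosen permutations
(`IsFrame.charpoly_lift`).

Some choice is as good as the average. Transpositions act as reflections. A symmetric matrix and its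
conjugate by a reflection have a common rank-one positive perturbation, so every convex combination
of the two resulting polynomials is real-rooted, and one of the two has its roots dominated by the
combination (`rootsDominated_convex`). A uniform permutation is a product of independent lazy
transpositions, so the average over all choices is reached through such two-point mixtures
(`exists_rootsDominated_expect`).

The average can be computed with another group. As a function of the rotation angle in one block,
the determinant is a trigonometric polynomial of degree at most two. The reflections of the standard
representation contain enough rotations by a third of a turn, and those of the signed permutation
group enough rotations by a quarter of a turn, to make both averages invariant under all
reflections, hence equal (`IsRotDesign.expect_eq`, `IsFrame.expect_stdRep_eq`).

The signed average has no roots beyond ρ. With the permutation parts fixed, averaging over the signs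
alone gives recursions for principal minors in which paired steps must use the same atom
(`signDet_eq`, `signAdj_of_ne`). The Green function of the additive product, which covers every
lift, obeys recursions of the same shape with additional nonnegative terms. It converges for y > ρ,
and induction over vertex subsets shows that the averaged determinant is positive there
(`SheetCover.signDet_univ_pos`). -/

theorem aeval_ne_zero_of_splits {f : ℝ[X]} (hf : f.Splits) (hf0 : f ≠ 0) {z : ℂ} (hz : 0 < z.im) :
    aeval z f ≠ 0 := by
  intro h
  have hr : (f.map (algebraMap ℝ ℂ)).IsRoot z := by
    rwa [IsRoot.def, eval_map_algebraMap]
  obtain ⟨x, rfl⟩ := hf.mem_range_of_isRoot hf0 hr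
  simp at hz

theorem splits_of_aeval_ne_zero {f : ℝ[X]} (h : ∀ z : ℂ, 0 < z.im → aeval z f ≠ 0) :
    f.Splits := by
  refine Splits.of_splits_map (algebraMap ℝ ℂ) (IsAlgClosed.splits _) fun a ha => ?_
  have ha0 : aeval a f = 0 := by
    rw [← eval_map_algebraMap]; exact isRoot_of_mem_roots ha
  rcases lt_trichotomy a.im 0 with hi | hi | hi
  · refine absurd ?_ (h (starRingEnd ℂ a) (by simpa using hi))
    have := congrArg (starRingEnd ℂ) ha0
    rw [map_zero] at this
    rw [← this]
    exact aeval_algHom_apply (Complex.conjAe.toAlgHom) a f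
  · exact ⟨a.re, by apply Complex.ext <;> simp [hi]⟩
  · exact absurd ha0 (h a hi)

theorem monic_add_C_mul {f g : ℝ[X]} (hf : f.Monic) (hdeg : f.natDegree = g.natDegree + 1) (t : ℝ) :
    (f + C t * g).Monic := by
  refine hf.add_of_left (degree_lt_degree (lt_of_le_of_lt (natDegree_C_mul_le t g) ?_))
  omega

theorem aeval_eq_reverse (f : ℝ[X]) {z : ℂ} (hz : z ≠ 0) :
    aeval z f = aeval z⁻¹ f.reverse * z ^ f.natDegree := by
  let _ := invertibleOfNonzero hz
  have := eval₂_reverse_mul_pow (algebraMap ℝ ℂ) z f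
  rw [invOf_eq_inv] at this
  simp only [aeval_def, this]

/-- At infinity g / f behaves like lc(g) / z, which has positive imaginary part in the upper half
plane when lc(g) < 0. The point is z = i / e with e > 0 small; reversing both polynomials turns the
limit at infinity into continuity at e = 0. -/
theorem exists_im_div_pos {f g : ℝ[X]} (hf : f.Monic) (hdeg : f.natDegree = g.natDegree + 1)
    (hlead : g.leadingCoeff < 0) : ∃ z : ℂ, 0 < z.im ∧ 0 < (aeval z g / aeval z f).im := by
  have hc : Tendsto (fun e : ℝ => (aeval (-(e : ℂ) * Complex.I) g.reverse /
      aeval (-(e : ℂ) * Complex.I) f.reverse).re) (𝓝 0) (𝓝 g.leadingCoeff) := by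
    have h0 : ContinuousAt (fun e : ℝ => (aeval (-(e : ℂ) * Complex.I) g.reverse /
      aeval (-(e : ℂ) * Complex.I) f.reverse).re) 0 := by
      refine Complex.continuous_re.continuousAt.comp (ContinuousAt.div ?_ ?_ ?_)
      · exact (by fun_prop : Continuous fun e : ℝ =>
          aeval (-(e : ℂ) * Complex.I) g.reverse).continuousAt
      · exact (by fun_prop : Continuous fun e : ℝ =>
          aeval (-(e : ℂ) * Complex.I) f.reverse).continuousAt
      · simp [aeval_def, eval₂_at_zero, coeff_zero_reverse, hf.leadingCoeff]
    have h1 := h0.tendsto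
    simpa [aeval_def, eval₂_at_zero, coeff_zero_reverse, hf.leadingCoeff] using h1
  have hev := (hc.eventually (gt_mem_nhds hlead))
  obtain ⟨e, hneg, he⟩ := ((hev.filter_mono nhdsWithin_le_nhds).and
    (self_mem_nhdsWithin : Set.Ioi (0 : ℝ) ∈ 𝓝[>] 0)).exists
  have he : 0 < e := he
  have hec : (e : ℂ) ≠ 0 := by exact_mod_cast he.ne'
  have hinv : (((e⁻¹ : ℝ) : ℂ) * Complex.I)⁻¹ = -(e : ℂ) * Complex.I := by
    rw [mul_inv, Complex.inv_I]; push_cast; rw [inv_inv]; ring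
  refine ⟨((e⁻¹ : ℝ) : ℂ) * Complex.I, by simp [he], ?_⟩
  have hz0 : ((e⁻¹ : ℝ) : ℂ) * Complex.I ≠ 0 := by simp [he.ne']
  rw [aeval_eq_reverse g hz0, aeval_eq_reverse f hz0, hdeg, pow_succ, mul_div_mul_comm,
    ← div_div, div_self (pow_ne_zero _ hz0), one_div, hinv]
  set w := aeval (-(e : ℂ) * Complex.I) g.reverse / aeval (-(e : ℂ) * Complex.I) f.reverse
  have : (w * (-(e : ℂ) * Complex.I)).im = - (w.re * e) := by simp
  rw [this]
  nlinarith

/-- In the upper half plane g / f never takes a nonzero real value r, since that would be a nonreal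
root of f - r⁻¹ g. If it also omits 0, its imaginary part has constant sign by connectedness, and
`exists_im_div_pos` gives the sign. If it takes the value 0, the open mapping theorem would make it
take small positive real values as well, unless it is constant; being then identically 0, it
contradicts `exists_im_div_pos`. -/
theorem im_div_nonneg {f g : ℝ[X]} (hf : f.Monic) (hdeg : f.natDegree = g.natDegree + 1)
    (hlead : g.leadingCoeff < 0) (h : ∀ t : ℝ, (f + C t * g).Splits) {z : ℂ} (hz : 0 < z.im) :
    0 ≤ (aeval z g / aeval z f).im := by
  set U : Set ℂ := {z | 0 < z.im} with hU
  have hUo : IsOpen U := isOpen_lt continuous_const Complex.continuous_im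
  have hUc : IsPreconnected U := (convex_halfSpace_im_gt 0).isPreconnected
  set φ : ℂ → ℂ := fun z => aeval z g / aeval z f with hφ
  have hf0 : ∀ z ∈ U, aeval z f ≠ 0 := fun z hz =>
    aeval_ne_zero_of_splits (by simpa using h 0) hf.ne_zero hz
  have hreal : ∀ z ∈ U, ∀ r : ℝ, r ≠ 0 → φ z ≠ r := by
    intro z hz r hr he
    refine aeval_ne_zero_of_splits (h (-r⁻¹)) (monic_add_C_mul hf hdeg _).ne_zero hz ?_
    have h1 : aeval z g = r * aeval z f := (div_eq_iff (hf0 z hz)).1 he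
    have hrc : (r : ℂ) ≠ 0 := by exact_mod_cast hr
    simp only [map_add, map_mul, aeval_C, h1]
    simp only [map_neg, map_inv₀, Complex.coe_algebraMap]
    field_simp
    ring
  have hd : DifferentiableOn ℂ φ U := fun z hz =>
    (DifferentiableAt.fun_div (g.differentiable_aeval (𝕜 := ℂ) z) (f.differentiable_aeval z)
      (hf0 z hz)).differentiableWithinAt
  obtain ⟨z₁, hz₁, hpos⟩ := exists_im_div_pos hf hdeg hlead
  by_cases hneg : ∀ z ∈ U, φ z ≠ 0
  · by_contra hlt
    push Not at hlt
    have himg := (hUc.image _ (Complex.continuous_im.comp_continuousOn hd.continuousOn))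
    have : (0 : ℝ) ∈ (fun z => (φ z).im) '' U :=
      himg.Icc_subset ⟨z, hz, rfl⟩ ⟨z₁, hz₁, rfl⟩ ⟨hlt.le, hpos.le⟩
    obtain ⟨w, hw, hw0⟩ := this
    have hwr : φ w = ((φ w).re : ℂ) := by
      apply Complex.ext
      · simp
      · simpa using hw0
    refine hreal w hw (φ w).re (fun h0 => hneg w hw ?_) hwr
    rw [hwr, h0]; simp
  · exfalso
    push Not at hneg
    obtain ⟨z₀, hz₀, h0⟩ := hneg
    rcases (hd.analyticOnNhd hUo).is_constant_or_isOpen hUc with ⟨w, hw⟩ | hopen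
    · rw [show aeval z₁ g / aeval z₁ f = φ z₁ from rfl, hw z₁ hz₁, ← hw z₀ hz₀, h0] at hpos
      simp at hpos
    · have hn : φ '' U ∈ 𝓝 ((0 : ℝ) : ℂ) :=
        (hopen U subset_rfl hUo).mem_nhds ⟨z₀, hz₀, by simpa using h0⟩
      have := (Complex.continuous_ofReal.tendsto 0).eventually hn
      obtain ⟨r, hr, hr0⟩ := ((this.filter_mono nhdsWithin_le_nhds).and
        (self_mem_nhdsWithin : Set.Ioi (0 : ℝ) ∈ 𝓝[>] 0)).exists
      obtain ⟨w, hw, hwr⟩ := hr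
      exact hreal w hw r (ne_of_gt hr0) hwr

/-- If `f` strictly decreases towards `f - g₁` and `f - g₂` along two real-rooted pencils, all convex
combinations of `f - g₁` and `f - g₂` are real-rooted. -/
theorem splits_convex_sub {f g₁ g₂ : ℝ[X]} (hf : f.Monic)
    (hd₁ : f.natDegree = g₁.natDegree + 1) (hd₂ : f.natDegree = g₂.natDegree + 1)
    (hl₁ : g₁.leadingCoeff < 0) (hl₂ : g₂.leadingCoeff < 0)
    (h₁ : ∀ t : ℝ, (f + C t * g₁).Splits) (h₂ : ∀ t : ℝ, (f + C t * g₂).Splits)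
    {s : ℝ} (hs0 : 0 ≤ s) (hs1 : s ≤ 1) :
    (C (1 - s) * (f - g₁) + C s * (f - g₂)).Splits := by
  refine splits_of_aeval_ne_zero fun z hz h0 => ?_
  have hfz : aeval z f ≠ 0 := aeval_ne_zero_of_splits (by simpa using h₁ 0) hf.ne_zero hz
  have i₁ := im_div_nonneg hf hd₁ hl₁ h₁ hz
  have i₂ := im_div_nonneg hf hd₂ hl₂ h₂ hz
  have nr : ∀ {g : ℝ[X]}, f.natDegree = g.natDegree + 1 → (∀ t : ℝ, (f + C t * g).Splits) →
      (aeval z g / aeval z f).im = 0 → aeval z g / aeval z f = 0 := by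
    intro g hd h hi
    by_contra hne
    set r := (aeval z g / aeval z f).re with hr
    have he : aeval z g / aeval z f = (r : ℂ) := by
      apply Complex.ext <;> simp [hr, hi]
    have hr0 : (r : ℂ) ≠ 0 := by rw [← he]; exact hne
    refine aeval_ne_zero_of_splits (h (-r⁻¹)) (monic_add_C_mul hf hd _).ne_zero hz ?_
    have h1 : aeval z g = r * aeval z f := (div_eq_iff hfz).1 he
    simp only [map_add, map_mul, aeval_C, h1]
    simp only [map_neg, map_inv₀, Complex.coe_algebraMap]
    field_simp
    ring
  set a := aeval z g₁ / aeval z f with ha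
  set b := aeval z g₂ / aeval z f with hb
  -- At a nonreal root the weighted mean of the two quotients is 1. Both imaginary parts are
  -- nonnegative, so each weighted one vanishes; by `nr` a quotient with zero imaginary part is
  -- itself zero, so the mean would have real part 0.
  have key : ((1 - s : ℝ) : ℂ) * a + (s : ℂ) * b = 1 := by
    have ha' : aeval z g₁ = a * aeval z f := by rw [ha, div_mul_cancel₀ _ hfz]
    have hb' : aeval z g₂ = b * aeval z f := by rw [hb, div_mul_cancel₀ _ hfz]
    simp only [map_add, map_sub, map_mul, aeval_C, ha', hb', Complex.coe_algebraMap] at h0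
    apply mul_right_cancel₀ hfz
    push_cast at h0 ⊢
    linear_combination -h0
  have kim : (1 - s) * a.im + s * b.im = 0 := by
    have := congrArg Complex.im key
    simpa using this
  have kre : (1 - s) * a.re + s * b.re = 1 := by
    have := congrArg Complex.re key
    simpa using this
  have e₁ : (1 - s) * a.im = 0 := by
    nlinarith [mul_nonneg (sub_nonneg.2 hs1) i₁, mul_nonneg hs0 i₂]
  have e₂ : s * b.im = 0 := by linarith
  have z₁ : (1 - s) * a.re = 0 := by
    rcases mul_eq_zero.1 e₁ with h | h
    · rw [h, zero_mul]
    · rw [show a = 0 from nr hd₁ h₁ h]; simp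
  have z₂ : s * b.re = 0 := by
    rcases mul_eq_zero.1 e₂ with h | h
    · rw [h, zero_mul]
    · rw [show b = 0 from nr hd₂ h₂ h]; simp
  linarith

/-- Every root of `f` is at most some root of `g`. -/
def RootsDominated (f g : ℝ[X]) : Prop := ∀ y, f.IsRoot y → ∃ z, y ≤ z ∧ g.IsRoot z

theorem RootsDominated.refl (f : ℝ[X]) : RootsDominated f f := fun y hy => ⟨y, le_rfl, hy⟩

theorem RootsDominated.trans {f g h : ℝ[X]} (h₁ : RootsDominated f g) (h₂ : RootsDominated g h) :
    RootsDominated f h := fun y hy => by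
  obtain ⟨z, hz, hr⟩ := h₁ y hy
  obtain ⟨w, hw, hr'⟩ := h₂ z hr
  exact ⟨w, hz.trans hw, hr'⟩

theorem multiset_sum_pos {m : Multiset ℝ} (hm : ∀ a ∈ m, 0 < a) (h0 : m ≠ 0) : 0 < m.sum := by
  obtain ⟨a, ha⟩ := Multiset.exists_mem_of_ne_zero h0
  exact (hm a ha).trans_le (Multiset.single_le_sum (fun b hb => (hm b hb).le) a ha)

theorem pos_coeff_prod_X_add_C (m : Multiset ℝ) (hm : ∀ a ∈ m, 0 < a) :
    ∀ k ≤ Multiset.card m, 0 < ((m.map fun a => X + C a).prod).coeff k := by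
  intro k hk
  rw [Multiset.prod_X_add_C_coeff _ hk]
  rw [Multiset.esymm]
  refine multiset_sum_pos ?_ ?_
  · intro x hx
    obtain ⟨s, hs, rfl⟩ := Multiset.mem_map.1 hx
    refine Multiset.prod_pos fun a ha => hm a ?_
    exact Multiset.mem_of_le (Multiset.mem_powersetCard.1 hs).1 ha
  · rw [Ne, Multiset.map_eq_zero]
    intro h
    have := congrArg Multiset.card h
    rw [Multiset.card_powersetCard, Multiset.card_zero, Nat.choose_eq_zero_iff] at this
    omega

/-- The expansion at x is the product of the factors X + (x - a) over the roots a, so its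
coefficients are elementary symmetric functions of positive numbers. Together with the next lemma
this turns "no roots above x" into sign conditions on coefficients, which depend continuously on the
polynomial; continuity of roots is not needed. -/
theorem taylor_coeff_pos {f : ℝ[X]} (hf : f.Splits) (hm : f.Monic) {x : ℝ}
    (hx : ∀ y, f.IsRoot y → y < x) (k : ℕ) (hk : k ≤ f.natDegree) : 0 < (taylor x f).coeff k := by
  have h1 : taylor x f = ((f.roots.map fun a => x - a).map fun a => X + C a).prod := by
    conv_lhs => rw [hf.eq_prod_roots_of_monic hm]
    rw [← taylorAlgHom_apply, map_multiset_prod, Multiset.map_map, Multiset.map_map]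
    congr 1
    refine Multiset.map_congr rfl fun a _ => ?_
    simp [taylorAlgHom_apply]
    ring
  rw [h1]
  refine pos_coeff_prod_X_add_C _ ?_ k ?_
  · intro b hb
    obtain ⟨a, ha, rfl⟩ := Multiset.mem_map.1 hb
    exact sub_pos.2 (hx a (isRoot_of_mem_roots ha))
  · rwa [Multiset.card_map, ← hf.natDegree_eq_card_roots]

theorem not_isRoot_of_taylor_coeff_nonneg {f : ℝ[X]} (hm : f.Monic) {x : ℝ}
    (hx : ∀ k ≤ f.natDegree, 0 ≤ (taylor x f).coeff k) {y : ℝ} (hy : x < y) : ¬ f.IsRoot y := by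
  intro h
  have h1 : (taylor x f).eval (y - x) = 0 := by
    rw [taylor_eval, sub_add_cancel]; exact h
  rw [eval_eq_sum_range, natDegree_taylor] at h1
  have hy' : 0 < y - x := sub_pos.2 hy
  have : 0 < ∑ i ∈ Finset.range (f.natDegree + 1), (taylor x f).coeff i * (y - x) ^ i := by
    refine Finset.sum_pos' (fun i hi => ?_) ⟨f.natDegree, by simp, ?_⟩
    · exact mul_nonneg (hx i (by simpa [Nat.lt_succ_iff] using hi)) (pow_nonneg hy'.le _)
    · rw [coeff_taylor_natDegree, hm.leadingCoeff]
      positivity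
  exact this.ne' h1

theorem natDegree_convex {f₀ f₁ : ℝ[X]} (h₀ : f₀.Monic) (h₁ : f₁.Monic)
    (hd : f₀.natDegree = f₁.natDegree) (s : ℝ) :
    (C (1 - s) * f₀ + C s * f₁).Monic ∧
      (C (1 - s) * f₀ + C s * f₁).natDegree = f₀.natDegree := by
  have hle : (C (1 - s) * f₀ + C s * f₁).natDegree ≤ f₀.natDegree := by
    refine (natDegree_add_le _ _).trans (max_le (natDegree_C_mul_le _ _) ?_)
    rw [hd]; exact natDegree_C_mul_le _ _
  have hc : (C (1 - s) * f₀ + C s * f₁).coeff f₀.natDegree = 1 := by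
    rw [coeff_add, coeff_C_mul, coeff_C_mul, h₀.coeff_natDegree, hd, h₁.coeff_natDegree]; ring
  have hm := monic_of_natDegree_le_of_coeff_eq_one _ hle hc
  refine ⟨hm, le_antisymm hle ?_⟩
  exact le_natDegree_of_ne_zero (by rw [hc]; exact one_ne_zero)

/-- Along a segment of real-rooted monic polynomials whose roots are all below `x` at time `p`, and
not at time `0`, the value `x` is a root at some time in between. -/
theorem exists_isRoot_convex {f₀ f₁ : ℝ[X]} (h₀ : f₀.Monic) (h₁ : f₁.Monic)
    (hd : f₀.natDegree = f₁.natDegree) {p : ℝ} (hp0 : 0 ≤ p) (hp1 : p ≤ 1)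
    (hs : ∀ s, 0 ≤ s → s ≤ 1 → (C (1 - s) * f₀ + C s * f₁).Splits) {x : ℝ}
    (hx : ∀ y, x ≤ y → ¬ (C (1 - p) * f₀ + C p * f₁).IsRoot y) {y₀ : ℝ} (hy₀ : x ≤ y₀)
    (hr : f₀.IsRoot y₀) :
    ∃ s, 0 ≤ s ∧ s ≤ p ∧ (C (1 - s) * f₀ + C s * f₁).IsRoot x := by
  by_contra hno
  push Not at hno
  set F : ℝ → ℝ[X] := fun s => C (1 - s) * f₀ + C s * f₁ with hF
  have hmon : ∀ s, (F s).Monic := fun s => (natDegree_convex h₀ h₁ hd s).1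
  have hdeg : ∀ s, (F s).natDegree = f₀.natDegree := fun s => (natDegree_convex h₀ h₁ hd s).2
  -- `T` is closed and `T'` is open. If x is never a root during [0, p], they agree on this
  -- interval, which is connected; but p belongs to them and 0 does not.
  set T : Set ℝ := {s | ∀ k ≤ f₀.natDegree, 0 ≤ (taylor x (F s)).coeff k} with hT
  set T' : Set ℝ := ⋂ k ∈ Finset.range (f₀.natDegree + 1), {s | 0 < (taylor x (F s)).coeff k}
    with hT'
  have hcont : ∀ k, Continuous fun s => (taylor x (F s)).coeff k := by
    intro k
    simp only [hF, map_add, taylor_mul, taylor_C, coeff_add, coeff_C_mul]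
    fun_prop
  have hTc : IsClosed T := by
    simp only [hT, Set.ofPred_forall]
    exact isClosed_iInter fun k => isClosed_iInter fun _ =>
      isClosed_le continuous_const (hcont k)
  have hTo : IsOpen T' :=
    isOpen_biInter_finset fun k _ => isOpen_lt continuous_const (hcont k)
  have hsub : ∀ s ∈ Set.Icc 0 p, (∀ y, x ≤ y → ¬ (F s).IsRoot y) → s ∈ T' := by
    intro s hsI h
    simp only [hT', Set.mem_iInter, Finset.mem_range, Set.mem_ofPred_eq]
    intro k hk
    refine taylor_coeff_pos (hs s hsI.1 (hsI.2.trans hp1)) (hmon s) (fun y hy => ?_) k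
      (by rw [show (C (1 - s) * f₀ + C s * f₁) = F s from rfl, hdeg s]; omega)
    by_contra hc
    exact h y (not_lt.1 hc) hy
  have hsub2 : ∀ s ∈ Set.Icc 0 p, s ∈ T → s ∈ T' := by
    intro s hsI hsT
    refine hsub s hsI fun y hy => ?_
    rcases hy.eq_or_lt with rfl | hlt
    · exact hno s hsI.1 hsI.2
    · exact not_isRoot_of_taylor_coeff_nonneg (hmon s) (by rw [hdeg s]; exact hsT) hlt
  have hTT : ∀ s ∈ T', s ∈ T := by
    intro s hsT k hk
    simp only [hT', Set.mem_iInter, Finset.mem_range, Set.mem_ofPred_eq] at hsT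
    exact (hsT k (by omega)).le
  have hpT : p ∈ T' := hsub p ⟨hp0, le_rfl⟩ hx
  have h0T : (0 : ℝ) ∉ T' := by
    intro h
    rcases hy₀.eq_or_lt with rfl | hlt
    · exact hno 0 le_rfl hp0 (by simpa using hr)
    · refine not_isRoot_of_taylor_coeff_nonneg (hmon 0) (x := x) ?_ hlt (by simpa [hF] using hr)
      rw [hdeg 0]; exact hTT 0 h
  have hpre : IsPreconnected (Set.Icc (0 : ℝ) p) := isPreconnected_Icc
  obtain ⟨s, hsI, hs1, hs2⟩ := hpre T' Tᶜ hTo hTc.isOpen_compl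
    (fun s hsI => by
      by_cases h : s ∈ T
      · exact Or.inl (hsub2 s hsI h)
      · exact Or.inr h)
    ⟨p, ⟨hp0, le_rfl⟩, hpT⟩ ⟨0, ⟨le_rfl, hp0⟩, fun h => h0T (hsub2 0 ⟨le_rfl, hp0⟩ h)⟩
  exact hs2 (hTT s hs1)

/-- If both alternatives fail, some x lies strictly above all roots at time p, while each endpoint
has a root at or above x. Then x is a root at a time s ≤ p and at a time 1 - t ≥ p. The value at x
is affine in time, and s ≠ p, so it vanishes identically, in particular at p. -/
theorem rootsDominated_convex {f₀ f₁ : ℝ[X]} (h₀ : f₀.Monic) (h₁ : f₁.Monic)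
    (hd : f₀.natDegree = f₁.natDegree) {p : ℝ} (hp0 : 0 ≤ p) (hp1 : p ≤ 1)
    (hs : ∀ s, 0 ≤ s → s ≤ 1 → (C (1 - s) * f₀ + C s * f₁).Splits) :
    RootsDominated f₀ (C (1 - p) * f₀ + C p * f₁) ∨
      RootsDominated f₁ (C (1 - p) * f₀ + C p * f₁) := by
  by_contra hno
  simp only [RootsDominated, not_or, not_forall, not_exists, not_and] at hno
  obtain ⟨⟨y₀, hy₀, h0⟩, ⟨y₁, hy₁, h1⟩⟩ := hno
  set x := min y₀ y₁ with hx
  have hxp : ∀ y, x ≤ y → ¬ (C (1 - p) * f₀ + C p * f₁).IsRoot y := by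
    intro y hy
    rcases min_choice y₀ y₁ with h | h
    · exact h0 y (by rw [← h]; exact hy)
    · exact h1 y (by rw [← h]; exact hy)
  obtain ⟨s, hs0, hsp, hsr⟩ := exists_isRoot_convex h₀ h₁ hd hp0 hp1 hs hxp (min_le_left _ _) hy₀
  obtain ⟨t, ht0, htp, htr⟩ := exists_isRoot_convex (p := 1 - p) h₁ h₀ hd.symm (by linarith)
    (by linarith)
    (fun s hs0 hs1 => by
      have := hs (1 - s) (by linarith) (by linarith)
      rw [sub_sub_cancel] at this
      rwa [add_comm])
    (x := x) (fun y hy => by rw [sub_sub_cancel, add_comm]; exact hxp y hy) (min_le_right _ _) hy₁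
  have hpr := hxp x le_rfl
  simp only [IsRoot.def, eval_add, eval_mul, eval_C] at hsr htr hpr
  apply hpr
  set a := f₀.eval x
  set b := f₁.eval x
  have hsne : s ≠ p := fun h => hpr (by rw [← h]; exact hsr)
  have h3 : (1 - t - s) * (b - a) = 0 := by linear_combination htr - hsr
  have hst : 1 - t - s ≠ 0 := by
    have : s < p := lt_of_le_of_ne hsp hsne
    have : 0 < 1 - t - s := by linarith
    exact this.ne'
  have hab : b - a = 0 := (mul_eq_zero.1 h3).resolve_left hst
  linear_combination hsr + (p - s) * hab

end RealRooted

end AdditiveProduct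

/-! ### Stability under lazy reflections -/

namespace AdditiveProduct

section Interlacing

set_option linter.unusedSectionVars false

open Polynomial Matrix
open scoped BigOperators

/-- M + t u wᵀ is the Schur complement of the corner 1 in the matrix M bordered by the column t u
and the row -w, and that determinant is affine in its last column. M need not be invertible. -/
theorem exists_det_add_smul_vecMulVec {n R : Type*} [Fintype n] [DecidableEq n] [CommRing R]
    (M : Matrix n n R) (u w : n → R) :
    ∃ D : R, ∀ t : R, (M + t • vecMulVec u w).det = M.det + t * D := by
  have key : ∀ t : R, (M + t • vecMulVec u w).det =
      ((fromBlocks M 0 (replicateRow Unit (-w)) 1).updateCol (Sum.inr ())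
        (t • (Sum.elim u 0 : n ⊕ Unit → R) + (Sum.elim 0 1 : n ⊕ Unit → R))).det := by
    intro t
    have h : (fromBlocks M 0 (replicateRow Unit (-w)) 1).updateCol (Sum.inr ())
        (t • (Sum.elim u 0 : n ⊕ Unit → R) + (Sum.elim 0 1 : n ⊕ Unit → R)) =
        fromBlocks M (replicateCol Unit (t • u)) (replicateRow Unit (-w)) 1 := by
      ext i j
      rcases i with i | i <;> rcases j with j | j <;> simp
    rw [h, det_fromBlocks_one₂₂]
    congr 1
    ext i j
    simp [mul_apply, vecMulVec_apply]
  refine ⟨((fromBlocks M 0 (replicateRow Unit (-w)) 1).updateCol (Sum.inr ())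
    (Sum.elim u 0 : n ⊕ Unit → R)).det, fun t => ?_⟩
  have h0 := key 0
  rw [key t, det_updateCol_add, det_updateCol_smul]
  rw [zero_smul, add_zero, zero_smul, zero_add] at h0
  rw [h0]; ring

variable {n ι : Type*} [Fintype n] [DecidableEq n] [Fintype ι] [DecidableEq ι]

/-- Functions of a tuple of symmetric matrices that behave like the characteristic polynomial
of the sum: monic, real-rooted, affine along rank-one directions, with the right trace term. -/
structure IsRealStable (F : (ι → Matrix n n ℝ) → ℝ[X]) : Prop where
  monic : ∀ A : ι → Matrix n n ℝ, (∀ m, (A m).IsSymm) → (F A).Monic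
  natDegree : ∀ A : ι → Matrix n n ℝ, (∀ m, (A m).IsSymm) → (F A).natDegree = Fintype.card n
  splits : ∀ A : ι → Matrix n n ℝ, (∀ m, (A m).IsSymm) → (F A).Splits
  nextCoeff : ∀ A : ι → Matrix n n ℝ, (∀ m, (A m).IsSymm) →
    (F A).nextCoeff = -∑ m, (A m).trace
  affine : ∀ A : ι → Matrix n n ℝ, (∀ m, (A m).IsSymm) → ∀ (m : ι) (v : n → ℝ) (t : ℝ),
    F (Function.update A m (A m + t • vecMulVec v v)) =
      F A + C t * (F (Function.update A m (A m + vecMulVec v v)) - F A)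

theorem sum_update_add (A : ι → Matrix n n ℝ) (m : ι) (B : Matrix n n ℝ) :
    ∑ i, Function.update A m (A m + B) i = ∑ i, A i + B := by
  rw [Finset.sum_update_of_mem (Finset.mem_univ m), ← Finset.add_sum_erase _ A (Finset.mem_univ m),
    Finset.sdiff_singleton_eq_erase]
  abel

theorem isRealStable_charpoly :
    IsRealStable fun A : ι → Matrix n n ℝ => (∑ m, A m).charpoly where
  monic A _ := charpoly_monic _
  natDegree A _ := charpoly_natDegree_eq_dim _
  splits A hA := by
    have h : (∑ m, A m).IsHermitian := by
      rw [Matrix.IsHermitian, conjTranspose_eq_transpose_of_trivial, transpose_sum]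
      exact Finset.sum_congr rfl fun m _ => hA m
    exact h.splits_charpoly
  nextCoeff A _ := by
    rw [← trace_sum, trace_eq_neg_charpoly_nextCoeff, neg_neg]
  affine A _ m v t := by
    refine Polynomial.funext fun x => ?_
    obtain ⟨D, hD⟩ := exists_det_add_smul_vecMulVec (Matrix.scalar n x - ∑ i, A i) v v
    have e : ∀ s : ℝ, (∑ i, Function.update A m (A m + s • vecMulVec v v) i).charpoly.eval x =
        (Matrix.scalar n x - ∑ i, A i).det + -s * D := by
      intro s
      rw [eval_charpoly, sum_update_add, ← hD, sub_add_eq_sub_sub, neg_smul, ← sub_eq_add_neg]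
    have e1 := e 1
    rw [one_smul] at e1
    simp only [eval_add, eval_mul, eval_C, eval_sub, e, e1, eval_charpoly]
    ring

/-- The leading terms cancel and the next coefficients do not. This supplies the degree and sign
hypotheses of `splits_convex_sub` when f comes from h by a perturbation that increases the trace. -/
theorem natDegree_sub_of_nextCoeff_lt {f h : ℝ[X]} (hf : f.Monic) (hh : h.Monic)
    (hd : f.natDegree = h.natDegree) (hpos : 0 < f.natDegree) (hlt : f.nextCoeff < h.nextCoeff) :
    f.natDegree = (f - h).natDegree + 1 ∧ (f - h).leadingCoeff < 0 := by
  have hle : (f - h).natDegree ≤ f.natDegree - 1 := by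
    by_cases h0 : f - h = 0
    · simp [h0]
    · have : (f - h).degree < f.degree :=
        degree_sub_lt_left (by rw [degree_eq_natDegree hf.ne_zero, degree_eq_natDegree hh.ne_zero, hd])
          hf.ne_zero (by rw [hf.leadingCoeff, hh.leadingCoeff])
      have := natDegree_lt_natDegree h0 this
      omega
  have hc : (f - h).coeff (f.natDegree - 1) < 0 := by
    rw [coeff_sub, ← nextCoeff_of_natDegree_pos hpos]
    rw [show h.coeff (f.natDegree - 1) = h.nextCoeff by
      rw [nextCoeff_of_natDegree_pos (by omega), hd]]
    linarith
  have he : (f - h).natDegree = f.natDegree - 1 :=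
    le_antisymm hle (le_natDegree_of_ne_zero hc.ne)
  refine ⟨by omega, ?_⟩
  rw [leadingCoeff, he]; exact hc

theorem nextCoeff_convex {f₀ f₁ : ℝ[X]} (h₀ : f₀.Monic) (h₁ : f₁.Monic)
    (hd : f₀.natDegree = f₁.natDegree) (s : ℝ) :
    (C (1 - s) * f₀ + C s * f₁).nextCoeff = (1 - s) * f₀.nextCoeff + s * f₁.nextCoeff := by
  simp only [nextCoeff, (natDegree_convex h₀ h₁ hd s).2, ← hd]
  split_ifs
  · simp
  · rw [coeff_add, coeff_C_mul, coeff_C_mul]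

/-- The reflection in the hyperplane orthogonal to the unit vector `u`. -/
def reflMatrix (u : n → ℝ) : Matrix n n ℝ := 1 - (2 : ℝ) • vecMulVec u u

theorem reflMatrix_isSymm (u : n → ℝ) : (reflMatrix u)ᵀ = reflMatrix u := by
  simp [reflMatrix, transpose_vecMulVec]

theorem reflMatrix_mul_self {u : n → ℝ} (hu : u ⬝ᵥ u = 1) :
    reflMatrix u * reflMatrix u = 1 := by
  have h : vecMulVec u u * vecMulVec u u = vecMulVec u u := by
    rw [vecMulVec_mul_vecMulVec, hu, one_smul]
  simp only [reflMatrix, sub_mul, mul_sub, one_mul, mul_one, Matrix.smul_mul, Matrix.mul_smul, h]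
  module

/-- With z the component of B u orthogonal to u, the conjugate is B - 2(u zᵀ + z uᵀ), and this
correction equals p pᵀ - q qᵀ for p = u - z and q = u + z. Both vectors have squared norm 1 + |z|² >
0. Thus B and its conjugate have a common positive rank-one perturbation. -/
theorem reflMatrix_conj {u : n → ℝ} (hu : u ⬝ᵥ u = 1) {B : Matrix n n ℝ} (hB : B.IsSymm) :
    ∃ p q : n → ℝ, 0 < p ⬝ᵥ p ∧ 0 < q ⬝ᵥ q ∧
      reflMatrix u * B * reflMatrix u + vecMulVec q q = B + vecMulVec p p := by
  set y := B *ᵥ u with hy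
  set k := u ⬝ᵥ y with hk
  set z := y - k • u with hz
  have huz : u ⬝ᵥ z = 0 := by
    rw [hz, dotProduct_sub, dotProduct_smul, hu, ← hk]; simp
  have hzu : z ⬝ᵥ u = 0 := by rw [dotProduct_comm]; exact huz
  have hzz : 0 ≤ z ⬝ᵥ z := Finset.sum_nonneg fun i _ => mul_self_nonneg (z i)
  have hBu : u ᵥ* B = y := by rw [hy, ← vecMul_transpose, hB.eq]
  refine ⟨u - z, u + z, ?_, ?_, ?_⟩
  · simp only [dotProduct_sub, sub_dotProduct, huz, hzu, hu]; linarith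
  · simp only [dotProduct_add, add_dotProduct, huz, hzu, hu]; linarith
  · have e1 : vecMulVec u u * B = vecMulVec u y := by rw [vecMulVec_mul, hBu]
    have e2 : B * vecMulVec u u = vecMulVec y u := by rw [mul_vecMulVec]
    have e3 : vecMulVec u y * vecMulVec u u = k • vecMulVec u u := by
      rw [vecMulVec_mul_vecMulVec, dotProduct_comm, ← hk, vecMulVec_smul]
    have hyz : y = z + k • u := by rw [hz]; abel
    simp only [reflMatrix, sub_mul, mul_sub, one_mul, mul_one, Matrix.smul_mul, Matrix.mul_smul, e1, e2, e3]
    rw [hyz]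
    ext i j
    simp only [Matrix.add_apply, Matrix.sub_apply, Matrix.smul_apply, vecMulVec_apply, Pi.add_apply, Pi.sub_apply,
      Pi.smul_apply, smul_eq_mul]
    ring

theorem isSymm_conj {R B : Matrix n n ℝ} (hB : B.IsSymm) : (R * B * Rᵀ).IsSymm := by
  rw [Matrix.IsSymm, transpose_mul, transpose_mul, transpose_transpose, hB.eq, Matrix.mul_assoc]

theorem isSymm_update {A : ι → Matrix n n ℝ} (hA : ∀ m, (A m).IsSymm) (m : ι)
    {B : Matrix n n ℝ} (hB : B.IsSymm) : ∀ i, (Function.update A m B i).IsSymm := by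
  intro i
  by_cases h : i = m
  · subst h; simpa using hB
  · simpa [h] using hA i

namespace IsRealStable

variable {F : (ι → Matrix n n ℝ) → ℝ[X]}

/-- By affinity the member of the pencil at t is F at A m + (1 + t) v vᵀ, which is real-rooted for
every real t. The leading coefficient of the difference is negative because v vᵀ has positive trace.
-/
theorem pencil (hF : IsRealStable F) {A : ι → Matrix n n ℝ} (hA : ∀ m, (A m).IsSymm) (m : ι)
    {v : n → ℝ} (hv : 0 < v ⬝ᵥ v) :
    (F (Function.update A m (A m + vecMulVec v v))).natDegree =
        (F (Function.update A m (A m + vecMulVec v v)) - F A).natDegree + 1 ∧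
      (F (Function.update A m (A m + vecMulVec v v)) - F A).leadingCoeff < 0 ∧
      ∀ t : ℝ, (F (Function.update A m (A m + vecMulVec v v)) +
        C t * (F (Function.update A m (A m + vecMulVec v v)) - F A)).Splits := by
  have hv' : ∀ t : ℝ, (A m + t • vecMulVec v v).IsSymm := fun t => by
    rw [Matrix.IsSymm, transpose_add, transpose_smul, transpose_vecMulVec, (hA m).eq]
  have hA1 := isSymm_update hA m (hv' 1)
  rw [one_smul] at hA1
  have hn : 0 < Fintype.card n := by
    rw [Fintype.card_pos_iff]
    by_contra h
    rw [not_nonempty_iff] at h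
    simp [dotProduct] at hv
  obtain ⟨h1, h2⟩ := natDegree_sub_of_nextCoeff_lt (hF.monic _ hA1) (hF.monic _ hA)
    (by rw [hF.natDegree _ hA1, hF.natDegree _ hA]) (by rw [hF.natDegree _ hA1]; exact hn)
    (by
      rw [hF.nextCoeff _ hA1, hF.nextCoeff _ hA, ← trace_sum, ← trace_sum, sum_update_add,
        trace_add, trace_vecMulVec]
      linarith)
  refine ⟨h1, h2, fun t => ?_⟩
  have := hF.splits _ (isSymm_update hA m (hv' (1 + t)))
  rw [hF.affine A hA] at this
  convert this using 1
  rw [map_add, map_one]; ring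

/-- By `reflMatrix_conj` both endpoints of the segment lie one rank-one step below the same tuple,
so `splits_convex_sub` applies with f the polynomial of that tuple. -/
theorem splits_segment (hF : IsRealStable F) {A : ι → Matrix n n ℝ} (hA : ∀ m, (A m).IsSymm)
    (m : ι) {u : n → ℝ} (hu : u ⬝ᵥ u = 1) {s : ℝ} (hs0 : 0 ≤ s) (hs1 : s ≤ 1) :
    (C (1 - s) * F A +
      C s * F (Function.update A m (reflMatrix u * A m * reflMatrix u))).Splits := by
  obtain ⟨p, q, hp, hq, hpq⟩ := reflMatrix_conj hu (hA m)
  set A' := Function.update A m (reflMatrix u * A m * reflMatrix u) with hA'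
  have hA's : ∀ i, (A' i).IsSymm := by
    refine isSymm_update hA m ?_
    have := isSymm_conj (R := reflMatrix u) (hA m)
    rwa [reflMatrix_isSymm] at this
  obtain ⟨d1, l1, s1⟩ := hF.pencil hA m hp
  obtain ⟨d2, l2, s2⟩ := hF.pencil hA's m hq
  have he : Function.update A' m (A' m + vecMulVec q q) =
      Function.update A m (A m + vecMulVec p p) := by
    rw [hA', Function.update_self, Function.update_idem, hpq]
  rw [he] at d2 l2 s2
  have hmon : (F (Function.update A m (A m + vecMulVec p p))).Monic := by
    refine hF.monic _ (isSymm_update hA m ?_)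
    rw [Matrix.IsSymm, transpose_add, transpose_vecMulVec, (hA m).eq]
  have := splits_convex_sub hmon d1 d2 l1 l2 s1 s2 hs0 hs1
  rwa [sub_sub_cancel, sub_sub_cancel] at this

/-- Real-rootedness is `splits_segment`. The other axioms survive because conjugation by a
reflection preserves the trace and sends v vᵀ to the rank-one matrix of the reflected vector, so
affinity holds for both terms. -/
theorem lazy (hF : IsRealStable F) (m : ι) {u : n → ℝ} (hu : u ⬝ᵥ u = 1) {s : ℝ}
    (hs0 : 0 ≤ s) (hs1 : s ≤ 1) :
    IsRealStable fun A => C (1 - s) * F A +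
      C s * F (Function.update A m (reflMatrix u * A m * reflMatrix u)) := by
  have hsym : ∀ {A : ι → Matrix n n ℝ}, (∀ m, (A m).IsSymm) →
      ∀ i, (Function.update A m (reflMatrix u * A m * reflMatrix u) i).IsSymm := by
    intro A hA
    refine isSymm_update hA m ?_
    have := isSymm_conj (R := reflMatrix u) (hA m)
    rwa [reflMatrix_isSymm] at this
  have hdeg : ∀ {A : ι → Matrix n n ℝ}, (∀ m, (A m).IsSymm) → (F A).natDegree =
      (F (Function.update A m (reflMatrix u * A m * reflMatrix u))).natDegree := by
    intro A hA
    rw [hF.natDegree _ hA, hF.natDegree _ (hsym hA)]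
  refine ⟨fun A hA => ?_, fun A hA => ?_, fun A hA => ?_, fun A hA => ?_, fun A hA i v t => ?_⟩
  · exact (natDegree_convex (hF.monic _ hA) (hF.monic _ (hsym hA)) (hdeg hA) s).1
  · rw [(natDegree_convex (hF.monic _ hA) (hF.monic _ (hsym hA)) (hdeg hA) s).2, hF.natDegree _ hA]
  · exact hF.splits_segment hA m hu hs0 hs1
  · rw [nextCoeff_convex (hF.monic _ hA) (hF.monic _ (hsym hA)) (hdeg hA) s, hF.nextCoeff _ hA,
      hF.nextCoeff _ (hsym hA)]
    have : ∑ i, (Function.update A m (reflMatrix u * A m * reflMatrix u) i).trace =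
        ∑ i, (A i).trace := by
      refine Finset.sum_congr rfl fun i _ => ?_
      by_cases h : i = m
      · subst h
        rw [Function.update_self, trace_mul_comm, ← Matrix.mul_assoc, reflMatrix_mul_self hu,
          Matrix.one_mul]
      · rw [Function.update_of_ne h]
    rw [this]; ring
  · have h1 := hF.affine A hA i v t
    by_cases h : i = m
    · subst h
      have h2 := hF.affine _ (hsym hA) i (reflMatrix u *ᵥ v) t
      have e : ∀ r : ℝ, reflMatrix u * (A i + r • vecMulVec v v) * reflMatrix u =
          reflMatrix u * A i * reflMatrix u +
            r • vecMulVec (reflMatrix u *ᵥ v) (reflMatrix u *ᵥ v) := by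
        intro r
        rw [Matrix.mul_add, Matrix.add_mul, Matrix.mul_smul, Matrix.smul_mul, mul_vecMulVec, vecMulVec_mul]
        congr 3
        conv_lhs => rw [← reflMatrix_isSymm u]
        rw [vecMul_transpose]
      have e1 := e 1
      rw [one_smul, one_smul] at e1
      simp only [Function.update_self, Function.update_idem] at h2 ⊢
      rw [h1, e, e1, h2]
      ring
    · have h2 := hF.affine _ (hsym hA) i v t
      have hmi : m ≠ i := fun h' => h h'.symm
      simp only [Function.update_of_ne h, Function.update_of_ne hmi] at h2 ⊢
      rw [Function.update_comm h, Function.update_comm h, h1]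
      rw [Function.update_comm hmi, Function.update_comm hmi] at h2
      rw [Function.update_comm hmi, Function.update_comm hmi, h2]
      ring

end IsRealStable

end Interlacing

end AdditiveProduct

/-! ### Uniform permutations as products of lazy transpositions -/

namespace AdditiveProduct

section Averaging

open Polynomial Matrix Equiv
open scoped BigOperators

set_option linter.unusedSectionVars false

theorem expect_perm_apply {α M : Type*} [Fintype α] [DecidableEq α] [AddCommGroup M] [Module ℚ≥0 M]
    (a : α) (f : α → M) : 𝔼 π : Perm α, f (π a) = 𝔼 x, f x := by
  have h : ∀ b, 𝔼 π : Perm α, f (π b) = 𝔼 π : Perm α, f (π a) := fun b =>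
    Fintype.expect_equiv (Equiv.mulRight (swap a b)) _ _ fun π => by simp
  have : Nonempty α := ⟨a⟩
  calc 𝔼 π : Perm α, f (π a) = 𝔼 _b : α, 𝔼 π : Perm α, f (π a) := (Fintype.expect_const _).symm
    _ = 𝔼 b : α, 𝔼 π : Perm α, f (π b) := Finset.expect_congr rfl fun b _ => (h b).symm
    _ = 𝔼 π : Perm α, 𝔼 b : α, f (π b) := Finset.expect_comm _ _ _
    _ = 𝔼 _π : Perm α, 𝔼 b : α, f b :=
      Finset.expect_congr rfl fun π _ => Fintype.expect_equiv π _ _ fun _ => rfl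
    _ = _ := Fintype.expect_const _

theorem expect_option {α : Type*} [Fintype α] [Nonempty α] (f : Option α → ℝ[X]) :
    𝔼 x, f x = C (1 - (Fintype.card α : ℝ) / (Fintype.card α + 1)) * f none +
      C ((Fintype.card α : ℝ) / (Fintype.card α + 1)) * 𝔼 x, f (some x) := by
  have hk : (0 : ℝ) < Fintype.card α := by exact_mod_cast Fintype.card_pos
  have hs : ∑ x, f (some x) = C (Fintype.card α : ℝ) * 𝔼 x, f (some x) := by
    rw [← Fintype.card_smul_expect, nsmul_eq_mul, map_natCast]
  have ht : C ((Fintype.card α : ℝ) + 1) * 𝔼 x, f x = f none + ∑ x, f (some x) := by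
    rw [← Fintype.sum_option, ← Fintype.card_smul_expect, nsmul_eq_mul, Fintype.card_option]
    simp
  have hne : C ((Fintype.card α : ℝ) + 1) ≠ 0 := by
    rw [Ne, C_eq_zero]; positivity
  apply mul_left_cancel₀ hne
  rw [ht, hs, mul_add, ← mul_assoc, ← mul_assoc, ← C_mul, ← C_mul]
  congr 2
  · rw [mul_sub, mul_div_cancel₀ _ (by positivity)]; simp
  · rw [mul_div_cancel₀ _ (by positivity)]

/-- A class of functions closed under every lazy transposition is closed under averaging over the
whole symmetric group. -/
def AveragesPerm (α : Type) [Fintype α] [DecidableEq α] {X : Type*} (S : Set (X → ℝ[X])) : Prop :=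
  ∀ ψ : Perm α → X → X, (∀ x, ψ 1 x = x) → (∀ σ τ x, ψ (σ * τ) x = ψ σ (ψ τ x)) →
    (∀ F ∈ S, ∀ a b : α, a ≠ b → ∀ p : ℝ, 0 ≤ p → p ≤ 1 →
      (fun x => C (1 - p) * F x + C p * F (ψ (swap a b) x)) ∈ S) →
    ∀ F ∈ S, (fun x => 𝔼 σ : Perm α, F (ψ σ x)) ∈ S

theorem AveragesPerm.congr {α β : Type} [Fintype α] [DecidableEq α] [Fintype β] [DecidableEq β]
    {X : Type*} {S : Set (X → ℝ[X])} (h : AveragesPerm α S) (e : α ≃ β) : AveragesPerm β S := by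
  intro ψ h1 hmul hlazy F hF
  have := h (fun σ => ψ (e.permCongr σ)) (fun x => by
      rw [show e.permCongr 1 = 1 by ext; simp]; exact h1 x)
    (fun σ τ x => by rw [← hmul, ← Equiv.permCongr_mul])
    (fun F hF a b hab p hp0 hp1 => by
      have := hlazy F hF (e a) (e b) (e.injective.ne hab) p hp0 hp1
      have hsw : e.permCongr (swap a b) = swap (e a) (e b) := by
        ext x; simp [Equiv.permCongr_apply, swap_apply_def, Equiv.symm_apply_eq]
        split_ifs <;> simp
      rw [hsw]; exact this) F hF
  convert this using 2 with x
  exact (Fintype.expect_equiv e.permCongr _ _ fun σ => rfl).symm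

/-- A uniform permutation of `Option α` is a uniform permutation of α, followed by a lazy
transposition of `none` with one fixed point a, followed by another uniform permutation π of α.
Moving π past the transposition replaces a by π a, which is uniform, and the products of `swap none
x` with permutations of α run over the cosets once each. -/
theorem AveragesPerm.option {α : Type} [Fintype α] [DecidableEq α]
    {X : Type*} {S : Set (X → ℝ[X])} (h : AveragesPerm α S) : AveragesPerm (Option α) S := by
  intro ψ h1 hmul hlazy F hF
  have hmul' : ∀ σ τ : Perm α, optionCongr (σ * τ) = optionCongr σ * optionCongr τ := by
    intro σ τ; ext x; cases x <;> simp
  have hone' : optionCongr (1 : Perm α) = 1 := by ext x; cases x <;> simp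
  have havg := h (fun σ => ψ (optionCongr σ)) (fun x => by rw [hone', h1])
    (fun σ τ x => by rw [hmul', hmul])
    (fun F hF a b hab p hp0 hp1 => by
      have := hlazy F hF (some a) (some b) (by simpa using hab) p hp0 hp1
      rw [optionCongr_swap]; exact this)
  have hdec : ∀ φ : Perm (Option α) → ℝ[X],
      𝔼 σ, φ σ = 𝔼 x : Option α, 𝔼 π : Perm α, φ (swap none x * optionCongr π) := by
    intro φ
    rw [← Finset.expect_product', Finset.univ_product_univ]
    refine (Fintype.expect_equiv Perm.decomposeOption.symm _ _ fun p => ?_).symm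
    rw [Perm.decomposeOption_symm_apply]
  have hself : swap (none : Option α) none = 1 := swap_self _
  by_cases hα : IsEmpty α
  · convert havg F hF using 2 with x
    rw [hdec]
    have : ∀ y : Option α, 𝔼 π : Perm α, F (ψ (swap none y * optionCongr π) x) =
        𝔼 π : Perm α, F (ψ (optionCongr π) x) := fun y => by
      have hy : y = none := by
        cases y with
        | none => rfl
        | some a => exact hα.elim a
      rw [hy, hself]
      simp only [one_mul]
    rw [Finset.expect_congr rfl fun y _ => this y, Fintype.expect_const]
  have hne : Nonempty α := not_isEmpty_iff.1 hα
  obtain ⟨a⟩ := id hne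
  -- The probability that a uniform permutation of `Option α` moves `none`.
  set p : ℝ := (Fintype.card α : ℝ) / (Fintype.card α + 1) with hp
  have hp0 : 0 ≤ p := by positivity
  have hp1 : p ≤ 1 := by rw [hp, div_le_one (by positivity)]; linarith
  have h3 := havg _ (hlazy _ (havg F hF) none (some a) (by simp) p hp0 hp1)
  convert h3 using 2 with x
  rw [hdec, expect_option, ← hp, Finset.expect_add_distrib, ← Finset.mul_expect,
    ← Finset.mul_expect]
  congr 2
  · have : ∀ g : Perm α, 𝔼 π : Perm α, F (ψ (optionCongr π) (ψ (optionCongr g) x)) =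
        𝔼 π : Perm α, F (ψ (optionCongr π) x) := fun g =>
      Fintype.expect_equiv (Equiv.mulRight g) _ _ fun π => by
        rw [← hmul, ← hmul']; rfl
    rw [Finset.expect_congr rfl fun g _ => this g, Fintype.expect_const]
    refine Finset.expect_congr rfl fun π _ => ?_
    rw [hself, one_mul]
  · have : ∀ π : Perm α, 𝔼 g : Perm α, F (ψ (optionCongr π) (ψ (swap none (some a))
        (ψ (optionCongr g) x))) =
        𝔼 g : Perm α, F (ψ (swap none (some (π a)) * optionCongr g) x) := fun π =>
      Fintype.expect_equiv (Equiv.mulLeft π) _ _ fun g => by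
        rw [← hmul, ← hmul]
        congr 2
        change _ = swap none (some (π a)) * optionCongr (π * g)
        rw [hmul', ← mul_assoc]
        congr 1
        have := Equiv.mul_swap_eq_swap_mul (optionCongr π) none (some a)
        simpa using this
    symm
    rw [Finset.expect_comm]
    rw [Finset.expect_congr rfl fun π _ => this π]
    exact expect_perm_apply a fun y =>
      𝔼 g : Perm α, F (ψ (swap none (some y) * optionCongr g) x)

theorem averagesPerm_fin (N : ℕ) {X : Type*} (S : Set (X → ℝ[X])) : AveragesPerm (Fin N) S := by
  induction N with
  | zero =>
    intro ψ h1 hmul hlazy F hF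
    convert hF using 2 with x
    have : ∀ σ : Perm (Fin 0), F (ψ σ x) = F x := fun σ => by
      rw [Subsingleton.elim σ 1, h1]
    rw [Finset.expect_congr rfl fun σ _ => this σ, Fintype.expect_const]
  | succ N ih => exact ih.option.congr (finSuccEquiv N).symm

/-- Resampling one coordinate does not change a uniform average. -/
theorem expect_update {J α M : Type*} [Fintype J] [DecidableEq J] [Fintype α] [AddCommGroup M]
    [Module ℚ≥0 M] (j : J) (f : (J → α) → M) :
    𝔼 Q : J → α, 𝔼 a : α, f (Function.update Q j a) = 𝔼 Q : J → α, f Q := by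
  rcases isEmpty_or_nonempty (J → α) with h | h
  · simp
  have : Nonempty α := ⟨h.some j⟩
  have : 𝔼 Q : J → α, f Q = 𝔼 Q : J → α, 𝔼 _a : α, f Q :=
    Finset.expect_congr rfl fun Q _ => (Fintype.expect_const _).symm
  rw [this, ← Finset.expect_product', ← Finset.expect_product', Finset.univ_product_univ]
  refine Fintype.expect_equiv
    ⟨fun p => (Function.update p.1 j p.2, p.1 j), fun p => (Function.update p.1 j p.2, p.1 j),
      fun p => by simp, fun p => by simp⟩ _ _ fun p => ?_
  rfl

end Averaging

end AdditiveProduct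

/-! ### Block conjugation and the choice of a good lift -/

namespace AdditiveProduct

section BlockAction

open Polynomial Matrix Equiv
open scoped BigOperators

set_option linter.unusedSectionVars false

variable {ι V κ : Type*} [Fintype ι] [DecidableEq ι] [Fintype V] [DecidableEq V] [Fintype κ]
  [DecidableEq κ]

/-- Conjugation of each matrix of a tuple by its own block-diagonal matrix. -/
def blockConj (g : ι × V → Matrix κ κ ℝ) (A : ι → Matrix (κ × V) (κ × V) ℝ) :
    ι → Matrix (κ × V) (κ × V) ℝ := fun m =>
  blockDiagonal (fun v => g (m, v)) * A m * (blockDiagonal fun v => g (m, v))ᵀ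

theorem blockConj_one (A : ι → Matrix (κ × V) (κ × V) ℝ) : blockConj (fun _ => 1) A = A := by
  funext m
  have : (blockDiagonal fun _ : V => (1 : Matrix κ κ ℝ)) = 1 := blockDiagonal_one
  simp [blockConj, this]

theorem blockConj_mul (g h : ι × V → Matrix κ κ ℝ) (A : ι → Matrix (κ × V) (κ × V) ℝ) :
    blockConj (fun j => g j * h j) A = blockConj g (blockConj h A) := by
  funext m
  simp only [blockConj, blockDiagonal_mul, transpose_mul, Matrix.mul_assoc]

theorem blockConj_isSymm (g : ι × V → Matrix κ κ ℝ) {A : ι → Matrix (κ × V) (κ × V) ℝ}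
    (hA : ∀ m, (A m).IsSymm) (m : ι) : (blockConj g A m).IsSymm := isSymm_conj (hA m)

/-- The vector on `κ × V` supported on the block of `v`. -/
def liftVec (v : V) (u : κ → ℝ) : κ × V → ℝ := fun x => if x.2 = v then u x.1 else 0

theorem liftVec_dotProduct (v : V) (u w : κ → ℝ) : liftVec v u ⬝ᵥ liftVec v w = u ⬝ᵥ w := by
  simp [dotProduct, liftVec, Fintype.sum_prod_type]

theorem blockDiagonal_update_one_add (v : V) (X : Matrix κ κ ℝ) (u w : κ → ℝ) (t : ℝ) :
    blockDiagonal (Function.update 1 v (X + t • vecMulVec u w)) =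
      blockDiagonal (Function.update 1 v X) + t • vecMulVec (liftVec v u) (liftVec v w) := by
  ext ⟨p, x⟩ ⟨q, y⟩
  simp only [blockDiagonal_apply, Matrix.add_apply, Matrix.smul_apply, vecMulVec_apply, liftVec]
  by_cases h : x = y
  · subst h
    by_cases hx : x = v
    · subst hx; simp [vecMulVec_apply]
    · simp [hx]
  · by_cases hx : x = v
    · subst hx; simp [h, Ne.symm h]
    · simp [h, hx]

theorem update_one_one {J M : Type*} [DecidableEq J] [One M] (j : J) :
    Function.update (1 : J → M) j 1 = 1 := Function.update_eq_self j (1 : J → M)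

theorem blockDiagonal_update_one_one (v : V) :
    blockDiagonal (Function.update 1 v (1 : Matrix κ κ ℝ)) = 1 := by
  rw [update_one_one]
  exact blockDiagonal_one

/-- Hence a transposition placed at a single vertex of a single atom conjugates one summand by one
reflection, the situation of `IsRealStable.lazy`. -/
theorem blockDiagonal_update_reflMatrix (v : V) (u : κ → ℝ) :
    blockDiagonal (Function.update 1 v (reflMatrix u)) = reflMatrix (liftVec v u) := by
  rw [reflMatrix, sub_eq_add_neg, ← neg_smul, blockDiagonal_update_one_add,
    blockDiagonal_update_one_one, reflMatrix, sub_eq_add_neg, ← neg_smul]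

theorem blockConj_single (j : ι × V) (X : Matrix κ κ ℝ) (A : ι → Matrix (κ × V) (κ × V) ℝ) :
    blockConj (Function.update 1 j X) A = Function.update A j.1
      (blockDiagonal (Function.update 1 j.2 X) * A j.1 *
        (blockDiagonal (Function.update 1 j.2 X))ᵀ) := by
  funext m
  by_cases h : m = j.1
  · subst h
    have : (fun v => (Function.update 1 j X : ι × V → Matrix κ κ ℝ) (j.1, v)) =
        (Function.update 1 j.2 X : V → Matrix κ κ ℝ) := by
      funext v
      by_cases hv : v = j.2
      · subst hv; simp
      · rw [Function.update_of_ne hv, Function.update_of_ne (fun h => hv (by rw [← h]))]; rfl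
    rw [blockConj, this, Function.update_self]
  · have : (fun v => (Function.update 1 j X : ι × V → Matrix κ κ ℝ) (m, v)) = fun _ => 1 := by
      funext v
      rw [Function.update_of_ne (fun h' => h (by rw [← h']))]; rfl
    have h1 : (blockDiagonal fun _ : V => (1 : Matrix κ κ ℝ)) = 1 := blockDiagonal_one
    rw [blockConj, this, Function.update_of_ne h, h1]
    simp

/-- For a representation by orthogonal matrices in which transpositions act as reflections, some
assignment of permutations to the blocks does at least as well as the average. -/
theorem exists_rootsDominated_expect {N : ℕ} (ρ : Perm (Fin N) →* Matrix κ κ ℝ)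
    (hswap : ∀ a b, a ≠ b → ∃ u : κ → ℝ, u ⬝ᵥ u = 1 ∧ ρ (swap a b) = reflMatrix u)
    {F₀ : (ι → Matrix (κ × V) (κ × V) ℝ) → ℝ[X]} (hF₀ : IsRealStable F₀)
    {A : ι → Matrix (κ × V) (κ × V) ℝ} (hA : ∀ m, (A m).IsSymm) :
    ∃ Q : ι × V → Perm (Fin N), RootsDominated (F₀ (blockConj (fun j => ρ (Q j)) A))
      (𝔼 Q : ι × V → Perm (Fin N), F₀ (blockConj (fun j => ρ (Q j)) A)) := by
  classical
  -- The class to which `averagesPerm_fin` is applied: stable functionals whose value at every tuple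
  -- dominates `F₀` at some assignment. Under a lazy transposition, stability persists by `lazy`;
  -- domination persists by passing to the better endpoint and, if this is the conjugated one,
  -- multiplying the transposition into the assignment.
  set S : Set ((ι → Matrix (κ × V) (κ × V) ℝ) → ℝ[X]) := {F | IsRealStable F ∧
    ∀ A : ι → Matrix (κ × V) (κ × V) ℝ, (∀ m, (A m).IsSymm) → ∃ Q : ι × V → Perm (Fin N),
      RootsDominated (F₀ (blockConj (fun j => ρ (Q j)) A)) (F A)} with hS
  have hmem : F₀ ∈ S := ⟨hF₀, fun A _ => ⟨fun _ => 1, by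
    simp only [map_one, blockConj_one]; exact RootsDominated.refl _⟩⟩
  have hsingle : ∀ (j : ι × V) (σ : Perm (Fin N)),
      (fun i => ρ (Pi.mulSingle (M := fun _ => Perm (Fin N)) j σ i)) =
        (Function.update 1 j (ρ σ) : ι × V → Matrix κ κ ℝ) := by
    intro j σ
    funext i
    by_cases h : i = j
    · subst h; simp
    · simp [h]
  have havg : ∀ j : ι × V, ∀ F ∈ S,
      (fun A => 𝔼 σ : Perm (Fin N), F (blockConj (Function.update 1 j (ρ σ)) A)) ∈ S := by
    intro j
    refine averagesPerm_fin N S (fun σ A => blockConj (Function.update 1 j (ρ σ)) A) ?_ ?_ ?_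
    · intro A
      rw [map_one, update_one_one]
      exact blockConj_one A
    · intro σ τ A
      rw [← blockConj_mul]
      congr 1
      funext i
      by_cases h : i = j
      · subst h; simp
      · simp [h]
    · intro F hF a b hab p hp0 hp1
      obtain ⟨u, hu, hρ⟩ := hswap a b hab
      have hu' : liftVec j.2 u ⬝ᵥ liftVec j.2 u = 1 := by rw [liftVec_dotProduct, hu]
      have hact : ∀ B : ι → Matrix (κ × V) (κ × V) ℝ,
          blockConj (Function.update 1 j (ρ (swap a b))) B = Function.update B j.1
            (reflMatrix (liftVec j.2 u) * B j.1 * reflMatrix (liftVec j.2 u)) := by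
        intro B
        rw [blockConj_single, hρ, blockDiagonal_update_reflMatrix, reflMatrix_isSymm]
      refine ⟨?_, fun B hB => ?_⟩
      · simp only [hact]
        exact hF.1.lazy j.1 hu' hp0 hp1
      · have hB' : ∀ m, (blockConj (Function.update 1 j (ρ (swap a b))) B m).IsSymm :=
          blockConj_isSymm _ hB
        rcases rootsDominated_convex (hF.1.monic B hB) (hF.1.monic _ hB')
          (by rw [hF.1.natDegree _ hB, hF.1.natDegree _ hB']) hp0 hp1
          (fun s hs0 hs1 => by
            rw [hact]; exact hF.1.splits_segment hB j.1 hu' hs0 hs1) with h | h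
        · obtain ⟨Q, hQ⟩ := hF.2 B hB
          exact ⟨Q, hQ.trans h⟩
        · obtain ⟨Q, hQ⟩ := hF.2 _ hB'
          refine ⟨fun i => Q i * Pi.mulSingle (M := fun _ => Perm (Fin N)) j (swap a b) i, ?_⟩
          have he : (fun i => ρ (Q i * Pi.mulSingle (M := fun _ => Perm (Fin N)) j (swap a b) i)) =
              fun i => ρ (Q i) * (Function.update 1 j (ρ (swap a b)) : ι × V → Matrix κ κ ℝ) i := by
            rw [← hsingle]
            simp only [map_mul]
          rw [he, blockConj_mul]
          exact hQ.trans h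
  -- The blocks are averaged one at a time: those in `T` are random, the others carry the identity.
  have hall : ∀ T : Finset (ι × V), (fun A => 𝔼 Q : ι × V → Perm (Fin N),
      F₀ (blockConj (fun j => ρ (T.piecewise Q 1 j)) A)) ∈ S := by
    intro T
    induction T using Finset.induction_on with
    | empty =>
      convert hmem using 2 with B
      simp only [Finset.piecewise_empty, Pi.one_apply, map_one, blockConj_one,
        Fintype.expect_const]
    | insert j T hj ih =>
      convert havg j _ ih using 2 with B
      rw [Finset.expect_comm, ← expect_update j]
      refine Finset.expect_congr rfl fun Q _ => Finset.expect_congr rfl fun σ _ => ?_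
      rw [← blockConj_mul]
      congr 2
      funext i
      by_cases h : i = j
      · subst h; simp [hj]
      · by_cases hi : i ∈ T <;> simp [h, hi]
  obtain ⟨Q, hQ⟩ := (hall Finset.univ).2 A hA
  simp only [Finset.piecewise_univ] at hQ
  exact ⟨Q, hQ⟩

end BlockAction

end AdditiveProduct

/-! ### Determinants along plane rotations -/

namespace AdditiveProduct

section Trig

open Matrix
open scoped BigOperators

set_option linter.unusedSectionVars false

/-- Trigonometric polynomials of degree at most two. -/
def IsTrigPoly (f : ℝ → ℝ) : Prop :=
  ∃ a₀ a₁ b₁ a₂ b₂ : ℝ, ∀ θ, f θ = a₀ + a₁ * Real.cos θ + b₁ * Real.sin θ +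
    a₂ * Real.cos (2 * θ) + b₂ * Real.sin (2 * θ)

theorem IsTrigPoly.const_mul {f : ℝ → ℝ} (hf : IsTrigPoly f) (r : ℝ) :
    IsTrigPoly fun θ => r * f θ := by
  obtain ⟨a₀, a₁, b₁, a₂, b₂, h⟩ := hf
  exact ⟨r * a₀, r * a₁, r * b₁, r * a₂, r * b₂, fun θ => by simp only [h]; ring⟩

theorem IsTrigPoly.expect {Γ : Type*} [Fintype Γ] {f : Γ → ℝ → ℝ} (hf : ∀ γ, IsTrigPoly (f γ)) :
    IsTrigPoly fun θ => 𝔼 γ, f γ θ := by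
  choose a₀ a₁ b₁ a₂ b₂ h using hf
  refine ⟨𝔼 γ, a₀ γ, 𝔼 γ, a₁ γ, 𝔼 γ, b₁ γ, 𝔼 γ, a₂ γ, 𝔼 γ, b₂ γ, fun θ => ?_⟩
  simp only [h, Finset.expect_add_distrib, Finset.expect_mul]

theorem cos_two_pi_div_three : Real.cos (2 * Real.pi / 3) = -1 / 2 := by
  rw [show 2 * Real.pi / 3 = Real.pi - Real.pi / 3 by ring, Real.cos_pi_sub, Real.cos_pi_div_three]
  ring

theorem sin_two_pi_div_three : Real.sin (2 * Real.pi / 3) = √3 / 2 := by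
  rw [show 2 * Real.pi / 3 = Real.pi - Real.pi / 3 by ring, Real.sin_pi_sub, Real.sin_pi_div_three]

/-- Averaging over three shifts by a third of a turn kills the frequencies 1 and 2, neither being
divisible by 3, and leaves the constant term. -/
theorem IsTrigPoly.eq_of_periodic_third {f : ℝ → ℝ} (hf : IsTrigPoly f)
    (hp : ∀ θ, f (θ + 2 * Real.pi / 3) = f θ) (θ : ℝ) : f θ = f 0 := by
  obtain ⟨a₀, a₁, b₁, a₂, b₂, h⟩ := hf
  have key : ∀ θ, f θ = a₀ := by
    intro θ
    have h1 := hp θ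
    have h2 := hp (θ + 2 * Real.pi / 3)
    have h3 : (√3 : ℝ) * √3 = 3 := Real.mul_self_sqrt (by norm_num)
    rw [h1] at h2
    rw [h] at h1 h2
    rw [h θ] at h1 h2 ⊢
    simp only [mul_add, Real.cos_add, Real.sin_add, Real.cos_two_mul, Real.sin_two_mul,
      cos_two_pi_div_three, sin_two_pi_div_three] at h1 h2 ⊢
    linear_combination (-1 / 3 : ℝ) * h1 + (-1 / 3 : ℝ) * h2 +
      (-1 / 12 : ℝ) * (a₁ * Real.cos θ + b₁ * Real.sin θ + 2 * b₂ * Real.cos θ * Real.sin θ +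
        a₂ * (2 * Real.cos θ ^ 2 - 1)) * h3
  rw [key, key]

/-- The same with four shifts, as 4 divides neither 1 nor 2. A half turn would not do, since
frequency 2 survives it. -/
theorem IsTrigPoly.eq_of_periodic_quarter {f : ℝ → ℝ} (hf : IsTrigPoly f)
    (hp : ∀ θ, f (θ + Real.pi / 2) = f θ) (θ : ℝ) : f θ = f 0 := by
  obtain ⟨a₀, a₁, b₁, a₂, b₂, h⟩ := hf
  have key : ∀ θ, f θ = a₀ := by
    intro θ
    have h1 := hp θ
    have h2 := hp (θ + Real.pi / 2)
    have h3 := hp (θ + Real.pi / 2 + Real.pi / 2)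
    rw [h2, h1] at h3
    rw [h1] at h2
    rw [h] at h1 h2 h3
    rw [h θ] at h1 h2 h3 ⊢
    simp only [mul_add, Real.cos_add, Real.sin_add, Real.cos_two_mul, Real.sin_two_mul,
      Real.cos_pi_div_two, Real.sin_pi_div_two] at h1 h2 h3 ⊢
    linear_combination (-1 / 4 : ℝ) * (h1 + h2 + h3)
  rw [key, key]

/-- The determinant is affine in each of the four rank-one coefficients, so setting them equal in
pairs gives degree at most two in z and in w. The relation z w = 1 then collapses the mixed
monomials, leaving only powers z², z, 1, w, w². -/
theorem exists_det_pencil {n : Type*} [Fintype n] [DecidableEq n] (M : Matrix n n ℂ)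
    (l₁ l₂ l₃ l₄ r₁ r₂ r₃ r₄ : n → ℂ) :
    ∃ c₀ c₁ c₂ c₃ c₄ : ℂ, ∀ z w : ℂ, z * w = 1 →
      (M + (z - 1) • vecMulVec l₁ r₁ + (z - 1) • vecMulVec l₂ r₂ + (w - 1) • vecMulVec l₃ r₃ +
        (w - 1) • vecMulVec l₄ r₄).det = c₀ + c₁ * z + c₂ * z ^ 2 + c₃ * w + c₄ * w ^ 2 := by
  set d : ℂ → ℂ → ℂ → ℂ → ℂ := fun x₁ x₂ x₃ x₄ =>
    (M + x₁ • vecMulVec l₁ r₁ + x₂ • vecMulVec l₂ r₂ + x₃ • vecMulVec l₃ r₃ +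
        x₄ • vecMulVec l₄ r₄).det with hd
  have aff : ∀ (B : Matrix n n ℂ) (l r : n → ℂ) (t : ℂ), (B + t • vecMulVec l r).det =
      (B + (0 : ℂ) • vecMulVec l r).det +
        t * ((B + (1 : ℂ) • vecMulVec l r).det - (B + (0 : ℂ) • vecMulVec l r).det) := by
    intro B l r t
    obtain ⟨D, hD⟩ := exists_det_add_smul_vecMulVec B l r
    rw [hD, hD, hD]; ring
  have h4 : ∀ a b c x, d a b c x = d a b c 0 + x * (d a b c 1 - d a b c 0) :=
    fun a b c x => aff _ _ _ _
  have h3 : ∀ a b c x, d a b c x = d a b 0 x + c * (d a b 1 x - d a b 0 x) := by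
    intro a b c x
    have e : ∀ t : ℂ, M + a • vecMulVec l₁ r₁ + b • vecMulVec l₂ r₂ + t • vecMulVec l₃ r₃ +
        x • vecMulVec l₄ r₄ = M + a • vecMulVec l₁ r₁ + b • vecMulVec l₂ r₂ +
        x • vecMulVec l₄ r₄ + t • vecMulVec l₃ r₃ := fun t => by abel
    simp only [hd, e]
    exact aff _ _ _ _
  have h2 : ∀ a b c x, d a b c x = d a 0 c x + b * (d a 1 c x - d a 0 c x) := by
    intro a b c x
    have e : ∀ t : ℂ, M + a • vecMulVec l₁ r₁ + t • vecMulVec l₂ r₂ + c • vecMulVec l₃ r₃ +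
        x • vecMulVec l₄ r₄ = M + a • vecMulVec l₁ r₁ + c • vecMulVec l₃ r₃ +
        x • vecMulVec l₄ r₄ + t • vecMulVec l₂ r₂ := fun t => by abel
    simp only [hd, e]
    exact aff _ _ _ _
  have h1 : ∀ a b c x, d a b c x = d 0 b c x + a * (d 1 b c x - d 0 b c x) := by
    intro a b c x
    have e : ∀ t : ℂ, M + t • vecMulVec l₁ r₁ + b • vecMulVec l₂ r₂ + c • vecMulVec l₃ r₃ +
        x • vecMulVec l₄ r₄ = M + b • vecMulVec l₂ r₂ + c • vecMulVec l₃ r₃ +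
        x • vecMulVec l₄ r₄ + t • vecMulVec l₁ r₁ := fun t => by abel
    simp only [hd, e]
    exact aff _ _ _ _
  have quad : ∀ g : ℂ → ℂ → ℂ, (∀ a b, g a b = g 0 b + a * (g 1 b - g 0 b)) →
      (∀ a b, g a b = g a 0 + b * (g a 1 - g a 0)) →
      ∀ x, g x x = g 0 0 + (g 1 0 + g 0 1 - 2 * g 0 0) * x +
        (g 1 1 - g 1 0 - g 0 1 + g 0 0) * x ^ 2 := by
    intro g ha hb x
    rw [ha x x, hb 0 x, hb 1 x]; ring
  have hx : ∀ x y, d x x y y = d 0 0 y y + (d 1 0 y y + d 0 1 y y - 2 * d 0 0 y y) * x +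
      (d 1 1 y y - d 1 0 y y - d 0 1 y y + d 0 0 y y) * x ^ 2 := fun x y =>
    quad (fun a b => d a b y y) (fun a b => h1 a b y y) (fun a b => h2 a b y y) x
  have hy : ∀ a b y, d a b y y = d a b 0 0 + (d a b 1 0 + d a b 0 1 - 2 * d a b 0 0) * y +
      (d a b 1 1 - d a b 1 0 - d a b 0 1 + d a b 0 0) * y ^ 2 := fun a b y =>
    quad (fun p q => d a b p q) (fun p q => h3 a b p q) (fun p q => h4 a b p q) y
  have hpoly : ∃ k₀₀ k₀₁ k₀₂ k₁₀ k₁₁ k₁₂ k₂₀ k₂₁ k₂₂ : ℂ, ∀ x y, d x x y y =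
      (k₀₀ + k₀₁ * y + k₀₂ * y ^ 2) + (k₁₀ + k₁₁ * y + k₁₂ * y ^ 2) * x +
      (k₂₀ + k₂₁ * y + k₂₂ * y ^ 2) * x ^ 2 := by
    have hy' : ∀ a b, ∃ p q r : ℂ, ∀ y, d a b y y = p + q * y + r * y ^ 2 := fun a b =>
      ⟨_, _, _, fun y => hy a b y⟩
    obtain ⟨p₀, q₀, r₀, e₀⟩ := hy' 0 0
    obtain ⟨p₁, q₁, r₁, e₁⟩ := hy' 1 0
    obtain ⟨p₂, q₂, r₂, e₂⟩ := hy' 0 1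
    obtain ⟨p₃, q₃, r₃, e₃⟩ := hy' 1 1
    refine ⟨p₀, q₀, r₀, p₁ + p₂ - 2 * p₀, q₁ + q₂ - 2 * q₀, r₁ + r₂ - 2 * r₀,
      p₃ - p₁ - p₂ + p₀, q₃ - q₁ - q₂ + q₀, r₃ - r₁ - r₂ + r₀, fun x y => ?_⟩
    rw [hx, e₀, e₁, e₂, e₃]; ring
  obtain ⟨k₀₀, k₀₁, k₀₂, k₁₀, k₁₁, k₁₂, k₂₀, k₂₁, k₂₂, hk⟩ := hpoly
  -- Obtained by expanding the sum of kᵢⱼ (z - 1)ⁱ (w - 1)ʲ and reducing by z w = 1.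
  refine ⟨k₀₀ - k₀₁ + k₀₂ - k₁₀ + 2 * k₁₁ - 3 * k₁₂ + k₂₀ - 3 * k₂₁ + 6 * k₂₂,
    k₁₀ - k₁₁ + k₁₂ - 2 * k₂₀ + 3 * k₂₁ - 4 * k₂₂, k₂₀ - k₂₁ + k₂₂,
    k₀₁ - 2 * k₀₂ - k₁₁ + 3 * k₁₂ + k₂₁ - 4 * k₂₂, k₀₂ - k₁₂ + k₂₂, fun z w hzw => ?_⟩
  have := hk (z - 1) (w - 1)
  simp only [hd] at this
  rw [this]
  linear_combination (k₁₁ + k₂₁ * (z - 2) + k₁₂ * (w - 2) + k₂₂ * (z * w + 5 - 2 * z - 2 * w)) * hzw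

variable {n : Type*} [Fintype n] [DecidableEq n]

/-- The rotation by `θ` in the oriented plane spanned by the orthonormal pair `a`, `b`. -/
noncomputable def rotMatrix (a b : n → ℝ) (θ : ℝ) : Matrix n n ℝ :=
  1 + (Real.cos θ - 1) • vecMulVec a a + (Real.cos θ - 1) • vecMulVec b b +
    Real.sin θ • vecMulVec b a + (-Real.sin θ) • vecMulVec a b

/-- Orthonormal pairs of vectors. -/
structure IsOrthoPair (a b : n → ℝ) : Prop where
  left : a ⬝ᵥ a = 1
  right : b ⬝ᵥ b = 1
  inner : a ⬝ᵥ b = 0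

variable {a b : n → ℝ}

theorem IsOrthoPair.inner' (h : IsOrthoPair a b) : b ⬝ᵥ a = 0 := by
  rw [dotProduct_comm]; exact h.inner

theorem IsOrthoPair.symm (h : IsOrthoPair a b) : IsOrthoPair b a := ⟨h.right, h.left, h.inner'⟩

theorem rotMatrix_transpose (a b : n → ℝ) (θ : ℝ) : (rotMatrix a b θ)ᵀ = rotMatrix b a θ := by
  simp only [rotMatrix, transpose_add, transpose_one, transpose_smul, transpose_vecMulVec]
  module

theorem rotMatrix_swap (a b : n → ℝ) (θ : ℝ) : rotMatrix b a θ = rotMatrix a b (-θ) := by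
  simp only [rotMatrix, Real.cos_neg, Real.sin_neg]
  module

theorem rotMatrix_mul (h : IsOrthoPair a b) (θ φ : ℝ) :
    rotMatrix a b θ * rotMatrix a b φ = rotMatrix a b (θ + φ) := by
  simp only [rotMatrix, mul_add, add_mul, mul_one, one_mul, Matrix.smul_mul, Matrix.mul_smul,
    vecMulVec_mul_vecMulVec, h.left, h.right, h.inner, h.inner', one_smul, zero_smul, vecMulVec_zero,
    smul_zero, Real.cos_add, Real.sin_add]
  module

theorem rotMatrix_zero (a b : n → ℝ) : rotMatrix a b 0 = 1 := by
  simp [rotMatrix]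

theorem rotMatrix_orthogonal (h : IsOrthoPair a b) (θ : ℝ) :
    rotMatrix a b θ * (rotMatrix a b θ)ᵀ = 1 := by
  rw [rotMatrix_transpose, rotMatrix_swap a b, rotMatrix_mul h, add_neg_cancel, rotMatrix_zero]

/-- The rotation is the square of the rotation by half the angle, which is orthogonal and so has
determinant ±1. -/
theorem det_rotMatrix (h : IsOrthoPair a b) (θ : ℝ) : (rotMatrix a b θ).det = 1 := by
  have h1 : rotMatrix a b θ = rotMatrix a b (θ / 2) * rotMatrix a b (θ / 2) := by
    rw [rotMatrix_mul h, add_halves]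
  have h2 := congrArg det (rotMatrix_orthogonal h (θ / 2))
  rw [det_mul, det_transpose, det_one] at h2
  rw [h1, det_mul, h2]

theorem isTrigPoly_of_complex {f : ℝ → ℝ} (c₀ c₁ c₂ c₃ c₄ : ℂ)
    (h : ∀ θ : ℝ, (f θ : ℂ) = c₀ + c₁ * (Real.cos θ + Real.sin θ * Complex.I) +
      c₂ * (Real.cos θ + Real.sin θ * Complex.I) ^ 2 +
      c₃ * (Real.cos θ - Real.sin θ * Complex.I) +
      c₄ * (Real.cos θ - Real.sin θ * Complex.I) ^ 2) : IsTrigPoly f := by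
  refine ⟨c₀.re, c₁.re + c₃.re, c₃.im - c₁.im, c₂.re + c₄.re, c₄.im - c₂.im, fun θ => ?_⟩
  have := congrArg Complex.re (h θ)
  rw [Complex.ofReal_re] at this
  rw [this, Real.cos_two_mul, Real.sin_two_mul]
  have hs : Real.sin θ ^ 2 = 1 - Real.cos θ ^ 2 := by
    linarith [Real.sin_sq_add_cos_sq θ]
  simp only [pow_two, Complex.add_re, Complex.mul_re, Complex.mul_im, Complex.add_im,
    Complex.sub_re, Complex.sub_im, Complex.ofReal_re, Complex.ofReal_im, Complex.I_re,
    Complex.I_im] at hs ⊢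
  linear_combination (-c₂.re - c₄.re) * hs

/-- The determinant of `C + R D Rᵀ` is a trigonometric polynomial of degree at most two in the angle
of the rotation `R`. -/
theorem isTrigPoly_det_conj (h : IsOrthoPair a b) (B D : Matrix n n ℝ) :
    IsTrigPoly fun θ => (B + rotMatrix a b θ * D * (rotMatrix a b θ)ᵀ).det := by
  set α : n → ℂ := fun i => (a i : ℂ) with hα
  set β : n → ℂ := fun i => (b i : ℂ) with hβ
  set Bc : Matrix n n ℂ := B.map (algebraMap ℝ ℂ) with hBc
  set Dc : Matrix n n ℂ := D.map (algebraMap ℝ ℂ) with hDc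
  -- Over ℂ the rotation is diagonal on its plane: `l` and `l'` are eigenvectors for z = exp(iθ) and
  -- w = exp(-iθ), with dual vectors `r` and `r'`, so it equals 1 + (z - 1) l rᵀ + (w - 1) l' r'ᵀ.
  set l : n → ℂ := (1 / 2 : ℂ) • (α - Complex.I • β) with hl
  set l' : n → ℂ := (1 / 2 : ℂ) • (α + Complex.I • β) with hl'
  set r : n → ℂ := α + Complex.I • β with hr
  set r' : n → ℂ := α - Complex.I • β with hr'
  obtain ⟨c₀, c₁, c₂, c₃, c₄, hc⟩ := exists_det_pencil (Bc + Dc) (Bc *ᵥ l) l (Bc *ᵥ l') l'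
    r (r ᵥ* Dc) r' (r' ᵥ* Dc)
  refine isTrigPoly_of_complex c₀ c₁ c₂ c₃ c₄ fun θ => ?_
  set z : ℂ := Real.cos θ + Real.sin θ * Complex.I with hz
  set w : ℂ := Real.cos θ - Real.sin θ * Complex.I with hw
  have hcs : (Real.cos θ : ℂ) ^ 2 + (Real.sin θ : ℂ) ^ 2 = 1 := by
    have := Real.cos_sq_add_sin_sq θ
    exact_mod_cast this
  have hzw : z * w = 1 := by
    rw [hz, hw]
    linear_combination hcs - (Real.sin θ : ℂ) ^ 2 * Complex.I_mul_I
  rw [← hc z w hzw]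
  -- Multiplying by the rotation, of determinant 1, makes the matrix linear in it: B R + R D has
  -- just the four rank-one terms of `exists_det_pencil`.
  have h1 : (B + rotMatrix a b θ * D * (rotMatrix a b θ)ᵀ).det =
      (B * rotMatrix a b θ + rotMatrix a b θ * D).det := by
    have ho : (rotMatrix a b θ)ᵀ * rotMatrix a b θ = 1 :=
      mul_eq_one_comm.1 (rotMatrix_orthogonal h θ)
    conv_lhs => rw [← mul_one (det _), ← det_rotMatrix h θ, ← det_mul, add_mul, Matrix.mul_assoc _ _ (rotMatrix a b θ), ho,
      Matrix.mul_one]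
  rw [h1]
  have h2 : ((B * rotMatrix a b θ + rotMatrix a b θ * D).det : ℂ) =
      ((B * rotMatrix a b θ + rotMatrix a b θ * D).map (algebraMap ℝ ℂ)).det :=
    RingHom.map_det (algebraMap ℝ ℂ) _
  have hrot : (rotMatrix a b θ).map (algebraMap ℝ ℂ) =
      1 + (z - 1) • vecMulVec l r + (w - 1) • vecMulVec l' r' := by
    ext i j
    simp only [rotMatrix, Matrix.map_apply, Matrix.add_apply, Matrix.smul_apply, vecMulVec_apply,
      hl, hl', hr, hr', hz, hw, hα, hβ, Pi.smul_apply, Pi.add_apply, Pi.sub_apply, smul_eq_mul,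
      Complex.coe_algebraMap]
    push_cast
    have h1 : ((1 : Matrix n n ℝ) i j : ℂ) = (1 : Matrix n n ℂ) i j := by
      by_cases hij : i = j
      · subst hij; simp
      · simp [hij]
    rw [h1]
    linear_combination (Complex.sin θ * b i * a j - Complex.sin θ * a i * b j +
      (Complex.cos θ - 1) * b i * b j) * Complex.I_mul_I
  rw [h2, Matrix.map_add _ (map_add _), Matrix.map_mul, Matrix.map_mul, hrot, ← hBc, ← hDc]
  congr 1
  simp only [mul_add, add_mul, Matrix.mul_one, Matrix.one_mul, Matrix.mul_smul, Matrix.smul_mul,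
    mul_vecMulVec, vecMulVec_mul]
  abel

end Trig

end AdditiveProduct

/-! ### Quadrature over the orthogonal group -/

namespace AdditiveProduct

section Quadrature

open Matrix
open scoped BigOperators

set_option linter.unusedSectionVars false

attribute [local instance] Matrix.normedAddCommGroup Matrix.normedSpace

variable {κ : Type*} [Fintype κ] [DecidableEq κ]

/-- Real orthogonal matrices. -/
def IsOrtho (X : Matrix κ κ ℝ) : Prop := X * Xᵀ = 1

theorem IsOrtho.one : IsOrtho (1 : Matrix κ κ ℝ) := by simp [IsOrtho]

theorem IsOrtho.mul {X Y : Matrix κ κ ℝ} (hX : IsOrtho X) (hY : IsOrtho Y) : IsOrtho (X * Y) := by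
  rw [IsOrtho, transpose_mul, Matrix.mul_assoc, ← Matrix.mul_assoc Y, hY, Matrix.one_mul, hX]

theorem IsOrtho.transpose {X : Matrix κ κ ℝ} (hX : IsOrtho X) : IsOrtho Xᵀ := by
  rw [IsOrtho, transpose_transpose]
  exact mul_eq_one_comm.1 hX

theorem IsOrtho.refl {u : κ → ℝ} (hu : u ⬝ᵥ u = 1) : IsOrtho (reflMatrix u) := by
  rw [IsOrtho, reflMatrix_isSymm, reflMatrix_mul_self hu]

/-- Differentiable functions of a matrix that restrict to trigonometric polynomials of degree two
along plane rotations. -/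
structure IsRotPoly (f : Matrix κ κ ℝ → ℝ) : Prop where
  differentiable : Differentiable ℝ f
  trig : ∀ {h₁ h₂ : Matrix κ κ ℝ} {a b : κ → ℝ}, IsOrtho h₁ → IsOrtho h₂ → IsOrthoPair a b →
    IsTrigPoly fun θ => f (h₁ * rotMatrix a b θ * h₂)

theorem IsRotPoly.transpose {f : Matrix κ κ ℝ → ℝ} (hf : IsRotPoly f) :
    IsRotPoly fun X => f Xᵀ where
  differentiable := by
    have h : Differentiable ℝ fun X : Matrix κ κ ℝ => Xᵀ := by
      refine differentiable_pi.2 fun i => differentiable_pi.2 fun j => ?_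
      change Differentiable ℝ fun X : κ → κ → ℝ => X j i
      fun_prop
    exact hf.differentiable.comp h
  trig := by
    intro h₁ h₂ a b o₁ o₂ hab
    have := hf.trig o₂.transpose o₁.transpose hab.symm
    simpa only [transpose_mul, rotMatrix_transpose, Matrix.mul_assoc] using this

/-- The infinitesimal rotation in the plane of `x` and `y`. -/
def wedge (x y : κ → ℝ) : Matrix κ κ ℝ := vecMulVec y x - vecMulVec x y

theorem wedge_add_left (x y z : κ → ℝ) : wedge (x + y) z = wedge x z + wedge y z := by
  simp only [wedge, vecMulVec_add, add_vecMulVec]; abel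

theorem wedge_smul_left (r : ℝ) (x z : κ → ℝ) : wedge (r • x) z = r • wedge x z := by
  simp only [wedge, vecMulVec_smul, smul_vecMulVec, smul_sub]

theorem wedge_swap (x y : κ → ℝ) : wedge y x = -wedge x y := by
  simp only [wedge]; abel

theorem wedge_add_right (x y z : κ → ℝ) : wedge x (y + z) = wedge x y + wedge x z := by
  simp only [wedge, vecMulVec_add, add_vecMulVec]; abel

theorem wedge_smul_right (r : ℝ) (x z : κ → ℝ) : wedge x (r • z) = r • wedge x z := by
  simp only [wedge, vecMulVec_smul, smul_vecMulVec, smul_sub]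

theorem wedge_self (x : κ → ℝ) : wedge x x = 0 := sub_self _

theorem wedge_sum_left {I : Type*} (s : Finset I) (x : I → κ → ℝ) (z : κ → ℝ) :
    wedge (∑ i ∈ s, x i) z = ∑ i ∈ s, wedge (x i) z := by
  classical
  induction s using Finset.induction_on with
  | empty => simp [wedge]
  | insert i s hi ih => rw [Finset.sum_insert hi, Finset.sum_insert hi, wedge_add_left, ih]

theorem wedge_sum_right {I : Type*} (s : Finset I) (x : κ → ℝ) (z : I → κ → ℝ) :
    wedge x (∑ i ∈ s, z i) = ∑ i ∈ s, wedge x (z i) := by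
  rw [wedge_swap, wedge_sum_left, ← Finset.sum_neg_distrib]
  exact Finset.sum_congr rfl fun i _ => (wedge_swap _ _).symm

/-- A finite family of orthogonal matrices, stable under right multiplication by enough
reflections: some products of two of them are rotations by a third or a quarter of a turn, and
their planes span all infinitesimal rotations. -/
structure IsRotDesign {Γ : Type*} [Fintype Γ] (ρ : Γ → Matrix κ κ ℝ) (U : Set (κ → ℝ)) : Prop where
  ortho : ∀ γ, IsOrtho (ρ γ)
  unit : ∀ u ∈ U, u ⬝ᵥ u = 1
  inv : ∀ u ∈ U, ∃ e : Γ ≃ Γ, ∀ γ, ρ γ * reflMatrix u = ρ (e γ)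
  nonempty : Nonempty κ → U.Nonempty
  span : ∀ x y, wedge x y ∈ Submodule.span ℝ {X | ∃ u ∈ U, ∃ u' ∈ U,
    (u ⬝ᵥ u' = 1 / 2 ∨ u ⬝ᵥ u' = √2 / 2) ∧ X = wedge u u'}

/-- This is why `IsRotDesign` asks for inner products 1 / 2 and √2 / 2: unit normals at angles π / 3
and π / 4 compose to a third and a quarter of a turn. -/
theorem reflMatrix_mul_reflMatrix {u w : κ → ℝ} (h : IsOrthoPair u w) (φ : ℝ) :
    reflMatrix (Real.cos φ • u + Real.sin φ • w) * reflMatrix u = rotMatrix u w (2 * φ) := by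
  have hs : Real.sin φ ^ 2 = 1 - Real.cos φ ^ 2 := by linarith [Real.sin_sq_add_cos_sq φ]
  set v := Real.cos φ • u + Real.sin φ • w with hv
  have hvu : v ⬝ᵥ u = Real.cos φ := by
    rw [hv, add_dotProduct, smul_dotProduct, smul_dotProduct, h.left, h.inner']; simp
  have e : reflMatrix v * reflMatrix u = 1 - (2 : ℝ) • vecMulVec v v - (2 : ℝ) • vecMulVec u u +
      (4 * Real.cos φ) • vecMulVec v u := by
    simp only [reflMatrix, mul_sub, sub_mul, mul_one, one_mul, Matrix.mul_smul, Matrix.smul_mul,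
      vecMulVec_mul_vecMulVec, hvu, vecMulVec_smul]
    module
  rw [e, rotMatrix, Real.cos_two_mul, Real.sin_two_mul]
  ext i j
  simp only [Matrix.add_apply, Matrix.sub_apply, Matrix.smul_apply, vecMulVec_apply, smul_eq_mul,
    hv, Pi.add_apply, Pi.smul_apply]
  linear_combination (-2 * w i * w j) * hs

theorem exists_unit_combination {u u' : κ → ℝ} (hu : u ⬝ᵥ u = 1) (hu' : u' ⬝ᵥ u' = 1) {φ : ℝ}
    (hφ : u ⬝ᵥ u' = Real.cos φ) (hs : Real.sin φ ≠ 0) :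
    ∃ w, IsOrthoPair u w ∧ u' = Real.cos φ • u + Real.sin φ • w := by
  refine ⟨(Real.sin φ)⁻¹ • (u' - Real.cos φ • u), ⟨hu, ?_, ?_⟩, ?_⟩
  · have hφ' : u' ⬝ᵥ u = Real.cos φ := by rw [dotProduct_comm, hφ]
    simp only [smul_dotProduct, dotProduct_smul, sub_dotProduct, dotProduct_sub, hu, hu', hφ, hφ',
      smul_eq_mul]
    field_simp
    linarith [Real.sin_sq_add_cos_sq φ]
  · simp only [dotProduct_smul, dotProduct_sub, hu, hφ, smul_eq_mul]
    ring
  · rw [smul_smul, mul_inv_cancel₀ hs]; module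

theorem hasDerivAt_rotMatrix_mul {a b : κ → ℝ} (h : IsOrthoPair a b) (X : Matrix κ κ ℝ) (θ : ℝ) :
    HasDerivAt (fun θ => rotMatrix a b θ * X) (wedge a b * (rotMatrix a b θ * X)) θ := by
  have e : (fun θ => rotMatrix a b θ * X) = fun θ => X + (Real.cos θ - 1) • (vecMulVec a a * X) +
      (Real.cos θ - 1) • (vecMulVec b b * X) + Real.sin θ • (vecMulVec b a * X) +
      (-Real.sin θ) • (vecMulVec a b * X) := by
    funext θ
    simp only [rotMatrix, add_mul, one_mul, Matrix.smul_mul]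
  have hc : HasDerivAt (fun θ => Real.cos θ - 1) (-Real.sin θ) θ :=
    (Real.hasDerivAt_cos θ).sub_const 1
  have hs := Real.hasDerivAt_sin θ
  have := ((((hc.smul_const (vecMulVec a a * X)).const_add X).fun_add
    (hc.smul_const (vecMulVec b b * X))).fun_add (hs.smul_const (vecMulVec b a * X))).fun_add
    (hs.fun_neg.smul_const (vecMulVec a b * X))
  rw [e]
  refine this.congr_deriv ?_
  rw [← Matrix.mul_assoc]
  simp only [← Matrix.smul_mul, ← add_mul]
  congr 1
  simp only [wedge, rotMatrix, sub_mul, mul_add, mul_one, Matrix.mul_smul,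
    vecMulVec_mul_vecMulVec, h.left, h.right, h.inner, h.inner', one_smul, zero_smul,
    vecMulVec_zero, smul_zero]
  module

namespace IsRotDesign

variable {Γ : Type*} [Fintype Γ] {ρ : Γ → Matrix κ κ ℝ} {U : Set (κ → ℝ)}
  {f : Matrix κ κ ℝ → ℝ}

theorem expect_refl (hd : IsRotDesign ρ U) {u : κ → ℝ} (hu : u ∈ U) (h : Matrix κ κ ℝ) :
    𝔼 γ, f (ρ γ * (reflMatrix u * h)) = 𝔼 γ, f (ρ γ * h) := by
  obtain ⟨e, he⟩ := hd.inv u hu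
  exact Fintype.expect_equiv e _ _ fun γ => by rw [← he, Matrix.mul_assoc]

theorem expect_trig (hd : IsRotDesign ρ U) (hf : IsRotPoly f) {a b : κ → ℝ} (hab : IsOrthoPair a b)
    {h : Matrix κ κ ℝ} (hh : IsOrtho h) :
    IsTrigPoly fun θ => 𝔼 γ, f (ρ γ * (rotMatrix a b θ * h)) :=
  IsTrigPoly.expect fun γ => by
    simpa only [Matrix.mul_assoc] using hf.trig (hd.ortho γ) hh hab

theorem differentiable_expect (hf : IsRotPoly f) : Differentiable ℝ fun h => 𝔼 γ, f (ρ γ * h) := by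
  simp only [Fintype.expect_eq_sum_div_card]
  have h : ∀ γ, Differentiable ℝ fun h => f (ρ γ * h) := fun γ => hf.differentiable.comp
    (LinearMap.toContinuousLinearMap (LinearMap.mulLeft ℝ (ρ γ))).differentiable
  have hs : Differentiable ℝ fun h => ∑ γ, f (ρ γ * h) := Differentiable.fun_sum fun γ _ => h γ
  simp only [div_eq_mul_inv]
  exact hs.mul_const _

/-- The average is unchanged when a reflection of the design multiplies h on the left, hence also
under the product of two of them, a third or a quarter of a turn. Along that circle of rotations it
is a trigonometric polynomial of degree at most two with such a period, so it is constant and its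
derivative vanishes. The spanning axiom and linearity give all infinitesimal rotations. -/
theorem deriv_wedge (hd : IsRotDesign ρ U) (hf : IsRotPoly f) {h : Matrix κ κ ℝ} (hh : IsOrtho h)
    (x y : κ → ℝ) : fderiv ℝ (fun h => 𝔼 γ, f (ρ γ * h)) h (wedge x y * h) = 0 := by
  set Φ := fun h => 𝔼 γ, f (ρ γ * h) with hΦ
  have hdiff : Differentiable ℝ Φ := differentiable_expect hf
  have key : ∀ u ∈ U, ∀ u' ∈ U, (u ⬝ᵥ u' = 1 / 2 ∨ u ⬝ᵥ u' = √2 / 2) →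
      fderiv ℝ Φ h (wedge u u' * h) = 0 := by
    intro u hu u' hu' hin
    have hrefl : ∀ X, Φ (reflMatrix u' * (reflMatrix u * X)) = Φ X := fun X => by
      rw [hΦ]; simp only
      rw [hd.expect_refl hu', hd.expect_refl hu]
    obtain ⟨φ, w, hw, hu'w, hconst⟩ : ∃ (φ : ℝ) (w : κ → ℝ), IsOrthoPair u w ∧
        u' = Real.cos φ • u + Real.sin φ • w ∧
        ∀ θ, Φ (rotMatrix u w θ * h) = Φ (rotMatrix u w 0 * h) := by
      have hsplit : ∀ φ : ℝ, ∀ w, IsOrthoPair u w → u' = Real.cos φ • u + Real.sin φ • w →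
          ∀ θ, Φ (rotMatrix u w (θ + 2 * φ) * h) = Φ (rotMatrix u w θ * h) := by
        intro φ w hw hu'w θ
        rw [add_comm, ← rotMatrix_mul hw, ← reflMatrix_mul_reflMatrix hw, ← hu'w,
          Matrix.mul_assoc, Matrix.mul_assoc, hrefl]
      rcases hin with hin | hin
      · have hc : u ⬝ᵥ u' = Real.cos (Real.pi / 3) := by rw [hin, Real.cos_pi_div_three]
        obtain ⟨w, hw, hu'w⟩ := exists_unit_combination (hd.unit u hu) (hd.unit u' hu') hc
          (by rw [Real.sin_pi_div_three]; positivity)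
        refine ⟨_, w, hw, hu'w, (hd.expect_trig hf hw hh).eq_of_periodic_third fun θ => ?_⟩
        have := hsplit _ w hw hu'w θ
        rwa [← mul_div_assoc] at this
      · have hc : u ⬝ᵥ u' = Real.cos (Real.pi / 4) := by rw [hin, Real.cos_pi_div_four]
        obtain ⟨w, hw, hu'w⟩ := exists_unit_combination (hd.unit u hu) (hd.unit u' hu') hc
          (by rw [Real.sin_pi_div_four]; positivity)
        refine ⟨_, w, hw, hu'w, (hd.expect_trig hf hw hh).eq_of_periodic_quarter fun θ => ?_⟩
        have := hsplit _ w hw hu'w θ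
        rwa [show 2 * (Real.pi / 4) = Real.pi / 2 by ring] at this
    have hD : HasDerivAt (fun θ => Φ (rotMatrix u w θ * h))
        (fderiv ℝ Φ (rotMatrix u w 0 * h) (wedge u w * (rotMatrix u w 0 * h))) 0 :=
      (hdiff _).hasFDerivAt.comp_hasDerivAt 0 (hasDerivAt_rotMatrix_mul hw h 0)
    have hD' : HasDerivAt (fun θ => Φ (rotMatrix u w θ * h)) 0 0 := by
      rw [show (fun θ => Φ (rotMatrix u w θ * h)) = fun _ => Φ (rotMatrix u w 0 * h) from
        funext hconst]
      exact hasDerivAt_const _ _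
    have h0 := hD.unique hD'
    rw [rotMatrix_zero, Matrix.one_mul] at h0
    rw [hu'w, wedge_add_right, wedge_smul_right, wedge_smul_right, wedge_self, smul_zero, zero_add,
      Matrix.smul_mul, map_smul, h0, smul_zero]
  generalize wedge x y = Z, hd.span x y = hsp
  induction hsp using Submodule.span_induction with
  | mem X hX =>
    obtain ⟨u, hu, u', hu', hin, rfl⟩ := hX
    exact key u hu u' hu' hin
  | zero => simp
  | add X Y _ _ hX hY => rw [Matrix.add_mul, map_add, hX, hY, add_zero]
  | smul r X _ hX => rw [Matrix.smul_mul, map_smul, hX, smul_zero]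

theorem expect_rot (hd : IsRotDesign ρ U) (hf : IsRotPoly f) {a b : κ → ℝ} (hab : IsOrthoPair a b)
    (θ : ℝ) {h : Matrix κ κ ℝ} (hh : IsOrtho h) :
    𝔼 γ, f (ρ γ * (rotMatrix a b θ * h)) = 𝔼 γ, f (ρ γ * h) := by
  have hD : ∀ θ, HasDerivAt (fun θ => 𝔼 γ, f (ρ γ * (rotMatrix a b θ * h))) 0 θ := by
    intro θ
    have := ((differentiable_expect (ρ := ρ) hf) _).hasFDerivAt.comp_hasDerivAt θ
      (hasDerivAt_rotMatrix_mul hab h θ)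
    exact this.congr_deriv
      (hd.deriv_wedge hf (IsOrtho.mul (rotMatrix_orthogonal hab θ) hh) a b)
  have := is_const_of_deriv_eq_zero (fun θ => (hD θ).differentiableAt) (fun θ => (hD θ).deriv) θ 0
  rw [this, rotMatrix_zero, Matrix.one_mul]

/-- An arbitrary reflection is a rotation times one reflection of the design; `expect_rot` absorbs
the rotation. When u = ± u₀ the two reflections coincide and there is no plane to rotate in. -/
theorem expect_reflMatrix (hd : IsRotDesign ρ U) (hf : IsRotPoly f) {u : κ → ℝ} (hu : u ⬝ᵥ u = 1)
    {h : Matrix κ κ ℝ} (hh : IsOrtho h) :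
    𝔼 γ, f (ρ γ * (reflMatrix u * h)) = 𝔼 γ, f (ρ γ * h) := by
  have hne : Nonempty κ := by
    by_contra hc
    rw [not_nonempty_iff] at hc
    simp [dotProduct] at hu
  obtain ⟨u₀, hu₀⟩ := hd.nonempty hne
  have h00 := hd.unit u₀ hu₀
  set c := u₀ ⬝ᵥ u with hc
  have hc' : u ⬝ᵥ u₀ = c := dotProduct_comm _ _
  have hsq : (u - c • u₀) ⬝ᵥ (u - c • u₀) = 1 - c ^ 2 := by
    simp only [sub_dotProduct, dotProduct_sub, smul_dotProduct, dotProduct_smul, hu, h00, hc',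
      ← hc, smul_eq_mul]
    ring
  have hnn : 0 ≤ 1 - c ^ 2 := by
    rw [← hsq]; exact Finset.sum_nonneg fun i _ => mul_self_nonneg _
  by_cases hz : 1 - c ^ 2 = 0
  · have hv : u = c • u₀ := by
      rw [hz] at hsq
      exact sub_eq_zero.1 (dotProduct_self_eq_zero.1 hsq)
    have : reflMatrix u = reflMatrix u₀ := by
      rw [reflMatrix, reflMatrix, hv, vecMulVec_smul, smul_vecMulVec, smul_smul c, ← pow_two,
        show c ^ 2 = 1 by linarith, one_smul]
    rw [this, hd.expect_refl hu₀]
  · have hc1 : -1 ≤ c ∧ c ≤ 1 := abs_le.1 (by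
      rw [← sq_le_one_iff_abs_le_one]; linarith)
    have hcos : u₀ ⬝ᵥ u = Real.cos (Real.arccos c) := by rw [Real.cos_arccos hc1.1 hc1.2]
    have hsin : Real.sin (Real.arccos c) ≠ 0 := by
      rw [Real.sin_arccos]
      exact (Real.sqrt_pos.2 (lt_of_le_of_ne hnn (Ne.symm hz))).ne'
    obtain ⟨w, hw, huw⟩ := exists_unit_combination h00 hu hcos hsin
    have hr := reflMatrix_mul_reflMatrix hw (Real.arccos c)
    rw [← huw] at hr
    have hr' : reflMatrix u = rotMatrix u₀ w (2 * Real.arccos c) * reflMatrix u₀ := by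
      rw [← hr, Matrix.mul_assoc, reflMatrix_mul_self h00, Matrix.mul_one]
    rw [hr', Matrix.mul_assoc, hd.expect_rot hf hw _ ((IsOrtho.refl h00).mul hh),
      hd.expect_refl hu₀]

end IsRotDesign

/-- The monoid generated by the reflections. -/
def reflMonoid (κ : Type*) [Fintype κ] [DecidableEq κ] : Submonoid (Matrix κ κ ℝ) :=
  Submonoid.closure {X | ∃ u : κ → ℝ, u ⬝ᵥ u = 1 ∧ X = reflMatrix u}

theorem reflMatrix_mem {u : κ → ℝ} (hu : u ⬝ᵥ u = 1) : reflMatrix u ∈ reflMonoid κ :=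
  Submonoid.subset_closure ⟨u, hu, rfl⟩

theorem reflMonoid_isOrtho {X : Matrix κ κ ℝ} (hX : X ∈ reflMonoid κ) : IsOrtho X := by
  induction hX using Submonoid.closure_induction with
  | mem X h => obtain ⟨u, hu, rfl⟩ := h; exact IsOrtho.refl hu
  | one => exact IsOrtho.one
  | mul X Y _ _ hX hY => exact hX.mul hY

theorem transpose_mem_reflMonoid {X : Matrix κ κ ℝ} (hX : X ∈ reflMonoid κ) :
    Xᵀ ∈ reflMonoid κ := by
  induction hX using Submonoid.closure_induction with
  | mem X h =>
    obtain ⟨u, hu, rfl⟩ := h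
    rw [reflMatrix_isSymm]; exact reflMatrix_mem hu
  | one => rw [transpose_one]; exact one_mem _
  | mul X Y _ _ hX hY => rw [transpose_mul]; exact mul_mem hY hX

theorem IsRotDesign.expect_mul {Γ : Type*} [Fintype Γ] {ρ : Γ → Matrix κ κ ℝ} {U : Set (κ → ℝ)}
    {f : Matrix κ κ ℝ → ℝ} (hd : IsRotDesign ρ U) (hf : IsRotPoly f) {X : Matrix κ κ ℝ}
    (hX : X ∈ reflMonoid κ) : 𝔼 γ, f (ρ γ * X) = 𝔼 γ, f (ρ γ) := by
  -- The additional orthogonal factor on the right is what lets the induction pass through products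
  -- of reflections.
  have : ∀ h, IsOrtho h → 𝔼 γ, f (ρ γ * (X * h)) = 𝔼 γ, f (ρ γ * h) := by
    induction hX using Submonoid.closure_induction with
    | mem X h =>
      obtain ⟨u, hu, rfl⟩ := h
      exact fun h hh => hd.expect_reflMatrix hf hu hh
    | one => intro h _; simp only [Matrix.one_mul]
    | mul X Y hX' hY' hX hY =>
      intro h hh
      have hY'' : IsOrtho Y := reflMonoid_isOrtho hY'
      simp only [Matrix.mul_assoc X]
      rw [hX _ (hY''.mul hh), hY _ hh]
  simpa using this 1 IsOrtho.one

/-- Any two such families give the same averages. -/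
theorem IsRotDesign.expect_eq {Γ Δ : Type*} [Fintype Γ] [Fintype Δ] [Nonempty Γ] [Nonempty Δ]
    {ρ : Γ → Matrix κ κ ℝ} {σ : Δ → Matrix κ κ ℝ} {U W : Set (κ → ℝ)}
    (hρ : IsRotDesign ρ U) (hσ : IsRotDesign σ W)
    (hρm : ∀ γ, ρ γ ∈ reflMonoid κ) (hσm : ∀ δ, σ δ ∈ reflMonoid κ)
    (hT : ∃ e : Γ ≃ Γ, ∀ γ, (ρ γ)ᵀ = ρ (e γ))
    {f : Matrix κ κ ℝ → ℝ} (hf : IsRotPoly f) : 𝔼 γ, f (ρ γ) = 𝔼 δ, f (σ δ) := by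
  obtain ⟨e, he⟩ := hT
  -- In the double average of f(σ δ * ρ γ), averaging over δ absorbs ρ γ directly, and averaging
  -- over γ absorbs σ δ after a transposition, which exchanges left and right factors. Interchanging
  -- the order identifies the two averages.
  have h1 : ∀ δ, 𝔼 γ, f (σ δ * ρ γ) = 𝔼 γ, f (ρ γ) := by
    intro δ
    have := hρ.expect_mul hf.transpose (transpose_mem_reflMonoid (hσm δ))
    have e1 : 𝔼 γ, f (σ δ * ρ γ) = 𝔼 γ, f (ρ γ * (σ δ)ᵀ)ᵀ :=
      Fintype.expect_equiv e _ _ fun γ => by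
        rw [← he, transpose_mul, transpose_transpose, transpose_transpose]
    have e2 : 𝔼 γ, f (ρ γ) = 𝔼 γ, f (ρ γ)ᵀ :=
      Fintype.expect_equiv e _ _ fun γ => by rw [← he, transpose_transpose]
    rw [e1, e2]; exact this
  have h2 : ∀ γ, 𝔼 δ, f (σ δ * ρ γ) = 𝔼 δ, f (σ δ) := fun γ => hσ.expect_mul hf (hρm γ)
  calc 𝔼 γ, f (ρ γ) = 𝔼 _δ : Δ, 𝔼 γ, f (ρ γ) := (Fintype.expect_const _).symm
    _ = 𝔼 δ, 𝔼 γ, f (σ δ * ρ γ) := Finset.expect_congr rfl fun δ _ => (h1 δ).symm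
    _ = 𝔼 γ, 𝔼 δ, f (σ δ * ρ γ) := Finset.expect_comm _ _ _
    _ = 𝔼 _γ : Γ, 𝔼 δ, f (σ δ) := Finset.expect_congr rfl fun γ _ => h2 γ
    _ = _ := Fintype.expect_const _

end Quadrature

end AdditiveProduct

/-! ### Quadrature applied block by block -/

namespace AdditiveProduct

section BlockQuadrature

open Matrix
open scoped BigOperators

set_option linter.unusedSectionVars false

attribute [local instance] Matrix.normedAddCommGroup Matrix.normedSpace

/-- A hybrid argument: in `H S` the coordinates in S are drawn from σ and the others from ρ.
Enlarging S by one coordinate changes nothing, by `h` with the other coordinates frozen. -/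
theorem expect_pi_eq {J Γ Δ M : Type*} [Fintype J] [DecidableEq J] [Fintype Γ] [Fintype Δ]
    [Nonempty Γ] [Nonempty Δ] (ρ : Γ → M) (σ : Δ → M) (P : M → Prop) (hρ : ∀ γ, P (ρ γ))
    (hσ : ∀ δ, P (σ δ)) (Ψ : (J → M) → ℝ)
    (h : ∀ (j : J) (g : J → M), (∀ i, P (g i)) →
      𝔼 γ, Ψ (Function.update g j (ρ γ)) = 𝔼 δ, Ψ (Function.update g j (σ δ))) :
    𝔼 Q : J → Γ, Ψ (fun j => ρ (Q j)) = 𝔼 T : J → Δ, Ψ (fun j => σ (T j)) := by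
  set H : Finset J → ℝ := fun S => 𝔼 Q : J → Γ, 𝔼 T : J → Δ,
    Ψ (S.piecewise (fun j => σ (T j)) fun j => ρ (Q j)) with hH
  have hP : ∀ (S : Finset J) (Q : J → Γ) (T : J → Δ) i,
      P (S.piecewise (fun j => σ (T j)) (fun j => ρ (Q j)) i) := by
    intro S Q T i
    by_cases hi : i ∈ S
    · simpa [hi] using hσ _
    · simpa [hi] using hρ _
  have hstep : ∀ S : Finset J, H S = H ∅ := by
    intro S
    induction S using Finset.induction_on with
    | empty => rfl
    | insert j S hj ih =>
      rw [← ih, hH]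
      simp only
      have e1 : ∀ Q : J → Γ, 𝔼 T : J → Δ,
          Ψ ((insert j S).piecewise (fun j => σ (T j)) fun j => ρ (Q j)) =
          𝔼 T : J → Δ, 𝔼 δ, Ψ (Function.update
            (S.piecewise (fun j => σ (T j)) fun j => ρ (Q j)) j (σ δ)) := by
        intro Q
        rw [← expect_update j]
        refine Finset.expect_congr rfl fun T _ => Finset.expect_congr rfl fun δ _ => ?_
        congr 1
        funext i
        by_cases hi : i = j
        · subst hi; simp
        · by_cases hs : i ∈ S <;> simp [hi, hs]
      have e2 : ∀ T : J → Δ, 𝔼 Q : J → Γ,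
          Ψ (S.piecewise (fun j => σ (T j)) fun j => ρ (Q j)) =
          𝔼 Q : J → Γ, 𝔼 γ, Ψ (Function.update
            (S.piecewise (fun j => σ (T j)) fun j => ρ (Q j)) j (ρ γ)) := by
        intro T
        rw [← expect_update j]
        refine Finset.expect_congr rfl fun T _ => Finset.expect_congr rfl fun δ _ => ?_
        congr 1
        funext i
        by_cases hi : i = j
        · subst hi; simp [hj]
        · by_cases hs : i ∈ S <;> simp [hi, hs]
      rw [Finset.expect_congr rfl fun Q _ => e1 Q]
      conv_rhs => rw [Finset.expect_comm, Finset.expect_congr rfl fun T _ => e2 T,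
        Finset.expect_comm]
      refine Finset.expect_congr rfl fun Q _ => Finset.expect_congr rfl fun T _ => ?_
      exact (h j _ (hP S Q T)).symm
  have h0 : H ∅ = 𝔼 Q : J → Γ, Ψ (fun j => ρ (Q j)) := by
    simp only [hH, Finset.piecewise_empty, Fintype.expect_const]
  have h1 : H Finset.univ = 𝔼 T : J → Δ, Ψ (fun j => σ (T j)) := by
    simp only [hH, Finset.piecewise_univ, Fintype.expect_const]
  rw [← h0, ← h1, hstep Finset.univ]

variable {ι V κ : Type*} [Fintype ι] [DecidableEq ι] [Fintype V] [DecidableEq V] [Fintype κ]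
  [DecidableEq κ]

theorem blockDiagonal_update_rotMatrix (v : V) (a b : κ → ℝ) (θ : ℝ) :
    blockDiagonal (Function.update 1 v (rotMatrix a b θ)) =
      rotMatrix (liftVec v a) (liftVec v b) θ := by
  rw [rotMatrix, blockDiagonal_update_one_add, blockDiagonal_update_one_add,
    blockDiagonal_update_one_add, blockDiagonal_update_one_add, blockDiagonal_update_one_one,
    rotMatrix]

theorem blockDiagonal_update_isOrtho (v : V) {X : Matrix κ κ ℝ} (hX : IsOrtho X) :
    IsOrtho (blockDiagonal (Function.update 1 v X)) := by
  rw [IsOrtho, blockDiagonal_transpose, ← blockDiagonal_mul, ← blockDiagonal_one]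
  congr 1
  funext w
  by_cases h : w = v
  · subst h
    simp only [Function.update_self]
    exact hX
  · simp [h]

theorem differentiable_det {E n : Type*} [NormedAddCommGroup E] [NormedSpace ℝ E] [Fintype n]
    [DecidableEq n] {M : E → Matrix n n ℝ} (h : ∀ i j, Differentiable ℝ fun x => M x i j) :
    Differentiable ℝ fun x => (M x).det := by
  simp only [det_apply, Units.smul_def, zsmul_eq_mul]
  fun_prop

theorem differentiable_blockDiagonal_update (g : V → Matrix κ κ ℝ) (v : V) (x y : κ × V) :
    Differentiable ℝ fun X : Matrix κ κ ℝ => blockDiagonal (Function.update g v X) x y := by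
  simp only [blockDiagonal_apply]
  by_cases h : x.2 = y.2
  · simp only [h, if_true]
    by_cases hv : y.2 = v
    · rw [hv]
      simp only [Function.update_self]
      change Differentiable ℝ fun X : κ → κ → ℝ => X x.1 y.1
      fun_prop
    · simp only [Function.update_of_ne hv]
      exact differentiable_const _
  · simp only [h, if_false]
    exact differentiable_const _

theorem blockConj_update (g : ι × V → Matrix κ κ ℝ) (j : ι × V) (X : Matrix κ κ ℝ)
    (A : ι → Matrix (κ × V) (κ × V) ℝ) (m : ι) :
    blockConj (Function.update g j X) A m = if m = j.1 then
      blockDiagonal (Function.update (fun v => g (m, v)) j.2 X) * A m *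
        (blockDiagonal (Function.update (fun v => g (m, v)) j.2 X))ᵀ else blockConj g A m := by
  obtain ⟨m', w⟩ := j
  by_cases h : m = m'
  · subst h
    have : (fun v => Function.update g (m, w) X (m, v)) =
        Function.update (fun v => g (m, v)) w X := by
      funext v
      by_cases hv : v = w
      · subst hv; simp
      · rw [Function.update_of_ne hv, Function.update_of_ne (fun h => hv (by simpa using h))]
    simp only [blockConj, this, if_true]
  · have : (fun v => Function.update g (m', w) X (m, v)) = fun v => g (m, v) := by
      funext v
      rw [Function.update_of_ne (fun h' => h (by simpa using congrArg Prod.fst h'))]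
    simp only [blockConj, this, h, if_false]

/-- As a function of one block, the characteristic polynomial of a sum of block conjugates satisfies
the assumptions of the quadrature theorem. -/
theorem isRotPoly_det (A : ι → Matrix (κ × V) (κ × V) ℝ) (Y : Matrix (κ × V) (κ × V) ℝ) (j : ι × V)
    (g : ι × V → Matrix κ κ ℝ) :
    IsRotPoly fun X => (Y - ∑ m, blockConj (Function.update g j X) A m).det where
  differentiable := by
    refine differentiable_det fun x y => ?_
    simp only [Matrix.sub_apply, Matrix.sum_apply]
    refine (differentiable_const _).sub (Differentiable.fun_sum fun m _ => ?_)
    simp only [blockConj_update]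
    by_cases h : m = j.1
    · simp only [h, if_true, Matrix.mul_apply, Matrix.transpose_apply]
      refine Differentiable.fun_sum fun z _ => Differentiable.mul (Differentiable.fun_sum fun w _ =>
        Differentiable.mul_const ?_ _) ?_
      · exact differentiable_blockDiagonal_update _ _ _ _
      · exact differentiable_blockDiagonal_update _ _ _ _
    · simp only [h, if_false]
      exact differentiable_const _
  trig := by
    intro h₁ h₂ a b o₁ o₂ hab
    set B := blockConj (Function.update g j h₂) A with hB
    set H := blockDiagonal (Function.update 1 j.2 h₁) with hH
    have hHo : IsOrtho H := blockDiagonal_update_isOrtho j.2 o₁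
    have hlift : IsOrthoPair (liftVec j.2 a) (liftVec j.2 b) :=
      ⟨by rw [liftVec_dotProduct, hab.left], by rw [liftVec_dotProduct, hab.right],
        by rw [liftVec_dotProduct, hab.inner]⟩
    set Z := Y - ∑ m ∈ Finset.univ.erase j.1, B m with hZ
    -- The factor h₁ is pulled out as the orthogonal block matrix `H`, and h₂ is absorbed into `B`.
    -- Only summand `j.1` then depends on θ, through conjugation by one plane rotation of the whole
    -- space, as in `isTrigPoly_det_conj`.
    have key : ∀ θ, (Y - ∑ m, blockConj
        (Function.update g j (h₁ * rotMatrix a b θ * h₂)) A m).det =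
        (H.det * Hᵀ.det) * (Hᵀ * Z * H + rotMatrix (liftVec j.2 a) (liftVec j.2 b) θ * (-B j.1) *
          (rotMatrix (liftVec j.2 a) (liftVec j.2 b) θ)ᵀ).det := by
      intro θ
      have h3 : Function.update g j (h₁ * rotMatrix a b θ * h₂) = fun i =>
          (Function.update 1 j h₁ : ι × V → Matrix κ κ ℝ) i *
          ((Function.update 1 j (rotMatrix a b θ) : ι × V → Matrix κ κ ℝ) i *
            Function.update g j h₂ i) := by
        funext i
        by_cases hi : i = j
        · subst hi; simp [Matrix.mul_assoc]
        · simp [hi]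
      rw [h3, blockConj_mul, blockConj_mul, ← hB, blockConj_single, blockConj_single,
        Function.update_self, Function.update_idem, blockDiagonal_update_rotMatrix, ← hH,
        Finset.sum_update_of_mem (Finset.mem_univ _), Finset.sdiff_singleton_eq_erase]
      set R := rotMatrix (liftVec j.2 a) (liftVec j.2 b) θ
      have h4 : Y - (H * (R * B j.1 * Rᵀ) * Hᵀ + ∑ x ∈ Finset.univ.erase j.1, B x) =
          H * (Hᵀ * Z * H + R * (-B j.1) * Rᵀ) * Hᵀ := by
        have e1 : H * (Hᵀ * Z * H) * Hᵀ = Z := by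
          have ho : H * Hᵀ = 1 := hHo
          calc H * (Hᵀ * Z * H) * Hᵀ = (H * Hᵀ) * Z * (H * Hᵀ) := by
                simp only [Matrix.mul_assoc]
            _ = Z := by rw [ho, Matrix.one_mul, Matrix.mul_one]
        rw [Matrix.mul_add, Matrix.add_mul, e1, hZ]
        simp only [Matrix.mul_neg, Matrix.neg_mul]
        abel
      rw [h4, det_mul, det_mul]
      ring
    simp only [key]
    exact (isTrigPoly_det_conj hlift _ _).const_mul _

end BlockQuadrature

end AdditiveProduct

/-! ### Two designs: the standard representation and signed permutations -/

namespace AdditiveProduct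

section Designs

open Matrix
open scoped BigOperators

set_option linter.unusedSectionVars false

theorem dotProduct_smul_sub {n : Type*} [Fintype n] (r : ℝ) (x y z w : n → ℝ) :
    (r • (x - y)) ⬝ᵥ (r • (z - w)) = r ^ 2 * (x ⬝ᵥ z - x ⬝ᵥ w - y ⬝ᵥ z + y ⬝ᵥ w) := by
  simp only [smul_dotProduct, dotProduct_smul, sub_dotProduct, dotProduct_sub, smul_eq_mul]
  ring

theorem sqrt_two_div_two_sq : (√2 / 2 : ℝ) ^ 2 = 1 / 2 := by
  rw [div_pow, Real.sq_sqrt (by norm_num)]; norm_num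

/-- An orthonormal basis whose last vector is constant, as a matrix of columns. -/
structure IsFrame {d : ℕ} (R : Matrix (Fin (d + 1)) (Fin d ⊕ Unit) ℝ) : Prop where
  mul_transpose : R * Rᵀ = 1
  transpose_mul : Rᵀ * R = 1
  const : ∀ i, R i (Sum.inr ()) = 1 / √(d + 1 : ℕ)

theorem exists_isFrame (d : ℕ) : ∃ R : Matrix (Fin (d + 1)) (Fin d ⊕ Unit) ℝ, IsFrame R := by
  classical
  let E := EuclideanSpace ℝ (Fin (d + 1))
  let s : E := WithLp.toLp 2 fun _ => 1 / √(d + 1 : ℕ)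
  have hs : inner ℝ s s = (1 : ℝ) := by
    rw [real_inner_self_eq_norm_sq, EuclideanSpace.norm_sq_eq]
    simp only [s, Real.norm_eq_abs, sq_abs, div_pow, Finset.sum_const, Finset.card_univ,
      Fintype.card_fin, nsmul_eq_mul, one_pow]
    rw [Real.sq_sqrt (by positivity)]
    field_simp
  have hcard : Module.finrank ℝ E = Fintype.card (Fin d ⊕ Unit) := by simp [E]
  obtain ⟨b, hb⟩ := Orthonormal.exists_orthonormalBasis_extension_of_card_eq (𝕜 := ℝ) hcard
    (v := fun _ => s) (s := {Sum.inr ()}) (by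
      rw [orthonormal_iff_ite]
      intro i j
      have : i = j := Subsingleton.elim _ _
      simpa [this, Set.domRestrict] using hs)
  have h1 : (Matrix.of fun i p => b p i)ᵀ * (Matrix.of fun i p => b p i) =
      (1 : Matrix (Fin d ⊕ Unit) (Fin d ⊕ Unit) ℝ) := by
    ext p q
    have := orthonormal_iff_ite.1 b.orthonormal p q
    rw [PiLp.inner_apply] at this
    simp only [Matrix.mul_apply, transpose_apply, of_apply, Matrix.one_apply]
    rw [← this]
    exact Finset.sum_congr rfl fun i _ => by simp [mul_comm]
  refine ⟨Matrix.of fun i p => b p i, ?_, h1, fun i => ?_⟩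
  · exact (Matrix.mul_eq_one_comm_of_card_eq _ _ _ (by simp)).1 h1
  · rw [of_apply, hb _ rfl]

variable {d : ℕ} {R : Matrix (Fin (d + 1)) (Fin d ⊕ Unit) ℝ}

/-- The vertices of a regular simplex. -/
def simplexVec (R : Matrix (Fin (d + 1)) (Fin d ⊕ Unit) ℝ) (i : Fin (d + 1)) : Fin d → ℝ :=
  fun p => R i (Sum.inl p)

/-- The rows of R are orthonormal, and omitting their common last entry 1 / √(d + 1) subtracts 1 /
(d + 1) from each inner product. -/
theorem IsFrame.dotProduct (h : IsFrame R) (i j : Fin (d + 1)) :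
    simplexVec R i ⬝ᵥ simplexVec R j = (if i = j then 1 else 0) - 1 / (d + 1 : ℕ) := by
  have h1 := congrFun (congrFun h.mul_transpose i) j
  rw [Matrix.mul_apply, Fintype.sum_sum_type, Matrix.one_apply] at h1
  simp only [Matrix.transpose_apply, Finset.univ_unique, Finset.sum_singleton, h.const,
    PUnit.default_eq_unit, ← sq, div_pow, one_pow, Real.sq_sqrt (Nat.cast_nonneg (α := ℝ) (d + 1))]
    at h1
  rw [← h1]
  simp [simplexVec, _root_.dotProduct]

theorem IsFrame.sum_eq_zero (h : IsFrame R) : ∑ i, simplexVec R i = 0 := by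
  funext p
  have h1 := congrFun (congrFun h.transpose_mul (Sum.inl p)) (Sum.inr ())
  simp only [Matrix.mul_apply, Matrix.transpose_apply, h.const, ← Finset.sum_mul,
    Matrix.one_apply, reduceCtorEq, if_false, mul_eq_zero] at h1
  rw [Finset.sum_apply]
  refine h1.resolve_right ?_
  positivity

theorem IsFrame.sum_mul (h : IsFrame R) (p q : Fin d) :
    ∑ i, simplexVec R i p * simplexVec R i q = if p = q then 1 else 0 := by
  have h1 := congrFun (congrFun h.transpose_mul (Sum.inl p)) (Sum.inl q)
  simpa [Matrix.mul_apply, Matrix.one_apply, simplexVec] using h1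

/-- The simplex vectors form a tight frame by `sum_mul`, and since they sum to zero so do the
coefficients; hence a fixed vertex may be subtracted from each of them. -/
theorem IsFrame.expand (h : IsFrame R) (x : Fin d → ℝ) (k : Fin (d + 1)) :
    x = ∑ i, (simplexVec R i ⬝ᵥ x) • (simplexVec R i - simplexVec R k) := by
  have h0 : ∑ i, simplexVec R i ⬝ᵥ x = 0 := by
    rw [← sum_dotProduct, h.sum_eq_zero, zero_dotProduct]
  simp only [smul_sub]
  rw [Finset.sum_sub_distrib, ← Finset.sum_smul, h0, zero_smul, sub_zero]
  funext q
  simp only [Finset.sum_apply, Pi.smul_apply, smul_eq_mul, _root_.dotProduct, Finset.sum_mul]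
  rw [Finset.sum_comm]
  have : ∀ p, ∑ i, simplexVec R i p * x p * simplexVec R i q = if p = q then x p else 0 := by
    intro p
    have h2 := h.sum_mul p q
    calc _ = (∑ i, simplexVec R i p * simplexVec R i q) * x p := by
          rw [Finset.sum_mul]; exact Finset.sum_congr rfl fun i _ => by ring
      _ = _ := by rw [h2]; simp
  simp [this]

/-- The standard representation of the symmetric group. -/
def IsFrame.stdRep (h : IsFrame R) : Equiv.Perm (Fin (d + 1)) →* Matrix (Fin d) (Fin d) ℝ where
  toFun σ := Matrix.of fun p q => ∑ k, simplexVec R (σ k) p * simplexVec R k q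
  map_one' := by
    ext p q
    simp only [of_apply, Equiv.Perm.one_apply, h.sum_mul, Matrix.one_apply]
  map_mul' σ τ := by
    ext p q
    simp only [of_apply, Matrix.mul_apply, Finset.sum_mul_sum]
    have h0 : ∑ k, simplexVec R (σ k) p = 0 := by
      rw [Equiv.sum_comp σ fun k => simplexVec R k p]
      simpa using congrFun h.sum_eq_zero p
    have h1 : ∀ k l, ∑ r, simplexVec R (σ k) p * simplexVec R k r *
        (simplexVec R (τ l) r * simplexVec R l q) =
        (if k = τ l then simplexVec R (σ k) p * simplexVec R l q else 0) -
          simplexVec R (σ k) p * (1 / (d + 1 : ℕ) * simplexVec R l q) := by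
      intro k l
      have h2 := h.dotProduct k (τ l)
      calc _ = simplexVec R (σ k) p * simplexVec R l q *
            (simplexVec R k ⬝ᵥ simplexVec R (τ l)) := by
            rw [_root_.dotProduct, Finset.mul_sum]
            exact Finset.sum_congr rfl fun r _ => by ring
        _ = _ := by rw [h2]; split_ifs <;> ring
    rw [Finset.sum_comm]
    simp only [Finset.sum_comm (s := (Finset.univ : Finset (Fin d)))]
    rw [Finset.sum_comm]
    have h3 : ∀ l, ∑ k, ∑ r, simplexVec R (σ k) p * simplexVec R k r *
        (simplexVec R (τ l) r * simplexVec R l q) =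
        simplexVec R (σ (τ l)) p * simplexVec R l q := by
      intro l
      simp only [h1, Finset.sum_sub_distrib, ← Finset.sum_mul, h0]
      simp
    simp [h3]

theorem IsFrame.stdRep_apply (h : IsFrame R) (σ : Equiv.Perm (Fin (d + 1))) (p q : Fin d) :
    h.stdRep σ p q = ∑ k, simplexVec R (σ k) p * simplexVec R k q := rfl

theorem IsFrame.stdRep_transpose (h : IsFrame R) (σ : Equiv.Perm (Fin (d + 1))) :
    (h.stdRep σ)ᵀ = h.stdRep σ⁻¹ := by
  ext p q
  rw [transpose_apply, h.stdRep_apply, h.stdRep_apply]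
  rw [← Equiv.sum_comp σ fun k => simplexVec R (σ⁻¹ k) p * simplexVec R k q]
  exact Finset.sum_congr rfl fun k _ => by simp [mul_comm]

/-- The unit normal of the mirror of a transposition. -/
noncomputable def rootVec (R : Matrix (Fin (d + 1)) (Fin d ⊕ Unit) ℝ) (a b : Fin (d + 1)) : Fin d → ℝ :=
  (√2 / 2) • (simplexVec R a - simplexVec R b)

theorem IsFrame.rootVec_unit (h : IsFrame R) {a b : Fin (d + 1)} (hab : a ≠ b) :
    rootVec R a b ⬝ᵥ rootVec R a b = 1 := by
  rw [rootVec, dotProduct_smul_sub, sqrt_two_div_two_sq]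
  simp only [h.dotProduct, hab, hab.symm, if_true, if_false]
  ring

theorem IsFrame.stdRep_swap (h : IsFrame R) {a b : Fin (d + 1)} (hab : a ≠ b) :
    h.stdRep (Equiv.swap a b) = reflMatrix (rootVec R a b) := by
  ext p q
  have h1 : ∑ k, (simplexVec R (Equiv.swap a b k) p - simplexVec R k p) * simplexVec R k q =
      (simplexVec R b p - simplexVec R a p) * simplexVec R a q +
        (simplexVec R a p - simplexVec R b p) * simplexVec R b q := by
    rw [Fintype.sum_eq_add a b hab]
    · simp
    · rintro x ⟨hxa, hxb⟩
      rw [Equiv.swap_apply_of_ne_of_ne hxa hxb, sub_self, zero_mul]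
  simp only [sub_mul, Finset.sum_sub_distrib, h.sum_mul] at h1
  rw [h.stdRep_apply, eq_add_of_sub_eq h1]
  have h2 := sqrt_two_div_two_sq
  simp only [reflMatrix, rootVec, Matrix.sub_apply, Matrix.smul_apply, vecMulVec_apply,
    Pi.smul_apply, Pi.sub_apply, smul_eq_mul, Matrix.one_apply]
  linear_combination (2 * (simplexVec R a p - simplexVec R b p) *
    (simplexVec R a q - simplexVec R b q)) * h2

theorem IsFrame.stdRep_mem (h : IsFrame R) (σ : Equiv.Perm (Fin (d + 1))) :
    h.stdRep σ ∈ reflMonoid (Fin d) := by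
  induction σ using Equiv.Perm.swap_induction_on with
  | one => rw [map_one]; exact one_mem _
  | swap_mul f x y hxy ih =>
    rw [map_mul, h.stdRep_swap hxy]
    exact mul_mem (reflMatrix_mem (h.rootVec_unit hxy)) ih

/-- The normals form the root system of type A. By `expand`, the vectors `rootVec R i 0` span the
space, and two distinct ones have inner product 1 / 2, so third turns suffice. -/
theorem IsFrame.isRotDesign (h : IsFrame R) :
    IsRotDesign h.stdRep {u | ∃ a b, a ≠ b ∧ u = rootVec R a b} where
  ortho σ := reflMonoid_isOrtho (h.stdRep_mem σ)
  unit := by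
    rintro u ⟨a, b, hab, rfl⟩
    exact h.rootVec_unit hab
  inv := by
    rintro u ⟨a, b, hab, rfl⟩
    exact ⟨Equiv.mulRight (Equiv.swap a b), fun σ => by
      rw [← h.stdRep_swap hab, ← map_mul]; rfl⟩
  nonempty := by
    rintro ⟨p⟩
    exact ⟨_, p.castSucc, Fin.last d, (Fin.castSucc_lt_last p).ne, rfl⟩
  span x y := by
    rw [h.expand x 0, h.expand y 0, wedge_sum_left]
    refine Submodule.sum_mem _ fun i _ => ?_
    rw [wedge_smul_left, wedge_sum_right]
    refine Submodule.smul_mem _ _ (Submodule.sum_mem _ fun j _ => ?_)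
    rw [wedge_smul_right]
    refine Submodule.smul_mem _ _ ?_
    by_cases hi : i = 0
    · subst hi
      have : wedge (simplexVec R 0 - simplexVec R 0) (simplexVec R j - simplexVec R 0) = 0 := by
        rw [sub_self, ← zero_smul ℝ (0 : Fin d → ℝ), wedge_smul_left, zero_smul]
      rw [this]; exact zero_mem _
    by_cases hj : j = 0
    · subst hj
      have : wedge (simplexVec R i - simplexVec R 0) (simplexVec R 0 - simplexVec R 0) = 0 := by
        rw [sub_self, ← zero_smul ℝ (0 : Fin d → ℝ), wedge_smul_right, zero_smul]
      rw [this]; exact zero_mem _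
    by_cases hij : i = j
    · subst hij; rw [wedge_self]; exact zero_mem _
    have h2 : wedge (simplexVec R i - simplexVec R 0) (simplexVec R j - simplexVec R 0) =
        (2 : ℝ) • wedge (rootVec R i 0) (rootVec R j 0) := by
      rw [rootVec, rootVec, wedge_smul_left, wedge_smul_right, smul_smul, smul_smul, mul_assoc, ← sq,
        sqrt_two_div_two_sq]
      norm_num
    rw [h2]
    refine Submodule.smul_mem _ _ (Submodule.subset_span
      ⟨_, ⟨i, 0, hi, rfl⟩, _, ⟨j, 0, hj, rfl⟩, Or.inl ?_, rfl⟩)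
    rw [rootVec, rootVec, dotProduct_smul_sub, sqrt_two_div_two_sq]
    simp only [h.dotProduct, hij, hi, Ne.symm hj, if_true, if_false]
    ring

variable {κ : Type*} [Fintype κ] [DecidableEq κ]

/-- Signed permutation matrices. -/
def signedPerm (γ : (κ → ℤˣ) × Equiv.Perm κ) : Matrix κ κ ℝ :=
  Matrix.of fun p q => if p = γ.2 q then ((γ.1 p : ℤ) : ℝ) else 0

theorem signedPerm_mul (γ δ : (κ → ℤˣ) × Equiv.Perm κ) : signedPerm γ * signedPerm δ =
    signedPerm (fun p => γ.1 p * δ.1 (γ.2⁻¹ p), γ.2 * δ.2) := by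
  ext p q
  rw [Matrix.mul_apply, Finset.sum_eq_single (δ.2 q)]
  · by_cases h : p = γ.2 (δ.2 q)
    · subst h; simp [signedPerm]
    · simp [signedPerm, h]
  · intro r _ hr; simp [signedPerm, hr]
  · simp

theorem signedPerm_one : signedPerm (1 : (κ → ℤˣ) × Equiv.Perm κ) = 1 := by
  ext p q
  simp [signedPerm, Matrix.one_apply]

theorem exists_equiv_signedPerm_mul (δ : (κ → ℤˣ) × Equiv.Perm κ) :
    ∃ e : ((κ → ℤˣ) × Equiv.Perm κ) ≃ ((κ → ℤˣ) × Equiv.Perm κ),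
      ∀ γ, signedPerm γ * signedPerm δ = signedPerm (e γ) := by
  refine ⟨Equiv.ofBijective (fun γ => (fun p => γ.1 p * δ.1 (γ.2⁻¹ p), γ.2 * δ.2))
    (Finite.injective_iff_bijective.1 ?_), fun γ => signedPerm_mul γ δ⟩
  rintro ⟨ε, π⟩ ⟨ε', π'⟩ h
  simp only [Prod.mk.injEq, mul_left_inj] at h
  obtain ⟨h1, rfl⟩ := h
  have : ε = ε' := by
    funext p
    simpa using congrFun h1 p
  rw [this]

theorem reflMatrix_single (q : κ) :
    reflMatrix (Pi.single q 1) = signedPerm (Function.update 1 q (-1), 1) := by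
  ext i j
  simp only [reflMatrix, Matrix.sub_apply, Matrix.smul_apply, vecMulVec_apply, Matrix.one_apply,
    signedPerm, of_apply, Equiv.Perm.one_apply, smul_eq_mul]
  by_cases hij : i = j
  · subst hij
    by_cases h : i = q
    · subst h; norm_num
    · simp [h]
  · by_cases h : i = q
    · subst h; simp [hij, Ne.symm hij]
    · simp [h, hij]

theorem dotProduct_single_self (q : κ) :
    (Pi.single q 1 : κ → ℝ) ⬝ᵥ Pi.single q 1 = 1 := by simp

/-- The unit vector in the direction of `s e_p + e_q`. -/
noncomputable def diagVec (s : ℝ) (p q : κ) : κ → ℝ :=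
  (√2 / 2) • (s • (Pi.single p 1 : κ → ℝ) + Pi.single q 1)

theorem diagVec_unit {s : ℝ} (hs : s ^ 2 = 1) {p q : κ} (h : p ≠ q) :
    diagVec s p q ⬝ᵥ diagVec s p q = 1 := by
  have h2 := sqrt_two_div_two_sq
  simp only [diagVec, dotProduct_smul, dotProduct_add, smul_eq_mul, dotProduct_single,
    Pi.smul_apply, Pi.add_apply, Pi.single_eq_same, Pi.single_eq_of_ne h, Pi.single_eq_of_ne h.symm,
    mul_one, mul_zero, add_zero, zero_add]
  linear_combination (s ^ 2 + 1) * h2 + (1 / 2) * hs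

/-- The reflection sends e_p to -s e_q and e_q to -s e_p. With s = -1 it is a plain transposition,
used to generate the group; s = 1 gives the normals of the design. -/
theorem reflMatrix_diagVec (s : ℤˣ) {p q : κ} (h : p ≠ q) :
    reflMatrix (diagVec ((s : ℤ) : ℝ) p q) =
      signedPerm (Function.update (Function.update 1 p (-s)) q (-s), Equiv.swap p q) := by
  ext i j
  have h2 := sqrt_two_div_two_sq
  simp only [reflMatrix, diagVec, Matrix.sub_apply, Matrix.smul_apply, vecMulVec_apply,
    Matrix.one_apply, signedPerm, of_apply, smul_eq_mul, Pi.smul_apply, Pi.add_apply]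
  have hs : (((s : ℤ) : ℝ)) ^ 2 = 1 := by
    rcases Int.units_eq_one_or s with rfl | rfl <;> norm_num
  rcases eq_or_ne i p with rfl | hip
  · rcases eq_or_ne j i with rfl | hji
    · simp [h]
      linear_combination (-2 * (s : ℝ) ^ 2) * h2 - hs
    · rcases eq_or_ne j q with rfl | hjq
      · simp [h, h.symm]
        linear_combination (2 * (s : ℝ)) * h2
      · simp [h, hji, Ne.symm hji, hjq, Equiv.swap_apply_of_ne_of_ne hji hjq]
  · rcases eq_or_ne i q with rfl | hiq
    · rcases eq_or_ne j p with rfl | hjp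
      · simp [h, h.symm]
        linear_combination (2 * (s : ℝ)) * h2
      · rcases eq_or_ne j i with rfl | hji
        · simp [h.symm]
          linear_combination (-2 : ℝ) * h2
        · simp [h.symm, hji, Ne.symm hji, hjp, Equiv.swap_apply_of_ne_of_ne hjp hji]
    · have : i = Equiv.swap p q j ↔ i = j := by
        rw [← Equiv.swap_apply_of_ne_of_ne hip hiq, Equiv.apply_eq_iff_eq,
          Equiv.swap_apply_of_ne_of_ne hip hiq]
      simp [hip, hiq, this]

theorem signedPerm_mem (γ : (κ → ℤˣ) × Equiv.Perm κ) : signedPerm γ ∈ reflMonoid κ := by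
  obtain ⟨ε, π⟩ := γ
  have h1 : signedPerm (ε, π) = signedPerm (ε, 1) * signedPerm (1, π) := by
    rw [signedPerm_mul]; simp
  rw [h1]
  refine mul_mem ?_ ?_
  · have h2 : ∀ S : Finset κ, signedPerm (fun p => if p ∈ S then ε p else 1, 1) ∈ reflMonoid κ := by
      intro S
      induction S using Finset.induction_on with
      | empty =>
        have := signedPerm_one (κ := κ)
        simp only [Finset.notMem_empty, if_false]
        exact this ▸ one_mem _
      | insert q S hq ih =>
        have h3 : signedPerm (fun p => if p ∈ insert q S then ε p else 1, 1) =
            signedPerm (fun p => if p ∈ S then ε p else 1, 1) *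
              signedPerm (Function.update 1 q (ε q), 1) := by
          rw [signedPerm_mul]
          congr 2
          funext p
          change _ = _ * (Function.update 1 q (ε q) : κ → ℤˣ) p
          by_cases hp : p = q
          · subst hp; simp [hq]
          · simp [hp]
        rw [h3]
        refine mul_mem ih ?_
        rcases Int.units_eq_one_or (ε q) with h | h
        · have := signedPerm_one (κ := κ)
          rw [h, ← Pi.one_apply (M := fun _ => ℤˣ) q, Function.update_eq_self]
          exact this ▸ one_mem _
        · rw [h, ← reflMatrix_single]
          exact reflMatrix_mem (dotProduct_single_self q)
    simpa using h2 Finset.univ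
  · induction π using Equiv.Perm.swap_induction_on with
    | one => exact signedPerm_one (κ := κ) ▸ one_mem _
    | swap_mul f x y hxy ih =>
      have h3 : signedPerm (1, Equiv.swap x y * f) =
          signedPerm (1, Equiv.swap x y) * signedPerm (1, f) := by
        rw [signedPerm_mul]; simp; rfl
      rw [h3]
      refine mul_mem ?_ (ih ?_)
      · have h4 := reflMatrix_diagVec (-1) hxy
        have h5 : (Function.update (Function.update 1 x (- -1)) y (- -1) : κ → ℤˣ) = 1 := by
          rw [neg_neg, ← Pi.one_apply (M := fun _ => ℤˣ) x, Function.update_eq_self,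
            Pi.one_apply, ← Pi.one_apply (M := fun _ => ℤˣ) y, Function.update_eq_self]
        rw [h5] at h4
        rw [← h4]
        exact reflMatrix_mem (diagVec_unit (by norm_num) hxy)
      · rw [signedPerm_mul]; simp

/-- Coordinate normals alone are orthogonal and only produce half turns. Pairing e_p with (e_p +
e_q) / √2 gives the angle π / 4, hence quarter turns in every coordinate plane. -/
theorem isRotDesign_signedPerm : IsRotDesign (signedPerm (κ := κ))
    ({u | ∃ q, u = Pi.single q 1} ∪ {u | ∃ p q, p ≠ q ∧ u = diagVec 1 p q}) where
  ortho γ := reflMonoid_isOrtho (signedPerm_mem γ)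
  unit := by
    rintro u (⟨q, rfl⟩ | ⟨p, q, h, rfl⟩)
    · exact dotProduct_single_self q
    · exact diagVec_unit (by norm_num) h
  inv := by
    rintro u (⟨q, rfl⟩ | ⟨p, q, h, rfl⟩)
    · rw [reflMatrix_single]; exact exists_equiv_signedPerm_mul _
    · have := reflMatrix_diagVec 1 h
      simp only [Units.val_one, Int.cast_one] at this
      rw [this]; exact exists_equiv_signedPerm_mul _
  nonempty := fun ⟨q⟩ => ⟨_, Or.inl ⟨q, rfl⟩⟩
  span x y := by
    have hx : ∀ z : κ → ℝ, z = ∑ p, z p • Pi.single p (1 : ℝ) := fun z => by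
      simpa [← Pi.single_smul] using (Finset.univ_sum_single z).symm
    rw [hx x, hx y, wedge_sum_left]
    refine Submodule.sum_mem _ fun p _ => ?_
    rw [wedge_smul_left, wedge_sum_right]
    refine Submodule.smul_mem _ _ (Submodule.sum_mem _ fun q _ => ?_)
    rw [wedge_smul_right]
    refine Submodule.smul_mem _ _ ?_
    by_cases hpq : p = q
    · subst hpq; rw [wedge_self]; exact zero_mem _
    have h2 : wedge (Pi.single p 1 : κ → ℝ) (Pi.single q 1) =
        √2 • wedge (Pi.single p 1) (diagVec 1 p q) := by
      rw [diagVec, wedge_smul_right, one_smul, wedge_add_right, wedge_self, zero_add, smul_smul]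
      have : √2 * (√2 / 2) = 1 := by
        have := Real.mul_self_sqrt (show (0 : ℝ) ≤ 2 by norm_num)
        linarith
      rw [this, one_smul]
    rw [h2]
    refine Submodule.smul_mem _ _ (Submodule.subset_span
      ⟨_, Or.inl ⟨p, rfl⟩, _, Or.inr ⟨p, q, hpq, rfl⟩, Or.inr ?_, rfl⟩)
    simp [diagVec, hpq]

/-- The average over permutations of the characteristic polynomial of a sum of block conjugates,
computed with signed permutations. -/
theorem IsFrame.expect_stdRep_eq (h : IsFrame R) {ι V : Type*} [Fintype ι] [DecidableEq ι]
    [Fintype V] [DecidableEq V] (A : ι → Matrix (Fin d × V) (Fin d × V) ℝ) (y : ℝ) :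
    (𝔼 Q : ι × V → Equiv.Perm (Fin (d + 1)),
      (∑ m, blockConj (fun j => h.stdRep (Q j)) A m).charpoly).eval y =
    𝔼 T : ι × V → (Fin d → ℤˣ) × Equiv.Perm (Fin d),
      (scalar (Fin d × V) y - ∑ m, blockConj (fun j => signedPerm (T j)) A m).det := by
  have h0 : (𝔼 Q : ι × V → Equiv.Perm (Fin (d + 1)),
      (∑ m, blockConj (fun j => h.stdRep (Q j)) A m).charpoly).eval y =
    𝔼 Q : ι × V → Equiv.Perm (Fin (d + 1)),
      (scalar (Fin d × V) y - ∑ m, blockConj (fun j => h.stdRep (Q j)) A m).det := by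
    simp only [← Matrix.eval_charpoly]
    rw [Finset.expect, Polynomial.eval_smul, Polynomial.eval_finsetSum, Finset.expect]
  rw [h0]
  exact expect_pi_eq (h.stdRep ·) (signedPerm ·) (fun _ => True) (fun _ => trivial)
    (fun _ => trivial)
    (fun g => (scalar (Fin d × V) y - ∑ m, blockConj g A m).det) fun j g _ =>
      h.isRotDesign.expect_eq isRotDesign_signedPerm h.stdRep_mem signedPerm_mem
        ⟨Equiv.inv _, h.stdRep_transpose⟩ (isRotPoly_det A _ j g)

end Designs

end AdditiveProduct

/-! ### Principal minors averaged over signs -/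

namespace AdditiveProduct

section SignAverage

open Matrix
open scoped BigOperators

set_option linter.unusedSectionVars false

variable {n ι : Type*} [Fintype n] [DecidableEq n] [Fintype ι] [DecidableEq ι]

theorem adjugate_apply_updateCol (X : Matrix n n ℝ) (i j : n) :
    X.adjugate i j = (X.updateCol i (Pi.single j 1)).det := by
  rw [← transpose_apply X.adjugate, adjugate_transpose, adjugate_apply, ← det_transpose,
    updateRow_transpose, transpose_transpose]

theorem det_eq_det_updateCol {X : Matrix n n ℝ} {a : n} (h : X a = Pi.single a 1) :
    X.det = (X.updateCol a (Pi.single a 1)).det := by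
  rw [← adjugate_apply_updateCol, det_eq_sum_mul_adjugate_row X a, h,
    Finset.sum_eq_single a (fun b _ hb => by rw [Pi.single_eq_of_ne hb, zero_mul]) (by simp),
    Pi.single_eq_same, one_mul]

/-- The matrix with the rows and columns outside `U` replaced by those of the identity. -/
def mask (U : Finset n) (M : Matrix n n ℝ) : Matrix n n ℝ :=
  Matrix.of fun a b => if a ∈ U ∧ b ∈ U then M a b else (1 : Matrix n n ℝ) a b

theorem mask_apply (U : Finset n) (M : Matrix n n ℝ) (a b : n) :
    mask U M a b = if a ∈ U ∧ b ∈ U then M a b else (1 : Matrix n n ℝ) a b := rfl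

theorem mask_univ (M : Matrix n n ℝ) : mask Finset.univ M = M := by
  ext a b; simp [mask_apply]

theorem mask_empty (M : Matrix n n ℝ) : mask ∅ M = 1 := by
  ext a b; simp [mask_apply]

theorem mask_transpose (U : Finset n) (M : Matrix n n ℝ) : (mask U M)ᵀ = mask U Mᵀ := by
  ext a b
  simp only [transpose_apply, mask_apply, and_comm, Matrix.one_apply, eq_comm]

theorem mask_erase (U : Finset n) (M : Matrix n n ℝ) (a : n) :
    ((mask U M).updateRow a (Pi.single a 1)).updateCol a (Pi.single a 1) = mask (U.erase a) M := by
  ext i j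
  simp only [mask_apply, updateCol_apply, updateRow_apply, Finset.mem_erase, Matrix.one_apply,
    Pi.single_apply]
  by_cases hi : i = a <;> by_cases hj : j = a <;> simp [hi, hj]
  exact fun h => hj h.symm

theorem adjugate_mask_self (U : Finset n) (M : Matrix n n ℝ) (a : n) :
    (mask U M).adjugate a a = (mask (U.erase a) M).det := by
  rw [adjugate_apply, det_eq_det_updateCol (a := a) (by rw [updateRow_self]), mask_erase]

/-- Determinant form of a walk expansion: the first step leaves a for c, and the rest avoids a. The
sign comes from exchanging rows a and b when row a of the cofactor is expanded. -/
theorem adjugate_mask_of_ne {U : Finset n} (M : Matrix n n ℝ) {a b : n} (ha : a ∈ U) (hab : a ≠ b) :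
    (mask U M).adjugate a b =
      -∑ c ∈ U.erase a, M a c * (mask (U.erase a) M).adjugate c b := by
  set Y := (mask U M).updateRow b (Pi.single a 1) with hY
  have hYa : Y a = mask U M a := updateRow_ne hab
  have hYb : Y b = Pi.single a 1 := updateRow_self
  rw [adjugate_apply, ← hY, det_eq_sum_mul_adjugate_row Y a, ← Finset.sum_neg_distrib]
  have hterm : ∀ c, c ≠ a → Y.adjugate c a = -(mask (U.erase a) M).adjugate c b := by
    intro c hc
    set X := ((mask U M).updateRow a (Pi.single a 1)).updateRow b (Pi.single c 1) with hX
    have hXa : X a = Pi.single a 1 := by rw [hX, updateRow_ne hab, updateRow_self]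
    have h1 : Y.updateRow a (Pi.single c 1) = X.submatrix (Equiv.swap a b) id := by
      ext i j
      simp only [hX, hY, submatrix_apply, updateRow_apply, id]
      rcases eq_or_ne i a with rfl | hia
      · simp
      · rcases eq_or_ne i b with rfl | hib
        · simp [hia, hab]
        · simp [hia, hib, Equiv.swap_apply_of_ne_of_ne hia hib]
    have h2 : X.updateCol a (Pi.single a 1) =
        (mask (U.erase a) M).updateRow b (Pi.single c 1) := by
      rw [← mask_erase, hX]
      ext i j
      simp only [updateCol_apply, updateRow_apply]
      by_cases hj : j = a
      · subst hj
        by_cases hi : i = b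
        · subst hi; simp [hab.symm, hc.symm]
        · simp [hi]
      · simp [hj]
    rw [adjugate_apply, h1, det_permute, Equiv.Perm.sign_swap hab, det_eq_det_updateCol hXa, h2,
      adjugate_apply]
    simp
  have h0 : Y.adjugate a a = 0 := by
    rw [adjugate_apply]
    refine det_zero_of_row_eq hab ?_
    rw [updateRow_self, updateRow_ne hab.symm, hYb]
  symm
  refine Finset.sum_subset_zero_on_sdiff (Finset.subset_univ _) (fun c hc => ?_) fun c hc => ?_
  · by_cases hca : c = a
    · rw [hca, h0, mul_zero]
    · have hcU : c ∉ U := fun h => (Finset.mem_sdiff.1 hc).2 (Finset.mem_erase.2 ⟨hca, h⟩)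
      rw [hYa, mask_apply, if_neg (fun h => hcU h.2), Matrix.one_apply_ne (Ne.symm hca), zero_mul]
  · obtain ⟨hca, hcU⟩ := Finset.mem_erase.1 hc
    rw [hterm c hca, hYa, mask_apply, if_pos ⟨ha, hcU⟩, mul_neg]

theorem adjugate_mask_of_ne' {U : Finset n} (M : Matrix n n ℝ) {a b : n} (hb : b ∈ U)
    (hab : a ≠ b) : (mask U M).adjugate a b =
      -∑ c ∈ U.erase b, (mask (U.erase b) M).adjugate a c * M c b := by
  have h := adjugate_mask_of_ne Mᵀ hb hab.symm
  rw [← mask_transpose, ← adjugate_transpose, transpose_apply] at h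
  rw [h]
  congr 1
  refine Finset.sum_congr rfl fun c _ => ?_
  rw [← mask_transpose, ← adjugate_transpose, transpose_apply, transpose_apply, mul_comm]

/-- Cauchy's expansion of a bordered determinant, valid without inverting the smaller minor. -/
theorem det_mask {U : Finset n} (M : Matrix n n ℝ) {v : n} (hv : v ∈ U) :
    (mask U M).det = M v v * (mask (U.erase v) M).det -
      ∑ a ∈ U.erase v, ∑ b ∈ U.erase v,
        M v a * (mask (U.erase v) M).adjugate a b * M b v := by
  rw [det_eq_sum_mul_adjugate_row _ v, ← Finset.add_sum_erase _ _ (Finset.mem_univ v),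
    adjugate_mask_self, mask_apply, if_pos ⟨hv, hv⟩, sub_eq_add_neg, ← Finset.sum_neg_distrib]
  congr 1
  symm
  refine Finset.sum_subset_zero_on_sdiff (Finset.erase_subset_erase _ (Finset.subset_univ _))
    (fun c hc => ?_) fun c hc => ?_
  · have hcv := Finset.ne_of_mem_erase (Finset.mem_sdiff.1 hc).1
    have hcU : c ∉ U := fun h => (Finset.mem_sdiff.1 hc).2 (Finset.mem_erase.2 ⟨hcv, h⟩)
    rw [mask_apply, if_neg (fun h => hcU h.2), Matrix.one_apply_ne (Ne.symm hcv), zero_mul]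
  · obtain ⟨hcv, hcU⟩ := Finset.mem_erase.1 hc
    rw [mask_apply, if_pos ⟨hv, hcU⟩, adjugate_mask_of_ne' M hv hcv, mul_neg, Finset.mul_sum]
    simp only [mul_assoc]

/-- `y - ∑ m, D_m A_m D_m` for diagonal sign matrices `D_m`. -/
def signMat (A : ι → Matrix n n ℝ) (y : ℝ) (ε : ι → n → ℤˣ) : Matrix n n ℝ :=
  Matrix.of fun a b => (if a = b then y else 0) -
    ∑ m, ((ε m a : ℤ) : ℝ) * A m a b * ((ε m b : ℤ) : ℝ)

/-- The average of the determinants of the `U`-minors of `signMat`. -/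
noncomputable def signDet (A : ι → Matrix n n ℝ) (y : ℝ) (U : Finset n) : ℝ :=
  𝔼 ε, (mask U (signMat A y ε)).det

/-- The average of the adjugates of the `U`-minors of `signMat`, conjugated by the signs of one
summand. -/
noncomputable def signAdj (A : ι → Matrix n n ℝ) (y : ℝ) (m : ι) (U : Finset n) (a b : n) : ℝ :=
  𝔼 ε : ι → n → ℤˣ, ((ε m a : ℤ) : ℝ) * ((ε m b : ℤ) : ℝ) *
    (mask U (signMat A y ε)).adjugate a b

variable (A : ι → Matrix n n ℝ) (y : ℝ)

theorem coe_sign_mul_self (s : ℤˣ) : ((s : ℤ) : ℝ) * ((s : ℤ) : ℝ) = 1 := by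
  rcases Int.units_eq_one_or s with rfl | rfl <;> norm_num

theorem signDet_empty : signDet A y ∅ = 1 := by
  simp [signDet, mask_empty]

/-- Flipping the single sign ε m v leaves the minor without v unchanged. As m ≠ m' and p ≠ v, that
sign occurs exactly once in the monomial, so the integrand is odd. -/
theorem expect_sign_eq_zero {U : Finset n} {v p q : n} {m m' : ι} (hv : v ∉ U) (hp : p ≠ v)
    (hm : m ≠ m') (a b : n) :
    𝔼 ε : ι → n → ℤˣ, ((ε m v : ℤ) : ℝ) * ((ε m p : ℤ) : ℝ) * (((ε m' v : ℤ) : ℝ) *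
      ((ε m' q : ℤ) : ℝ)) * (mask U (signMat A y ε)).adjugate a b = 0 := by
  set f : (ι → n → ℤˣ) → ℝ := fun ε => ((ε m v : ℤ) : ℝ) * ((ε m p : ℤ) : ℝ) *
    (((ε m' v : ℤ) : ℝ) * ((ε m' q : ℤ) : ℝ)) * (mask U (signMat A y ε)).adjugate a b with hf
  change 𝔼 ε, f ε = 0
  set δ : ι → n → ℤˣ := fun k x => if k = m ∧ x = v then -1 else 1 with hδ
  have h1 : ∀ ε, f (ε * δ) = -f ε := by
    intro ε
    have h2 : mask U (signMat A y (ε * δ)) = mask U (signMat A y ε) := by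
      ext i j
      simp only [mask_apply]
      split_ifs with h
      · have hi : i ≠ v := fun h' => hv (h' ▸ h.1)
        have hj : j ≠ v := fun h' => hv (h' ▸ h.2)
        simp [signMat, hδ, hi, hj]
      · rfl
    simp only [hf, h2]
    simp [hδ, hp, hm.symm]
  have h3 : 𝔼 ε, f ε = 𝔼 ε, -f ε :=
    (Fintype.expect_equiv (Equiv.mulRight δ) _ _ fun ε => (h1 ε).symm).symm
  rw [Finset.expect_neg_distrib] at h3
  linarith

theorem signMat_of_ne (ε : ι → n → ℤˣ) {a b : n} (h : a ≠ b) : signMat A y ε a b =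
    -∑ m, ((ε m a : ℤ) : ℝ) * A m a b * ((ε m b : ℤ) : ℝ) := by
  simp [signMat, h]

theorem signAdj_self (m : ι) (U : Finset n) (a : n) :
    signAdj A y m U a a = signDet A y (U.erase a) := by
  simp only [signAdj, signDet, coe_sign_mul_self, one_mul, adjugate_mask_self]

/-- In `adjugate_mask_of_ne` a step from a along a summand other than m averages to zero; along m
the signs at a cancel and those at c and b form the next `signAdj`. -/
theorem signAdj_of_ne (m : ι) {U : Finset n} {a b : n} (ha : a ∈ U) (hab : a ≠ b) :
    signAdj A y m U a b =
      ∑ c ∈ U.erase a, A m a c * signAdj A y m (U.erase a) c b := by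
  simp only [signAdj, Finset.mul_expect]
  have h1 : ∀ ε : ι → n → ℤˣ, ((ε m a : ℤ) : ℝ) * ((ε m b : ℤ) : ℝ) *
      (mask U (signMat A y ε)).adjugate a b =
      ∑ c ∈ U.erase a, ∑ m', A m' a c * (((ε m a : ℤ) : ℝ) * ((ε m b : ℤ) : ℝ) *
        (((ε m' a : ℤ) : ℝ) * ((ε m' c : ℤ) : ℝ)) *
          (mask (U.erase a) (signMat A y ε)).adjugate c b) := by
    intro ε
    rw [adjugate_mask_of_ne _ ha hab, ← Finset.sum_neg_distrib, Finset.mul_sum]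
    refine Finset.sum_congr rfl fun c hc => ?_
    rw [signMat_of_ne _ _ _ (Finset.ne_of_mem_erase hc).symm, neg_mul, neg_neg, Finset.sum_mul,
      Finset.mul_sum]
    exact Finset.sum_congr rfl fun m' _ => by ring
  simp only [h1]
  rw [Finset.expect_sum_comm]
  refine Finset.sum_congr rfl fun c hc => ?_
  rw [Finset.expect_sum_comm, Finset.sum_eq_single m]
  · refine Finset.expect_congr rfl fun ε _ => ?_
    have := coe_sign_mul_self (ε m a)
    linear_combination (A m a c * ((ε m b : ℤ) : ℝ) * ((ε m c : ℤ) : ℝ) *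
      (mask (U.erase a) (signMat A y ε)).adjugate c b) * this
  · intro m' _ hm
    rw [← Finset.mul_expect,
      expect_sign_eq_zero A y (Finset.notMem_erase a U) hab.symm (Ne.symm hm), mul_zero]
  · simp

/-- In `det_mask` only the terms that leave v and return to it along the same summand survive the
averaging. The zero diagonals make the diagonal entry equal to y. -/
theorem signDet_eq (hA : ∀ m a, A m a a = 0) {U : Finset n} {v : n} (hv : v ∈ U) :
    signDet A y U = y * signDet A y (U.erase v) - ∑ m, ∑ a ∈ U.erase v, ∑ b ∈ U.erase v,
      A m v a * A m b v * signAdj A y m (U.erase v) a b := by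
  have h1 : ∀ ε : ι → n → ℤˣ, (mask U (signMat A y ε)).det =
      y * (mask (U.erase v) (signMat A y ε)).det - ∑ m, ∑ a ∈ U.erase v, ∑ b ∈ U.erase v, ∑ m',
        A m v a * A m' b v * (((ε m v : ℤ) : ℝ) * ((ε m a : ℤ) : ℝ) *
        (((ε m' v : ℤ) : ℝ) * ((ε m' b : ℤ) : ℝ)) *
          (mask (U.erase v) (signMat A y ε)).adjugate a b) := by
    intro ε
    have h2 : signMat A y ε v v = y := by simp [signMat, hA]
    rw [det_mask _ hv, h2]
    congr 1
    symm
    rw [Finset.sum_comm]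
    refine Finset.sum_congr rfl fun a ha => ?_
    rw [Finset.sum_comm]
    refine Finset.sum_congr rfl fun b hb => ?_
    rw [signMat_of_ne _ _ _ (Finset.ne_of_mem_erase ha).symm,
      signMat_of_ne _ _ _ (Finset.ne_of_mem_erase hb), neg_mul, neg_mul_neg, Finset.sum_mul,
      Finset.sum_mul]
    symm
    refine Finset.sum_congr rfl fun m _ => ?_
    rw [Finset.mul_sum]
    exact Finset.sum_congr rfl fun m' _ => by ring
  simp only [signDet, h1]
  rw [Finset.expect_sub_distrib, Finset.mul_expect]
  congr 1
  simp only [Finset.expect_sum_comm]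
  refine Finset.sum_congr rfl fun m _ => Finset.sum_congr rfl fun a ha =>
    Finset.sum_congr rfl fun b hb => ?_
  rw [Finset.sum_eq_single m, signAdj, Finset.mul_expect]
  · refine Finset.expect_congr rfl fun ε _ => ?_
    have := coe_sign_mul_self (ε m v)
    linear_combination (A m v a * A m b v * ((ε m a : ℤ) : ℝ) * ((ε m b : ℤ) : ℝ) *
      (mask (U.erase v) (signMat A y ε)).adjugate a b) * this
  · intro m' _ hm
    rw [← Finset.mul_expect, expect_sign_eq_zero A y (Finset.notMem_erase v U)
      (Finset.ne_of_mem_erase ha) (Ne.symm hm), mul_zero]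
  · simp

end SignAverage

end AdditiveProduct

/-! ### Green functions of nonnegative matrices -/

namespace AdditiveProduct

section Green

open Matrix

set_option linter.unusedSectionVars false

variable {W : Type*} [Fintype W] [DecidableEq W]

/-- The matrix with the entries outside `F × F` replaced by zero. -/
def cut (F : Finset W) (B : Matrix W W ℝ) : Matrix W W ℝ :=
  Matrix.of fun a b => if a ∈ F ∧ b ∈ F then B a b else 0

theorem cut_apply (F : Finset W) (B : Matrix W W ℝ) (a b : W) :
    cut F B a b = if a ∈ F ∧ b ∈ F then B a b else 0 := rfl

/-- The Green function `∑ t, B_F ^ t / y ^ (t + 1)` of the restriction of `B` to `F`. -/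
noncomputable def green (B : Matrix W W ℝ) (y : ℝ) (F : Finset W) : Matrix W W ℝ :=
  Matrix.of fun a b => ∑' t : ℕ, (cut F B ^ t) a b / y ^ (t + 1)

/-- Nonnegative symmetric matrices with zero diagonal and convergent Green function at `y`. -/
structure HasGreen (B : Matrix W W ℝ) (y : ℝ) : Prop where
  pos : 0 < y
  nonneg : ∀ a b, 0 ≤ B a b
  symm : ∀ a b, B a b = B b a
  diag : ∀ a, B a a = 0
  summable : ∀ a b, Summable fun t : ℕ => (B ^ t) a b / y ^ (t + 1)

theorem pow_apply_nonneg {B : Matrix W W ℝ} (hB : ∀ a b, 0 ≤ B a b) (t : ℕ) (a b : W) :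
    0 ≤ (B ^ t) a b := by
  induction t generalizing a b with
  | zero => rw [pow_zero, Matrix.one_apply]; split_ifs <;> norm_num
  | succ t ih =>
    rw [pow_succ, Matrix.mul_apply]
    exact Finset.sum_nonneg fun c _ => mul_nonneg (ih _ _) (hB _ _)

theorem pow_apply_mono {B C : Matrix W W ℝ} (hB : ∀ a b, 0 ≤ B a b) (h : ∀ a b, B a b ≤ C a b)
    (t : ℕ) (a b : W) : (B ^ t) a b ≤ (C ^ t) a b := by
  induction t generalizing a b with
  | zero => rw [pow_zero, pow_zero]
  | succ t ih =>
    rw [pow_succ, pow_succ, Matrix.mul_apply, Matrix.mul_apply]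
    exact Finset.sum_le_sum fun c _ => mul_le_mul (ih _ _) (h _ _) (hB _ _)
      ((pow_apply_nonneg hB _ _ _).trans (ih _ _))

namespace HasGreen

variable {B : Matrix W W ℝ} {y : ℝ}

theorem cut_nonneg (h : HasGreen B y) (F : Finset W) (a b : W) : 0 ≤ cut F B a b := by
  rw [cut_apply]; split_ifs
  exacts [h.nonneg _ _, le_rfl]

theorem cut_mono (h : HasGreen B y) {F F' : Finset W} (hF : F ⊆ F') (a b : W) :
    cut F B a b ≤ cut F' B a b := by
  rw [cut_apply, cut_apply]
  by_cases h1 : a ∈ F ∧ b ∈ F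
  · rw [if_pos h1, if_pos ⟨hF h1.1, hF h1.2⟩]
  · rw [if_neg h1]; split_ifs
    exacts [h.nonneg _ _, le_rfl]

theorem cut_le (h : HasGreen B y) (F : Finset W) (a b : W) : cut F B a b ≤ B a b := by
  rw [cut_apply]; split_ifs
  exacts [le_rfl, h.nonneg _ _]

theorem summable_cut (h : HasGreen B y) (F : Finset W) (a b : W) :
    Summable fun t : ℕ => (cut F B ^ t) a b / y ^ (t + 1) := by
  have hy := h.pos
  refine (h.summable a b).of_nonneg_of_le (fun t => ?_) fun t => ?_
  · exact div_nonneg (pow_apply_nonneg (h.cut_nonneg F) _ _ _) (by positivity)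
  · exact div_le_div_of_nonneg_right (pow_apply_mono (h.cut_nonneg F) (h.cut_le F) _ _ _)
      (by positivity)

theorem green_nonneg (h : HasGreen B y) (F : Finset W) (a b : W) : 0 ≤ green B y F a b := by
  have hy := h.pos
  exact tsum_nonneg fun t => div_nonneg (pow_apply_nonneg (h.cut_nonneg F) _ _ _) (by positivity)

theorem green_mono (h : HasGreen B y) {F F' : Finset W} (hF : F ⊆ F') (a b : W) :
    green B y F a b ≤ green B y F' a b := by
  have hy := h.pos
  exact (h.summable_cut F a b).tsum_le_tsum (fun t => div_le_div_of_nonneg_right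
    (pow_apply_mono (h.cut_nonneg F) (h.cut_mono hF) _ _ _) (by positivity)) (h.summable_cut F' a b)

theorem green_self_pos (h : HasGreen B y) (F : Finset W) (a : W) : 0 < green B y F a a := by
  have hy := h.pos
  refine (h.summable_cut F a a).tsum_pos (fun t => div_nonneg
    (pow_apply_nonneg (h.cut_nonneg F) _ _ _) (by positivity)) 0 ?_
  rw [pow_zero, Matrix.one_apply_eq]
  positivity

theorem smul_green (h : HasGreen B y) (F : Finset W) :
    y • green B y F = 1 + cut F B * green B y F := by
  have hy := h.pos
  ext a b
  rw [Matrix.smul_apply, Matrix.add_apply, Matrix.mul_apply, smul_eq_mul]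
  simp only [green, of_apply]
  rw [(h.summable_cut F a b).tsum_eq_zero_add, mul_add]
  congr 1
  · rw [pow_zero, zero_add, pow_one]; field_simp
  · simp only [← tsum_mul_left]
    rw [← Summable.tsum_finsetSum fun c _ => (h.summable_cut F c b).mul_left _]
    refine tsum_congr fun t => ?_
    rw [pow_succ' (cut F B), Matrix.mul_apply, pow_succ y (t + 1), Finset.sum_div, Finset.mul_sum]
    refine Finset.sum_congr rfl fun c _ => ?_
    field_simp

theorem mul_green (h : HasGreen B y) (F : Finset W) :
    (y • (1 : Matrix W W ℝ) - cut F B) * green B y F = 1 := by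
  rw [Matrix.sub_mul, Matrix.smul_mul, Matrix.one_mul, h.smul_green]
  abel

theorem green_mul (h : HasGreen B y) (F : Finset W) :
    green B y F * (y • (1 : Matrix W W ℝ) - cut F B) = 1 :=
  mul_eq_one_comm.1 (h.mul_green F)

/-- The resolvent identity; taking F' to be `F.erase a` or ∅ gives the two walk decompositions
below. -/
theorem green_eq_add (h : HasGreen B y) (F F' : Finset W) :
    green B y F = green B y F' + green B y F * (cut F B - cut F' B) * green B y F' := by
  have h1 : cut F B - cut F' B =
      (y • (1 : Matrix W W ℝ) - cut F' B) - (y • (1 : Matrix W W ℝ) - cut F B) := by abel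
  rw [h1, Matrix.mul_sub, Matrix.sub_mul, h.green_mul F, Matrix.mul_assoc, h.mul_green F',
    Matrix.mul_one, Matrix.one_mul]
  abel

theorem green_notMem_left (h : HasGreen B y) {F : Finset W} {a : W} (ha : a ∉ F) (b : W) :
    green B y F a b = (1 : Matrix W W ℝ) a b / y := by
  have h1 := congrFun (congrFun (h.smul_green F) a) b
  rw [Matrix.smul_apply, Matrix.add_apply, Matrix.mul_apply, smul_eq_mul,
    Finset.sum_eq_zero fun c _ => by rw [cut_apply, if_neg fun h => ha h.1, zero_mul],
    add_zero] at h1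
  rw [← h1, mul_div_cancel_left₀ _ h.pos.ne']

/-- A walk from a to b is split at its last visit to a. This is the counterpart of `signAdj_of_ne`.
-/
theorem green_of_ne (h : HasGreen B y) {F : Finset W} {a b : W} (ha : a ∈ F) (hab : a ≠ b) :
    green B y F a b =
      green B y F a a * ∑ c ∈ F.erase a, B a c * green B y (F.erase a) c b := by
  have h0 : ∀ b, a ≠ b → green B y (F.erase a) a b = 0 := fun b hab => by
    rw [h.green_notMem_left (Finset.notMem_erase a F), Matrix.one_apply_ne hab, zero_div]
  have h1 := congrFun (congrFun (h.green_eq_add F (F.erase a)) a) b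
  rw [h1, Matrix.add_apply, h0 b hab, zero_add, Matrix.mul_assoc, Matrix.mul_apply,
    Finset.sum_eq_single a, Matrix.mul_apply]
  · congr 1
    symm
    refine Finset.sum_subset_zero_on_sdiff (Finset.subset_univ _) (fun c hc => ?_) fun c hc => ?_
    · by_cases hca : c = a
      · rw [hca, h0 b hab, mul_zero]
      · have hcF : c ∉ F := fun h => (Finset.mem_sdiff.1 hc).2 (Finset.mem_erase.2 ⟨hca, h⟩)
        simp [cut_apply, hcF]
    · simp [cut_apply, ha, Finset.mem_of_mem_erase hc]
  · intro x _ hx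
    rw [Matrix.mul_apply, Finset.sum_eq_zero, mul_zero]
    intro c _
    by_cases hca : c = a
    · rw [hca, h0 b hab, mul_zero]
    · simp [cut_apply, hx, hca]
  · simp

/-- The renewal equation for returns to a: each excursion leaves to c, moves outside a, and comes
back from x. This is the counterpart of `signDet_eq`. -/
theorem green_self (h : HasGreen B y) {F : Finset W} {a : W} (ha : a ∈ F) :
    green B y F a a * (y - ∑ c ∈ F.erase a, ∑ x ∈ F.erase a,
      B a c * B x a * green B y (F.erase a) c x) = 1 := by
  have hy := h.pos
  have h1 := congrFun (congrFun (h.green_eq_add F ∅) a) a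
  have h2 : ∀ c, green B y ∅ c a = (1 : Matrix W W ℝ) c a / y := fun c =>
    h.green_notMem_left (by simp) a
  have h3 : cut (∅ : Finset W) B = 0 := by ext; simp [cut_apply]
  have h4 : (green B y F * (cut F B - cut ∅ B) * green B y ∅) a a =
      (∑ x ∈ F.erase a, green B y F a x * B x a) / y := by
    rw [h3, sub_zero, Matrix.mul_apply, Finset.sum_eq_single a]
    · rw [h2, Matrix.one_apply_eq, mul_one_div, Matrix.mul_apply]
      congr 1
      symm
      refine Finset.sum_subset_zero_on_sdiff (Finset.subset_univ _) (fun c hc => ?_) fun c hc => ?_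
      · by_cases hca : c = a
        · simp [hca, cut_apply, h.diag]
        · have hcF : c ∉ F := fun h => (Finset.mem_sdiff.1 hc).2 (Finset.mem_erase.2 ⟨hca, h⟩)
          simp [cut_apply, hcF]
      · simp [cut_apply, ha, Finset.mem_of_mem_erase hc]
    · intro c _ hc
      rw [h2, Matrix.one_apply_ne hc, zero_div, mul_zero]
    · simp
  rw [Matrix.add_apply, h4, h2, Matrix.one_apply_eq] at h1
  have h5 : ∑ x ∈ F.erase a, green B y F a x * B x a = green B y F a a *
      ∑ c ∈ F.erase a, ∑ x ∈ F.erase a, B a c * B x a * green B y (F.erase a) c x := by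
    rw [Finset.sum_comm, Finset.mul_sum]
    refine Finset.sum_congr rfl fun x hx => ?_
    rw [h.green_of_ne ha (Finset.ne_of_mem_erase hx).symm, mul_assoc, Finset.sum_mul]
    congr 1
    exact Finset.sum_congr rfl fun c _ => by ring
  rw [h5] at h1
  field_simp at h1
  linarith

end HasGreen

end Green

/-! ### Comparison of averaged minors with the Green function of a cover -/

section SheetCover

open Matrix

set_option linter.unusedSectionVars false

variable {n ι W P : Type*} [Fintype n] [DecidableEq n] [Fintype ι] [DecidableEq ι] [Fintype W]
  [DecidableEq W]

/-- Finite pieces of covers of the sum of the graphs `R m`, in which every vertex of small level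
has, in each summand, a copy of every neighbour of its image, and different summands share no
edges. -/
structure SheetCover (R : ι → n → n → Prop) (L : ℕ) (P : Type*) (B : Matrix W W ℝ) where
  proj : P → W → n
  level : W → ℕ
  same : ι → W → W → Prop
  nbr : P → ι → W → n → W
  same_symm : ∀ {m w w'}, same m w w' → same m w' w
  same_trans : ∀ {m w w' w''}, same m w w' → same m w' w'' → same m w w''
  same_inj : ∀ {p m w w'}, same m w w' → proj p w = proj p w' → w = w'
  proj_nbr : ∀ {p m w b}, level w < L → R m (proj p w) b → proj p (nbr p m w b) = b
  level_nbr : ∀ {p m w b}, level w < L → R m (proj p w) b → level (nbr p m w b) ≤ level w + 1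
  edge_nbr : ∀ {p m w b}, level w < L → R m (proj p w) b → B w (nbr p m w b) = 1
  same_nbr : ∀ {p m w b}, level w < L → R m (proj p w) b → same m w (nbr p m w b)
  nbr_inj : ∀ {p m m' w b b'}, level w < L → R m (proj p w) b → R m' (proj p w) b' →
    nbr p m w b = nbr p m' w b' → m = m'
  exists_lift : ∀ v, ∃ p w, proj p w = v ∧ level w + Fintype.card n ≤ L

namespace SheetCover

variable {R : ι → n → n → Prop} {L : ℕ} {B : Matrix W W ℝ} {y : ℝ}

/-- The vertices of the cover above `U`. -/
def fiber (S : SheetCover R L P B) (p : P) (U : Finset n) : Finset W :=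
  Finset.univ.filter fun w => S.proj p w ∈ U

theorem mem_fiber (S : SheetCover R L P B) {p : P} {U : Finset n} {w : W} :
    w ∈ S.fiber p U ↔ S.proj p w ∈ U := by simp [fiber]

theorem fiber_erase_subset (S : SheetCover R L P B) (p : P) (U : Finset n) (w : W) :
    S.fiber p (U.erase (S.proj p w)) ⊆ (S.fiber p U).erase w := by
  intro x hx
  rw [mem_fiber, Finset.mem_erase] at hx
  rw [Finset.mem_erase, mem_fiber]
  exact ⟨fun h => hx.1 (by rw [h]), hx.2⟩

open Classical in
/-- The matrices of the summands. -/
noncomputable def relMat (R : ι → n → n → Prop) (m : ι) : Matrix n n ℝ :=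
  Matrix.of fun a b => if R m a b then 1 else 0

theorem nbr_mem (S : SheetCover R L P B) {p : P} {m : ι} {w : W} {b : n} {U : Finset n}
    (hw : S.level w < L) (hR : R m (S.proj p w) b) (hb : b ∈ U) (hne : b ≠ S.proj p w) :
    S.nbr p m w b ∈ (S.fiber p U).erase w := by
  rw [Finset.mem_erase, mem_fiber, S.proj_nbr hw hR]
  exact ⟨fun h => hne (by rw [← S.proj_nbr hw hR, h]), hb⟩

/-- The estimates of the induction over the vertex subset `U`. -/
structure Estimates (S : SheetCover R L P B) (y : ℝ) (U : Finset n) : Prop where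
  pos : 0 < signDet (relMat R) y U
  adj_le : ∀ p m w w', S.proj p w ∈ U → S.proj p w' ∈ U → S.same m w w' → S.level w + U.card ≤ L →
    signAdj (relMat R) y m U (S.proj p w) (S.proj p w') ≤
      signDet (relMat R) y U * green B y (S.fiber p U) w w'

open Classical in
-- Compare `signDet_eq` with `green_self`. Each pair of neighbours of v along one summand lifts to a
-- pair of neighbours of w, injectively, and the inductive bound controls its term. The remaining
-- pairs in the cover, for instance those from different summands, contribute nonnegative terms.
-- Replacing the smaller fiber by `(S.fiber p U).erase w` only increases the Green function.
theorem erase_le_of_estimates (S : SheetCover R L P B) (hB : HasGreen B y) (hR : ∀ m a, ¬R m a a)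
    (hRs : ∀ m a b, R m a b → R m b a) {U : Finset n} {p : P} {w : W} (hw : S.proj p w ∈ U)
    (hL : S.level w + U.card ≤ L) (ih : S.Estimates y (U.erase (S.proj p w))) :
    signDet (relMat R) y (U.erase (S.proj p w)) ≤
      signDet (relMat R) y U * green B y (S.fiber p U) w w := by
  set v := S.proj p w with hv
  set U' := U.erase v with hU'
  set G := green B y ((S.fiber p U).erase w) with hG
  have hcard : U'.card + 1 = U.card := Finset.card_erase_add_one hw
  have hlt : S.level w < L := by omega
  have hwF : w ∈ S.fiber p U := (S.mem_fiber).2 hw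
  set T : Finset (ι × n) := (Finset.univ ×ˢ U').filter fun x => R x.1 v x.2 with hT
  have hTmem : ∀ x ∈ T, R x.1 v x.2 ∧ x.2 ∈ U' := fun x hx => by
    simp only [hT, Finset.mem_filter, Finset.mem_product] at hx
    exact ⟨hx.2, hx.1.2⟩
  have h1 : ∑ m, ∑ a ∈ U', ∑ b ∈ U',
      relMat R m v a * relMat R m b v * signAdj (relMat R) y m U' a b ≤
      signDet (relMat R) y U' * ∑ x ∈ T, ∑ x' ∈ T, G (S.nbr p x.1 w x.2) (S.nbr p x'.1 w x'.2) := by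
    have h2 : ∀ m, ∀ a ∈ U', ∀ b ∈ U',
        relMat R m v a * relMat R m b v * signAdj (relMat R) y m U' a b ≤
        if R m v a ∧ R m v b then
          signDet (relMat R) y U' * G (S.nbr p m w a) (S.nbr p m w b) else 0 := by
      intro m a ha b hb
      by_cases h : R m v a ∧ R m v b
      · have e1 : relMat R m v a = 1 := if_pos h.1
        have e2 : relMat R m b v = 1 := if_pos (hRs _ _ _ h.2)
        rw [if_pos h, e1, e2, one_mul, one_mul]
        have pa := S.proj_nbr hlt h.1
        have pb := S.proj_nbr hlt h.2
        have := ih.adj_le p m (S.nbr p m w a) (S.nbr p m w b) (by rwa [pa]) (by rwa [pb])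
          (S.same_trans (S.same_symm (S.same_nbr hlt h.1)) (S.same_nbr hlt h.2))
          (by have := S.level_nbr hlt h.1; omega)
        rw [pa, pb] at this
        refine this.trans (mul_le_mul_of_nonneg_left ?_ ih.pos.le)
        exact hB.green_mono (S.fiber_erase_subset p U w) _ _
      · rw [if_neg h]
        rcases not_and_or.1 h with h | h
        · have e1 : relMat R m v a = 0 := if_neg h
          rw [e1]; simp
        · have e1 : relMat R m b v = 0 := if_neg fun h' => h (hRs _ _ _ h')
          rw [e1]; simp
    refine (Finset.sum_le_sum fun m _ => Finset.sum_le_sum fun a ha =>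
      Finset.sum_le_sum fun b hb => h2 m a ha b hb).trans ?_
    rw [hT, Finset.mul_sum, Finset.sum_filter, Finset.sum_product]
    refine Finset.sum_le_sum fun m _ => Finset.sum_le_sum fun a _ => ?_
    by_cases h : R m v a
    · simp only [h, true_and, if_true]
      rw [Finset.sum_filter, Finset.sum_product, Finset.mul_sum]
      refine le_trans (le_of_eq ?_) (Finset.single_le_sum (fun m' _ => ?_) (Finset.mem_univ m))
      · rw [Finset.mul_sum]
        exact Finset.sum_congr rfl fun b _ => by split_ifs <;> simp
      · refine mul_nonneg ih.pos.le (Finset.sum_nonneg fun b _ => ?_)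
        split_ifs
        exacts [hB.green_nonneg _ _ _, le_rfl]
    · simp [h]
  have h3 : ∑ x ∈ T, ∑ x' ∈ T, G (S.nbr p x.1 w x.2) (S.nbr p x'.1 w x'.2) ≤
      ∑ c ∈ (S.fiber p U).erase w, ∑ x ∈ (S.fiber p U).erase w, B w c * B x w * G c x := by
    have hinj : Set.InjOn (fun x : ι × n => S.nbr p x.1 w x.2) T := by
      intro x hx x' hx' h
      have hx := (hTmem x hx).1
      have hx' := (hTmem x' hx').1
      refine Prod.ext (S.nbr_inj hlt hx hx' h) ?_
      rw [← S.proj_nbr hlt hx, ← S.proj_nbr hlt hx']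
      exact congrArg (S.proj p) h
    have hsub : T.image (fun x : ι × n => S.nbr p x.1 w x.2) ⊆ (S.fiber p U).erase w := by
      intro c hc
      obtain ⟨x, hx, rfl⟩ := Finset.mem_image.1 hc
      obtain ⟨hx, hxU⟩ := hTmem x hx
      exact S.nbr_mem hlt hx (Finset.mem_of_mem_erase hxU) (Finset.ne_of_mem_erase hxU)
    have hB1 : ∀ x ∈ T, B w (S.nbr p x.1 w x.2) = 1 := fun x hx => S.edge_nbr hlt (hTmem x hx).1
    have hB2 : ∀ x ∈ T, B (S.nbr p x.1 w x.2) w = 1 := fun x hx => by rw [hB.symm, hB1 x hx]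
    have hnn : ∀ c x, 0 ≤ B w c * B x w * G c x := fun c x =>
      mul_nonneg (mul_nonneg (hB.nonneg _ _) (hB.nonneg _ _)) (hB.green_nonneg _ _ _)
    calc _ = ∑ c ∈ T.image (fun x : ι × n => S.nbr p x.1 w x.2),
          ∑ x ∈ T.image (fun x : ι × n => S.nbr p x.1 w x.2), B w c * B x w * G c x := by
          rw [Finset.sum_image hinj]
          refine Finset.sum_congr rfl fun x hx => ?_
          rw [Finset.sum_image hinj]
          refine Finset.sum_congr rfl fun x' hx' => ?_
          rw [hB1 x hx, hB2 x' hx', one_mul, one_mul]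
      _ ≤ ∑ c ∈ T.image (fun x : ι × n => S.nbr p x.1 w x.2),
          ∑ x ∈ (S.fiber p U).erase w, B w c * B x w * G c x :=
          Finset.sum_le_sum fun c _ =>
            Finset.sum_le_sum_of_subset_of_nonneg hsub fun x _ _ => hnn c x
      _ ≤ _ := Finset.sum_le_sum_of_subset_of_nonneg hsub fun c _ _ =>
          Finset.sum_nonneg fun x _ => hnn c x
  have h4 := hB.green_self hwF
  have hg := hB.green_self_pos (S.fiber p U) w
  have h5 := signDet_eq (relMat R) y (fun m a => if_neg (hR m a)) hw
  have h6 : signDet (relMat R) y U' * (y - ∑ c ∈ (S.fiber p U).erase w,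
      ∑ x ∈ (S.fiber p U).erase w, B w c * B x w * G c x) ≤ signDet (relMat R) y U := by
    rw [h5, mul_sub, mul_comm y]
    exact sub_le_sub_left (h1.trans (mul_le_mul_of_nonneg_left h3 ih.pos.le)) _
  calc signDet (relMat R) y U' = signDet (relMat R) y U' * (green B y (S.fiber p U) w w *
        (y - ∑ c ∈ (S.fiber p U).erase w, ∑ x ∈ (S.fiber p U).erase w,
          B w c * B x w * G c x)) := by rw [h4, mul_one]
    _ = (signDet (relMat R) y U' * (y - ∑ c ∈ (S.fiber p U).erase w,
        ∑ x ∈ (S.fiber p U).erase w, B w c * B x w * G c x)) * green B y (S.fiber p U) w w := by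
      ring
    _ ≤ _ := mul_le_mul_of_nonneg_right h6 hg.le

open Classical in
-- The first-step recursion `signAdj_of_ne` is compared termwise with `green_of_ne`; the outer
-- factor green(w, w) is paid for by `erase_le_of_estimates`. For w = w' the claim is that estimate
-- itself.
theorem adj_le_of_estimates (S : SheetCover R L P B) (hB : HasGreen B y) (hR : ∀ m a, ¬R m a a)
    (hRs : ∀ m a b, R m a b → R m b a) {U : Finset n} {p : P} {m : ι} {w w' : W}
    (hw : S.proj p w ∈ U) (hw' : S.proj p w' ∈ U) (hs : S.same m w w')
    (hL : S.level w + U.card ≤ L) (ih : S.Estimates y (U.erase (S.proj p w))) :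
    signAdj (relMat R) y m U (S.proj p w) (S.proj p w') ≤
      signDet (relMat R) y U * green B y (S.fiber p U) w w' := by
  have herase := S.erase_le_of_estimates hB hR hRs hw hL ih
  by_cases hww : w = w'
  · subst hww
    rwa [signAdj_self]
  have hne : S.proj p w ≠ S.proj p w' := fun h => hww (S.same_inj hs h)
  set v := S.proj p w with hv
  set U' := U.erase v with hU'
  set G := green B y ((S.fiber p U).erase w) with hG
  have hcard : U'.card + 1 = U.card := Finset.card_erase_add_one hw
  have hlt : S.level w < L := by omega
  have hwF : w ∈ S.fiber p U := (S.mem_fiber).2 hw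
  rw [signAdj_of_ne _ _ _ hw hne]
  set T := U'.filter fun b => R m v b with hT
  have hTmem : ∀ b ∈ T, R m v b ∧ b ∈ U' := fun b hb => (Finset.mem_filter.1 hb).symm
  have hnn : ∀ c, 0 ≤ B w c * G c w' := fun c =>
    mul_nonneg (hB.nonneg _ _) (hB.green_nonneg _ _ _)
  have hinj : Set.InjOn (fun b => S.nbr p m w b) T := by
    intro b hb b' hb' h
    rw [← S.proj_nbr hlt (hTmem b hb).1, ← S.proj_nbr hlt (hTmem b' hb').1]
    exact congrArg (S.proj p) h
  have hsub : T.image (fun b => S.nbr p m w b) ⊆ (S.fiber p U).erase w := by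
    intro c hc
    obtain ⟨b, hb, rfl⟩ := Finset.mem_image.1 hc
    obtain ⟨hb, hbU⟩ := hTmem b hb
    exact S.nbr_mem hlt hb (Finset.mem_of_mem_erase hbU) (Finset.ne_of_mem_erase hbU)
  calc ∑ b ∈ U', relMat R m v b * signAdj (relMat R) y m U' b (S.proj p w')
      = ∑ b ∈ T, signAdj (relMat R) y m U' b (S.proj p w') := by
        rw [hT, Finset.sum_filter]
        refine Finset.sum_congr rfl fun b _ => ?_
        by_cases h : R m v b <;> simp [relMat, h]
    _ ≤ ∑ b ∈ T, signDet (relMat R) y U' * (B w (S.nbr p m w b) * G (S.nbr p m w b) w') := by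
        refine Finset.sum_le_sum fun b hb => ?_
        obtain ⟨hb, hbU⟩ := hTmem b hb
        have pb := S.proj_nbr hlt hb
        have := ih.adj_le p m (S.nbr p m w b) w' (by rwa [pb])
          (Finset.mem_erase.2 ⟨hne.symm, hw'⟩) (S.same_trans (S.same_symm (S.same_nbr hlt hb)) hs)
          (by have := S.level_nbr hlt hb; omega)
        rw [pb] at this
        rw [S.edge_nbr hlt hb, one_mul]
        refine this.trans (mul_le_mul_of_nonneg_left ?_ ih.pos.le)
        exact hB.green_mono (S.fiber_erase_subset p U w) _ _
    _ = signDet (relMat R) y U' * ∑ c ∈ T.image (fun b => S.nbr p m w b), B w c * G c w' := by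
        rw [Finset.sum_image hinj, Finset.mul_sum]
    _ ≤ signDet (relMat R) y U' * ∑ c ∈ (S.fiber p U).erase w, B w c * G c w' :=
        mul_le_mul_of_nonneg_left
          (Finset.sum_le_sum_of_subset_of_nonneg hsub fun c _ _ => hnn c) ih.pos.le
    _ ≤ (signDet (relMat R) y U * green B y (S.fiber p U) w w) *
        ∑ c ∈ (S.fiber p U).erase w, B w c * G c w' :=
        mul_le_mul_of_nonneg_right herase (Finset.sum_nonneg fun c _ => hnn c)
    _ = _ := by rw [hB.green_of_ne hwF hww, mul_assoc]

/-- Induction on the size of U. A step to a neighbour raises the level by at most one while U loses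
a vertex, so the bound level + |U| ≤ L persists, and `exists_lift` gives enough room at the start.
Positivity for U follows from positivity for U without v, because the Green function in
`erase_le_of_estimates` is nonnegative. -/
theorem estimates (S : SheetCover R L P B) (hB : HasGreen B y) (hR : ∀ m a, ¬R m a a)
    (hRs : ∀ m a b, R m a b → R m b a) (U : Finset n) : S.Estimates y U := by
  induction hk : U.card generalizing U with
  | zero =>
    obtain rfl := Finset.card_eq_zero.1 hk
    exact ⟨by rw [signDet_empty]; exact one_pos,
      fun p m w w' h => absurd h (Finset.notMem_empty _)⟩
  | succ k ih =>
    have ih' : ∀ v ∈ U, S.Estimates y (U.erase v) := fun v hv =>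
      ih _ (by rw [Finset.card_erase_of_mem hv, hk]; rfl)
    refine ⟨?_, fun p m w w' hw hw' hs hL => S.adj_le_of_estimates hB hR hRs hw hw' hs hL (ih' _ hw)⟩
    obtain ⟨v, hv⟩ : U.Nonempty := Finset.card_pos.1 (by omega)
    obtain ⟨p, w, rfl, hL⟩ := S.exists_lift v
    have h1 := S.erase_le_of_estimates hB hR hRs hv
      (by have := Finset.card_le_univ U; omega) (ih' _ hv)
    exact pos_of_mul_pos_left ((ih' _ hv).pos.trans_le h1) (hB.green_nonneg _ _ _)

/-- Beyond the convergence radius of the cover, the averaged characteristic polynomial is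
positive. -/
theorem signDet_univ_pos (S : SheetCover R L P B) (hB : HasGreen B y) (hR : ∀ m a, ¬R m a a)
    (hRs : ∀ m a b, R m a b → R m b a) : 0 < signDet (relMat R) y Finset.univ :=
  (S.estimates hB hR hRs _).pos

end SheetCover

end SheetCover

end AdditiveProduct

/-! ### Walk counts and the spectral radius -/

namespace AdditiveProduct

section WalkCount

open SimpleGraph Filter

set_option linter.unusedSectionVars false

variable {W : Type*} {X : SimpleGraph W} {Δ : ℕ}

theorem finite_walks (hfin : ∀ a, (X.neighborSet a).Finite) (t : ℕ) (a b : W) :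
    {p : X.Walk a b | p.length = t}.Finite := by
  classical
  let _ : X.LocallyFinite := fun a => (hfin a).fintype
  rw [← coe_finsetWalkLength_eq]
  exact Finset.finite_toSet _

theorem ncard_walks_le (hfin : ∀ a, (X.neighborSet a).Finite)
    (hΔ : ∀ a, (X.neighborSet a).ncard ≤ Δ) (t : ℕ) (a b : W) :
    {p : X.Walk a b | p.length = t}.ncard ≤ Δ ^ t := by
  classical
  let _ : X.LocallyFinite := fun a => (hfin a).fintype
  rw [← coe_finsetWalkLength_eq, Set.ncard_coe_finset]
  induction t generalizing a with
  | zero =>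
    rw [pow_zero, finsetWalkLength]
    split_ifs with h
    · subst h; simp
    · simp
  | succ t ih =>
    rw [finsetWalkLength, pow_succ']
    refine (Finset.card_biUnion_le_card_mul _ _ (Δ ^ t) fun c _ => ?_).trans
      (Nat.mul_le_mul_right _ ?_)
    · rw [Finset.card_map]; exact ih _
    · rw [Finset.card_univ, ← Nat.card_eq_fintype_card]
      exact hΔ a

theorem ncard_walks_cons (hfin : ∀ a, (X.neighborSet a).Finite) (t : ℕ) {a a' : W} (b : W)
    (h : X.Adj a' a) : {p : X.Walk a b | p.length = t}.ncard ≤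
      {p : X.Walk a' b | p.length = t + 1}.ncard :=
  Set.ncard_le_ncard_of_injOn (Walk.cons h) (fun p hp => by
    rw [Set.mem_ofPred_eq] at hp ⊢; rw [Walk.length_cons, hp])
    (fun p _ q _ hpq => by simpa using hpq) (finite_walks hfin _ _ _)

theorem ncard_walks_comm (t : ℕ) (a b : W) : {p : X.Walk a b | p.length = t}.ncard =
    {p : X.Walk b a | p.length = t}.ncard := by
  rw [← Set.ncard_image_of_injective _ (Walk.reverse_injective (u := a) (v := b))]
  congr 1
  ext p
  refine ⟨?_, fun h => ⟨p.reverse, by simpa using h, p.reverse_reverse⟩⟩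
  rintro ⟨q, hq, rfl⟩
  simpa using hq

theorem exists_ncard_walks_le_left (hfin : ∀ a, (X.neighborSet a).Finite) {a a' : W}
    (h : X.Reachable a' a) (b : W) : ∃ k, ∀ t, {p : X.Walk a b | p.length = t}.ncard ≤
      {p : X.Walk a' b | p.length = t + k}.ncard := by
  obtain ⟨q⟩ := h
  induction q with
  | nil => exact ⟨0, fun t => le_rfl⟩
  | cons h q ih =>
    obtain ⟨k, hk⟩ := ih
    exact ⟨k + 1, fun t => (hk t).trans (ncard_walks_cons hfin _ _ h)⟩

theorem exists_ncard_walks_le (hfin : ∀ a, (X.neighborSet a).Finite) (hX : X.Preconnected)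
    (a b u v : W) : ∃ k, ∀ t, {p : X.Walk a b | p.length = t}.ncard ≤
      {p : X.Walk u v | p.length = t + k}.ncard := by
  obtain ⟨k, hk⟩ := exists_ncard_walks_le_left hfin (hX u a) b
  obtain ⟨l, hl⟩ := exists_ncard_walks_le_left hfin (hX v b) u
  refine ⟨k + l, fun t => (hk t).trans ?_⟩
  rw [ncard_walks_comm, ← add_assoc, ncard_walks_comm (t + k + l)]
  exact hl _

/-- Bounded degree makes the limsup in `rho` meaningful; for a real sequence not bounded above it
would be a default value. -/
theorem isBoundedUnder_walks (hfin : ∀ a, (X.neighborSet a).Finite)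
    (hΔ : ∀ a, (X.neighborSet a).ncard ≤ Δ) (u v : W) :
    IsBoundedUnder (· ≤ ·) atTop fun t : ℕ =>
      (Set.ncard {p : X.Walk u v | p.length = t} : ℝ) ^ (1 / (t : ℝ)) := by
  refine isBoundedUnder_of_eventually_le (a := (Δ : ℝ)) ?_
  filter_upwards [eventually_gt_atTop 0] with t ht
  have h1 : (Set.ncard {p : X.Walk u v | p.length = t} : ℝ) ≤ (Δ : ℝ) ^ t := by
    exact_mod_cast ncard_walks_le hfin hΔ t u v
  calc _ ≤ ((Δ : ℝ) ^ t) ^ (1 / (t : ℝ)) :=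
        Real.rpow_le_rpow (Nat.cast_nonneg _) h1 (by positivity)
    _ = Δ := by rw [one_div]; exact Real.pow_rpow_inv_natCast (Nat.cast_nonneg _) ht.ne'

theorem rho_nonneg (hfin : ∀ a, (X.neighborSet a).Finite)
    (hΔ : ∀ a, (X.neighborSet a).ncard ≤ Δ) (u v : W) : 0 ≤ rho X u v :=
  le_limsup_of_frequently_le (Frequently.of_forall fun _ => Real.rpow_nonneg (Nat.cast_nonneg _) _)
    (isBoundedUnder_walks hfin hΔ u v)

theorem summable_walks (hfin : ∀ a, (X.neighborSet a).Finite)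
    (hΔ : ∀ a, (X.neighborSet a).ncard ≤ Δ) {u v : W} {y : ℝ} (hy : rho X u v < y) :
    Summable fun t : ℕ => (Set.ncard {p : X.Walk u v | p.length = t} : ℝ) / y ^ t := by
  have h0 := rho_nonneg hfin hΔ u v
  obtain ⟨z, hz, hzy⟩ := exists_between hy
  have hz0 : 0 < z := h0.trans_lt hz
  have hy0 : 0 < y := hz0.trans hzy
  have h1 : ∀ᶠ t : ℕ in atTop,
      ‖(Set.ncard {p : X.Walk u v | p.length = t} : ℝ) / y ^ t‖ ≤ (z / y) ^ t := by
    filter_upwards [eventually_lt_of_limsup_lt hz (isBoundedUnder_walks hfin hΔ u v),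
      eventually_gt_atTop 0] with t ht ht0
    rw [Real.norm_of_nonneg (by positivity), div_pow]
    refine div_le_div_of_nonneg_right ?_ (by positivity)
    have h2 := pow_le_pow_left₀ (Real.rpow_nonneg (Nat.cast_nonneg _) _) ht.le t
    rwa [one_div, Real.rpow_inv_natCast_pow (Nat.cast_nonneg _) ht0.ne'] at h2
  exact Summable.of_norm_bounded_eventually_nat
    (summable_geometric_of_lt_one (by positivity) ((div_lt_one hy0).2 hzy)) h1

/-- Fixed connecting walks, of total length k, prolong a walk from a to b into one from u to v, so
convergence for the pair u, v passes to every pair with a shift of k. -/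
theorem summable_walks_of_preconnected (hfin : ∀ a, (X.neighborSet a).Finite)
    (hΔ : ∀ a, (X.neighborSet a).ncard ≤ Δ) (hX : X.Preconnected) {u v : W} {y : ℝ}
    (hy : rho X u v < y) (a b : W) :
    Summable fun t : ℕ => (Set.ncard {p : X.Walk a b | p.length = t} : ℝ) / y ^ (t + 1) := by
  have hy0 : 0 < y := (rho_nonneg hfin hΔ u v).trans_lt hy
  obtain ⟨k, hk⟩ := exists_ncard_walks_le hfin hX a b u v
  have h1 := (((summable_nat_add_iff k).2 (summable_walks hfin hΔ hy)).mul_left (y ^ k / y))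
  refine h1.of_nonneg_of_le (fun t => by positivity) fun t => ?_
  have h2 : (Set.ncard {p : X.Walk a b | p.length = t} : ℝ) ≤
      Set.ncard {p : X.Walk u v | p.length = t + k} := by exact_mod_cast hk t
  calc _ ≤ (Set.ncard {p : X.Walk u v | p.length = t + k} : ℝ) / y ^ (t + 1) :=
        div_le_div_of_nonneg_right h2 (by positivity)
    _ = _ := by rw [pow_add y t k, pow_succ]; field_simp

open Classical in
/-- The adjacency matrix of a finite induced subgraph has a Green function beyond the spectral
radius of the whole graph. -/
theorem hasGreen_adjMatrix {S : Type*} [Fintype S] [DecidableEq S] (f : S ↪ W)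
    (hfin : ∀ a, (X.neighborSet a).Finite) (hΔ : ∀ a, (X.neighborSet a).ncard ≤ Δ)
    (hX : X.Preconnected) {u v : W} {y : ℝ} (hy : rho X u v < y) :
    HasGreen ((X.comap f).adjMatrix ℝ) y where
  pos := (rho_nonneg hfin hΔ u v).trans_lt hy
  nonneg a b := by rw [adjMatrix_apply]; split_ifs <;> norm_num
  symm a b := by simp only [adjMatrix_apply, adj_comm]
  diag a := by simp
  summable a b := by
    have hy0 : 0 < y := (rho_nonneg hfin hΔ u v).trans_lt hy
    refine (summable_walks_of_preconnected hfin hΔ hX hy (f a) (f b)).of_nonneg_of_le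
      (fun t => ?_) fun t => ?_
    · rw [adjMatrix_pow_apply_eq_card_walk]; positivity
    · rw [adjMatrix_pow_apply_eq_card_walk]
      refine div_le_div_of_nonneg_right ?_ (by positivity)
      rw [← Nat.card_eq_fintype_card]
      refine Nat.cast_le.2 (Set.ncard_le_ncard_of_injOn
        (Walk.map (Embedding.comap f X).toHom) (fun p hp => ?_)
        ((Walk.map_injective_of_injective (Embedding.comap f X).injective a b).injOn)
        (finite_walks hfin _ _ _))
      have hp : p.length = t := hp
      exact (Walk.length_map _ _).trans hp

end WalkCount

end AdditiveProduct

/-! ### The additive product as a cover of every lift -/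

namespace AdditiveProduct

section WordCover

open SimpleGraph

set_option linter.unusedSectionVars false

variable {V : Type*} {c : ℕ} {A : Fin c → SimpleGraph V} {r : V}

open Classical in
/-- The word obtained from `s` by moving to the vertex `z` of an atom of colour `C` that does not
contain the last step of `s`. -/
noncomputable def stepTo (r : V) (C : Fin c) (s : List (Fin c × V)) (z : V) : List (Fin c × V) :=
  if z = endpoint r s then s else (C, z) :: s

open Classical in
/-- The word at which the copy of the atom of colour `C` through `s` is attached. -/
noncomputable def attach (C : Fin c) : List (Fin c × V) → List (Fin c × V)
  | [] => []
  | p :: s => if p.1 = C then s else p :: s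

theorem endpoint_stepTo (C : Fin c) (s : List (Fin c × V)) (z : V) :
    endpoint r (stepTo r C s z) = z := by
  rw [stepTo]; split_ifs with h
  exacts [h.symm, rfl]

theorem isWord_attach {C : Fin c} {s : List (Fin c × V)} (hs : IsWord A r s) :
    IsWord A r (attach C s) := by
  cases s with
  | nil => exact hs
  | cons p s =>
    rw [attach]; split_ifs
    exacts [hs.1, hs]

theorem head_attach {C : Fin c} {s : List (Fin c × V)} (hs : IsWord A r s) :
    ∀ p ∈ (attach C s).head?, p.1 ≠ C := by
  cases s with
  | nil => simp [attach]
  | cons p s =>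
    rw [attach]; split_ifs with h
    · subst h; exact hs.2.1
    · simpa using h

theorem stepTo_attach {C : Fin c} {s : List (Fin c × V)} (hs : IsWord A r s) :
    stepTo r C (attach C s) (endpoint r s) = s := by
  cases s with
  | nil => simp [attach, stepTo]
  | cons p s =>
    obtain ⟨D, v⟩ := p
    rw [attach]; split_ifs with h
    · have h' : D = C := h
      subst h'
      have hne : v ≠ endpoint r s := hs.2.2.2.2.symm
      exact if_neg hne
    · simp [stepTo]

theorem endpoint_attach_mem {C : Fin c} {s : List (Fin c × V)} (hs : IsWord A r s)
    (h : endpoint r s ∈ (A C).support) : endpoint r (attach C s) ∈ (A C).support := by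
  cases s with
  | nil => exact h
  | cons p s =>
    rw [attach]; split_ifs with hC
    · subst hC; exact hs.2.2.1
    · exact h

theorem isWord_stepTo {C : Fin c} {s : List (Fin c × V)} (hs : IsWord A r s)
    (hh : ∀ p ∈ s.head?, p.1 ≠ C) (he : endpoint r s ∈ (A C).support) {z : V}
    (hz : z ∈ (A C).support) : IsWord A r (stepTo r C s z) := by
  rw [stepTo]; split_ifs with h
  exacts [hs, ⟨hs, hh, he, hz, Ne.symm h⟩]

theorem attach_stepTo {C : Fin c} {s : List (Fin c × V)} (hh : ∀ p ∈ s.head?, p.1 ≠ C) (z : V) :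
    attach C (stepTo r C s z) = s := by
  rw [stepTo]; split_ifs
  · cases s with
    | nil => rfl
    | cons p s =>
      rw [attach, if_neg (hh p (by simp))]
  · rw [attach, if_pos rfl]

theorem stepTo_adj {C : Fin c} {s : List (Fin c × V)} {z z' : V} (h : (A C).Adj z z') :
    Arc A r (stepTo r C s z) (stepTo r C s z') ∨ Arc A r (stepTo r C s z') (stepTo r C s z) := by
  by_cases h1 : z = endpoint r s
  · subst h1
    have h2 : z' ≠ endpoint r s := h.ne'
    simp only [stepTo, h2, if_true, if_false]
    exact Or.inl (Arc.child s C z' h)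
  · by_cases h2 : z' = endpoint r s
    · subst h2
      simp only [stepTo, h1, if_true, if_false]
      exact Or.inr (Arc.child s C z h.symm)
    · simp only [stepTo, h1, h2, if_false]
      exact Or.inl (Arc.sibling s C z z' h)

theorem length_stepTo_attach_le (C : Fin c) (s : List (Fin c × V)) (z : V) :
    (stepTo r C (attach C s) z).length ≤ s.length + 1 := by
  cases s with
  | nil => rw [attach, stepTo]; split_ifs <;> simp
  | cons p s =>
    rw [attach]
    split_ifs
    all_goals
      rw [stepTo]
      split_ifs <;> simp only [List.length_cons] <;> omega

/-- Two atom copies through s share no other word. A move in the colour of the last step of s does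
not lengthen s, while a move in any other colour does; if neither move has that colour, the appended
step shows which colour was used. -/
theorem stepTo_attach_inj {C C' : Fin c} {s : List (Fin c × V)} (hs : IsWord A r s) {z z' : V}
    (hz : z ≠ endpoint r s) (hz' : z' ≠ endpoint r s)
    (h : stepTo r C (attach C s) z = stepTo r C' (attach C' s) z') : C = C' := by
  by_contra hC
  have key : ∀ {D D' : Fin c} {x x' : V}, D ≠ D' → x' ≠ endpoint r s → (∀ p ∈ s.head?, p.1 = D) →
      s ≠ [] → stepTo r D (attach D s) x ≠ stepTo r D' (attach D' s) x' := by
    intro D D' x x' hD hx' hh hne he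
    have h1 := congrArg List.length he
    obtain ⟨p, s, rfl⟩ := List.exists_cons_of_ne_nil hne
    have hp : p.1 = D := hh p (by simp)
    have e1 : attach D (p :: s) = s := by rw [attach, if_pos hp]
    have e2 : attach D' (p :: s) = p :: s := by rw [attach, if_neg fun h => hD (hp ▸ h)]
    rw [e1, e2, stepTo, stepTo, if_neg hx'] at h1
    split_ifs at h1
    · simp only [List.length_cons] at h1; omega
    · simp only [List.length_cons] at h1; omega
  cases s with
  | nil =>
    have h1 : z ≠ r := hz
    have h2 : z' ≠ r := hz'
    simp only [attach, stepTo, endpoint, h1, h2, if_false, List.cons.injEq, Prod.mk.injEq] at h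
    exact hC h.1.1
  | cons p s =>
    by_cases hp : p.1 = C
    · exact key hC hz' (by simpa using hp) (by simp) h
    · by_cases hp' : p.1 = C'
      · exact key (Ne.symm hC) hz (by simpa using hp') (by simp) h.symm
      · rw [attach, if_neg hp, attach, if_neg hp', stepTo, stepTo, if_neg hz, if_neg hz'] at h
        simp only [List.cons.injEq, Prod.mk.injEq] at h
        exact hC h.1.1

/-- `stepTo` maps the connected atom homomorphically into the product, which joins s to each of its
extensions even when the last step of the string is not an edge. -/
theorem reachable_nil (hA : IsConnectedSumGraph A) (s : Word A r) :
    (additiveProduct A r).Reachable ⟨[], trivial⟩ s := by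
  obtain ⟨s, hs⟩ := s
  induction s with
  | nil => exact Reachable.refl _
  | cons p s ih =>
    obtain ⟨C, v⟩ := p
    refine (ih hs.1).trans ?_
    obtain ⟨hs0, hh, he, hv, hne⟩ := hs
    let φ : ((A C).induce (A C).support) →g additiveProduct A r :=
      { toFun := fun z => ⟨stepTo r C s z.1, isWord_stepTo hs0 hh he z.2⟩
        map_rel' := fun {a b} h => stepTo_adj (r := r) (s := s) h }
    have h1 := ((hA.atom_connected C).preconnected ⟨_, he⟩ ⟨v, hv⟩).map φ
    have h2 : φ ⟨_, he⟩ = ⟨s, hs0⟩ := Subtype.ext (if_pos rfl)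
    have h3 : φ ⟨v, hv⟩ = ⟨(C, v) :: s, hs0, hh, he, hv, hne⟩ :=
      Subtype.ext (if_neg hne.symm)
    rwa [h2, h3] at h1

theorem preconnected_additiveProduct (hA : IsConnectedSumGraph A) :
    (additiveProduct A r).Preconnected := fun a b =>
  (reachable_nil hA a).symm.trans (reachable_nil hA b)

theorem exists_word_endpoint (hA : IsConnectedSumGraph A) (u : V) :
    ∃ s, IsWord A r s ∧ endpoint r s = u := by
  obtain ⟨q⟩ := hA.sum_connected.preconnected u r
  induction q with
  | nil => exact ⟨[], trivial, rfl⟩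
  | @cons a b _ h q ih =>
    obtain ⟨s, hs, he⟩ := ih
    obtain ⟨C, hC⟩ := (iSup_adj).1 h
    have ha : a ∈ (A C).support := ⟨b, hC⟩
    have hb : b ∈ (A C).support := ⟨a, hC.symm⟩
    exact ⟨_, isWord_stepTo (isWord_attach hs) (head_attach hs)
      (endpoint_attach_mem hs (by rwa [he])) ha, endpoint_stepTo _ _ _⟩

theorem additiveProduct_neighbors [Fintype V] : ∃ Δ : ℕ, ∀ s : Word A r,
    ((additiveProduct A r).neighborSet s).Finite ∧
      ((additiveProduct A r).neighborSet s).ncard ≤ Δ := by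
  classical
  -- A neighbour of s appends a step, replaces the last step, or deletes it.
  refine ⟨2 * Fintype.card (Fin c × V) + 1, fun s => ?_⟩
  set T : Finset (List (Fin c × V)) := (Finset.univ.image fun p => p :: s.1) ∪
    (Finset.univ.image fun p => p :: s.1.tail) ∪ {s.1.tail} with hT
  have hmem : ∀ t ∈ (additiveProduct A r).neighborSet s, t.1 ∈ (T : Set (List (Fin c × V))) := by
    rintro ⟨t, ht⟩ h
    have key : ∀ a b, Arc A r a b → (a = b.tail ∨ a ∈ Finset.univ.image fun p => p :: b.tail) ∧
        (b ∈ Finset.univ.image (fun p => p :: a) ∨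
          b ∈ Finset.univ.image fun p => p :: a.tail) := by
      intro a b hab
      cases hab with
      | sibling s C u v h => simp
      | child s C v h => simp
    rcases h with h | h
    · rcases (key _ _ h).2 with h | h
      · exact Finset.mem_coe.2 (Finset.mem_union_left _ (Finset.mem_union_left _ h))
      · exact Finset.mem_coe.2 (Finset.mem_union_left _ (Finset.mem_union_right _ h))
    · rcases (key _ _ h).1 with h | h
      · exact Finset.mem_coe.2 (Finset.mem_union_right _ (Finset.mem_singleton.2 h))
      · exact Finset.mem_coe.2 (Finset.mem_union_left _ (Finset.mem_union_right _ h))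
  refine ⟨Set.Finite.of_finite_image (f := Subtype.val) (T.finite_toSet.subset ?_)
    Subtype.val_injective.injOn, ?_⟩
  · rintro _ ⟨t, ht, rfl⟩
    exact hmem t ht
  · refine (Set.ncard_le_ncard_of_injOn Subtype.val hmem Subtype.val_injective.injOn
      T.finite_toSet).trans ?_
    rw [Set.ncard_coe_finset]
    refine (Finset.card_union_le _ _).trans (Nat.add_le_add ((Finset.card_union_le _ _).trans ?_)
      (by simp))
    rw [two_mul]
    exact Nat.add_le_add Finset.card_image_le Finset.card_image_le

variable {κ : Type*}

/-- The sheet permutation along a word. -/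
def sheet (r : V) (π : Fin c × V → Equiv.Perm κ) : List (Fin c × V) → Equiv.Perm κ
  | [] => 1
  | p :: s => π p * (π (p.1, endpoint r s))⁻¹ * sheet r π s

theorem sheet_stepTo (π : Fin c × V → Equiv.Perm κ) (C : Fin c) (s : List (Fin c × V)) (z : V) :
    sheet r π (stepTo r C s z) = π (C, z) * (π (C, endpoint r s))⁻¹ * sheet r π s := by
  rw [stepTo]; split_ifs with h
  · rw [← h, mul_inv_cancel, one_mul]
  · rfl

/-- Words of bounded length. -/
structure BoundedWord (A : Fin c → SimpleGraph V) (r : V) (L : ℕ) where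
  list : List (Fin c × V)
  isWord : IsWord A r list
  length_le : list.length ≤ L

/-- Bounded words as vertices of the additive product. -/
def BoundedWord.toWord (L : ℕ) : BoundedWord A r L ↪ Word A r where
  toFun w := ⟨w.list, w.isWord⟩
  inj' := by
    rintro ⟨s, _, _⟩ ⟨t, _, _⟩ h
    obtain rfl : s = t := congrArg Subtype.val h
    rfl

instance [Finite V] (L : ℕ) : Finite (BoundedWord A r L) := by
  have : Finite {l : List (Fin c × V) | l.length ≤ L} := List.finite_length_le _ _
  refine Finite.of_injective
    (fun w => (⟨w.list, w.length_le⟩ : {l : List (Fin c × V) | l.length ≤ L})) ?_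
  rintro ⟨s, _, _⟩ ⟨t, _, _⟩ h
  obtain rfl : s = t := congrArg Subtype.val h
  rfl

/-- The adjacency relation of the lift of the atom of colour `m` by `π`. -/
def liftRel (A : Fin c → SimpleGraph V) (π : Fin c × V → Equiv.Perm κ) (m : Fin c)
    (a b : κ × V) : Prop :=
  (A m).Adj a.2 b.2 ∧ (π (m, a.2))⁻¹ a.1 = (π (m, b.2))⁻¹ b.1

open Classical in
/-- The neighbour of a bounded word in its copy of the atom of colour `m`. -/
noncomputable def wordNbr {L : ℕ} (m : Fin c) (w : BoundedWord A r L) (z : V) :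
    BoundedWord A r L :=
  -- The default value w is never reached along edges from words of length below L, by
  -- `coe_wordNbr`.
  if h : IsWord A r (stepTo r m (attach m w.list) z) ∧
      (stepTo r m (attach m w.list) z).length ≤ L then ⟨_, h.1, h.2⟩ else w

theorem coe_wordNbr {L : ℕ} {m : Fin c} {w : BoundedWord A r L} {z : V} (hw : w.list.length < L)
    (h : (A m).Adj (endpoint r w.list) z) :
    (wordNbr m w z).list = stepTo r m (attach m w.list) z := by
  have h1 : endpoint r w.list ∈ (A m).support := ⟨z, h⟩
  have h2 : z ∈ (A m).support := ⟨_, h.symm⟩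
  have hs := w.isWord
  rw [wordNbr, dif_pos ⟨isWord_stepTo (isWord_attach hs) (head_attach hs)
    (endpoint_attach_mem hs h1) h2, (length_stepTo_attach_le _ _ _).trans hw⟩]

open Classical in
/-- Bounded words cover every lift of the sum graph. -/
noncomputable def wordCover [Fintype V] [Fintype κ] (A : Fin c → SimpleGraph V) (r : V)
    (π : Fin c × V → Equiv.Perm κ) (L : ℕ) [Fintype (BoundedWord A r L)]
    (hL : ∀ u, ∃ s, IsWord A r s ∧ endpoint r s = u ∧ s.length + Fintype.card (κ × V) ≤ L) :
    SheetCover (liftRel A π) L κ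
      (((additiveProduct A r).comap (BoundedWord.toWord L)).adjMatrix ℝ) where
  -- One projection for each sheet p of the root: a word goes to its end vertex, and p is
  -- transported along the word by `sheet`.
  proj p w := (sheet r π w.list p, endpoint r w.list)
  level w := w.list.length
  -- Two words lie in the same copy of the atom m when that copy is attached at the same word.
  same m w w' := attach m w.list = attach m w'.list
  nbr _ m w b := wordNbr m w b.2
  same_symm := Eq.symm
  same_trans := Eq.trans
  same_inj {p m w w'} h he := by
    refine (BoundedWord.toWord L).injective (Subtype.ext ?_)
    change w.list = w'.list
    rw [← stepTo_attach (C := m) w.isWord, ← stepTo_attach (C := m) w'.isWord, h,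
      (Prod.mk.inj he).2]
  proj_nbr {p m w b} hw h := by
    have h2 := sheet_stepTo (r := r) π m (attach m w.list) (endpoint r w.list)
    rw [stepTo_attach w.isWord] at h2
    rw [coe_wordNbr hw h.1, endpoint_stepTo, sheet_stepTo]
    refine Prod.ext ?_ rfl
    have h3 := h.2
    rw [h2] at h3
    simp only [Equiv.Perm.mul_apply] at h3 ⊢
    rw [(Equiv.symm_apply_apply _ _).symm.trans h3]
    exact Equiv.apply_symm_apply _ _
  level_nbr {p m w b} hw h := by
    rw [coe_wordNbr hw h.1]
    exact length_stepTo_attach_le _ _ _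
  edge_nbr {p m w b} hw h := by
    rw [adjMatrix_apply, if_pos]
    have h1 := stepTo_adj (r := r) (s := attach m w.list) h.1
    rw [stepTo_attach w.isWord, ← coe_wordNbr hw h.1] at h1
    exact h1
  same_nbr {p m w b} hw h := by
    rw [coe_wordNbr hw h.1, attach_stepTo (head_attach w.isWord)]
  nbr_inj {p m m' w b b'} hw h h' he := by
    have he := congrArg (fun x => x.list) he
    rw [coe_wordNbr hw h.1, coe_wordNbr hw h'.1] at he
    exact stepTo_attach_inj w.isWord h.1.ne' h'.1.ne' he
  exists_lift v := by
    obtain ⟨s, hs, he, hl⟩ := hL v.2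
    refine ⟨(sheet r π s)⁻¹ v.1, ⟨s, hs, by omega⟩, ?_, hl⟩
    exact Prod.ext (by simp) he

/-- Beyond the spectral radius of the additive product, the averaged characteristic polynomial of
the signings of a lift is positive. -/
theorem signDet_liftRel_pos [Fintype V] [DecidableEq V] [Fintype κ] [DecidableEq κ]
    (hA : IsConnectedSumGraph A) (r : V) (u v : Word A r) (π : Fin c × V → Equiv.Perm κ) {y : ℝ}
    (hy : rho (additiveProduct A r) u v < y) :
    0 < signDet (SheetCover.relMat (liftRel A π)) y Finset.univ := by
  classical
  choose s hs he using exists_word_endpoint (r := r) hA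
  -- Above each vertex there is a word of length `(s u).length`; one further level is reserved for
  -- each vertex of the lift, as the induction requires.
  set L := ∑ u, (s u).length + Fintype.card (κ × V) with hL
  let _ : Fintype (BoundedWord A r L) := Fintype.ofFinite _
  obtain ⟨Δ, hΔ⟩ := additiveProduct_neighbors (A := A) (r := r)
  have hB := hasGreen_adjMatrix (S := BoundedWord A r L) (BoundedWord.toWord L)
    (fun a => (hΔ a).1) (fun a => (hΔ a).2) (preconnected_additiveProduct hA) hy
  refine (wordCover A r π L fun u => ⟨s u, hs u, he u, ?_⟩).signDet_univ_pos hB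
    (fun m a h => h.1.ne rfl) fun m a b h => ⟨h.1.symm, h.2.symm⟩
  exact Nat.add_le_add_right (Finset.single_le_sum (f := fun u => (s u).length)
    (fun _ _ => Nat.zero_le _) (Finset.mem_univ u)) _

end WordCover

end AdditiveProduct

/-! ### The spectrum of a lift -/

namespace AdditiveProduct

section LiftSpectrum

open Matrix Polynomial
open scoped BigOperators

set_option linter.unusedSectionVars false

variable {V κ : Type*} [Fintype V] [DecidableEq V] [Fintype κ] [DecidableEq κ] {c d : ℕ}

open Classical in
/-- The disjoint union of copies of the atoms. -/
noncomputable def atomMat (κ : Type*) (A : Fin c → SimpleGraph V) (m : Fin c) :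
    Matrix (κ × V) (κ × V) ℝ :=
  Matrix.of fun a b => if a.1 = b.1 then (A m).adjMatrix ℝ a.2 b.2 else 0

theorem atomMat_isSymm (A : Fin c → SimpleGraph V) (m : Fin c) : (atomMat κ A m).IsSymm := by
  ext a b
  simp only [transpose_apply, atomMat, of_apply, SimpleGraph.adjMatrix_apply]
  have h := (A m).adj_comm b.2 a.2
  by_cases h1 : a.1 = b.1 <;> by_cases h2 : (A m).Adj a.2 b.2 <;> simp [h1, h2, h, eq_comm]

open Classical in
theorem blockConj_atomMat (g : Fin c × V → Matrix κ κ ℝ) (A : Fin c → SimpleGraph V) (m : Fin c)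
    (a b : κ × V) : blockConj g (atomMat κ A) m a b =
      (A m).adjMatrix ℝ a.2 b.2 * (g (m, a.2) * (g (m, b.2))ᵀ) a.1 b.1 := by
  obtain ⟨p, u⟩ := a
  obtain ⟨q, v⟩ := b
  have h1 : ∀ k w, (blockDiagonal (fun v => g (m, v)) * atomMat κ A m) (p, u) (k, w) =
      g (m, u) p k * (A m).adjMatrix ℝ u w := by
    intro k w
    rw [Matrix.mul_apply, Fintype.sum_prod_type, Finset.sum_eq_single k, Finset.sum_eq_single u]
    · simp [blockDiagonal_apply, atomMat]
    · intro x _ hx; simp [blockDiagonal_apply, hx.symm]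
    · simp
    · intro x _ hx; simp [atomMat, hx]
    · simp
  rw [blockConj, Matrix.mul_apply, Fintype.sum_prod_type, Matrix.mul_apply, Finset.mul_sum]
  refine Finset.sum_congr rfl fun k _ => ?_
  rw [Finset.sum_eq_single v]
  · rw [h1, transpose_apply, blockDiagonal_apply, if_pos rfl, transpose_apply]
    ring
  · intro x _ hx
    rw [transpose_apply, blockDiagonal_apply, if_neg hx.symm, mul_zero]
  · simp

theorem signedPerm_mul_transpose (γ δ : (κ → ℤˣ) × Equiv.Perm κ) (p q : κ) :
    (signedPerm γ * (signedPerm δ)ᵀ) p q =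
      if γ.2⁻¹ p = δ.2⁻¹ q then ((γ.1 p : ℤ) : ℝ) * ((δ.1 q : ℤ) : ℝ) else 0 := by
  have h1 : ∀ k, p = γ.2 k ↔ k = γ.2⁻¹ p := fun k => by
    rw [Equiv.Perm.eq_inv_iff_eq]; exact eq_comm
  have h2 : ∀ k, q = δ.2 k ↔ k = δ.2⁻¹ q := fun k => by
    rw [Equiv.Perm.eq_inv_iff_eq]; exact eq_comm
  rw [Matrix.mul_apply, Finset.sum_eq_single (γ.2⁻¹ p)]
  · simp only [signedPerm, of_apply, transpose_apply, h1, h2, if_true, mul_ite, mul_zero]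
  · intro k _ hk
    simp only [signedPerm, of_apply, h1, hk, if_false, zero_mul]
  · simp

/-- The permutation parts of the blocks turn the copies of the atom into a lift, and the sign parts
become its diagonal sign matrices. -/
theorem sub_blockConj_signedPerm (A : Fin c → SimpleGraph V) (y : ℝ)
    (T : Fin c × V → (κ → ℤˣ) × Equiv.Perm κ) :
    scalar (κ × V) y - ∑ m, blockConj (fun j => signedPerm (T j)) (atomMat κ A) m =
      signMat (SheetCover.relMat (liftRel A fun j => (T j).2)) y
        fun m a => (T (m, a.2)).1 a.1 := by
  ext a b
  rw [Matrix.sub_apply, Matrix.sum_apply, signMat, of_apply, scalar_apply, diagonal_apply]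
  congr 1
  refine Finset.sum_congr rfl fun m _ => ?_
  rw [blockConj_atomMat, signedPerm_mul_transpose]
  simp only [SheetCover.relMat, liftRel, of_apply, SimpleGraph.adjMatrix_apply]
  by_cases h1 : (A m).Adj a.2 b.2 <;>
    by_cases h2 : (T (m, a.2)).2⁻¹ a.1 = (T (m, b.2)).2⁻¹ b.1 <;> simp [h1, h2]

/-- The tuples of signed permutations, split into signs and permutations. -/
def signEquiv (J : Type*) (V κ : Type*) :
    (J × V → (κ → ℤˣ) × Equiv.Perm κ) ≃ (J × V → Equiv.Perm κ) × (J → κ × V → ℤˣ) where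
  toFun T := (fun j => (T j).2, fun m a => (T (m, a.2)).1 a.1)
  invFun x j := (fun p => x.2 j.1 (p, j.2), x.1 j)
  left_inv _ := rfl
  right_inv _ := rfl

/-- For each fixed family of permutation parts, the average over the signs is already positive by
`signDet_liftRel_pos`. -/
theorem expect_signedPerm_pos {A : Fin c → SimpleGraph V} (hA : IsConnectedSumGraph A) {r : V}
    {u v : Word A r} {y : ℝ} (hy : rho (additiveProduct A r) u v < y) :
    0 < 𝔼 T : Fin c × V → (κ → ℤˣ) × Equiv.Perm κ,
      (scalar (κ × V) y - ∑ m, blockConj (fun j => signedPerm (T j)) (atomMat κ A) m).det := by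
  have h1 := Fintype.expect_equiv (signEquiv (Fin c) V κ)
    (fun T => (scalar (κ × V) y -
      ∑ m, blockConj (fun j => signedPerm (T j)) (atomMat κ A) m).det)
    (fun x => (signMat (SheetCover.relMat (liftRel A x.1)) y x.2).det)
    (fun T => by rw [sub_blockConj_signedPerm]; rfl)
  rw [h1, ← Finset.univ_product_univ, Finset.expect_product]
  refine Finset.expect_pos (fun π _ => ?_) Finset.univ_nonempty
  have h2 := signDet_liftRel_pos hA r u v π hy
  simpa only [signDet, mask_univ] using h2

variable {R : Matrix (Fin (d + 1)) (Fin d ⊕ Unit) ℝ}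

theorem IsFrame.stdRep_mul_transpose (h : IsFrame R) (σ τ : Equiv.Perm (Fin (d + 1)))
    (p q : Fin d) : (h.stdRep σ * (h.stdRep τ)ᵀ) p q =
      ∑ k, R (σ k) (Sum.inl p) * R (τ k) (Sum.inl q) := by
  rw [h.stdRep_transpose, ← map_mul, h.stdRep_apply, ← Equiv.sum_comp τ]
  refine Finset.sum_congr rfl fun k _ => ?_
  have : (σ * τ⁻¹) (τ k) = σ k := by simp
  rw [this]; rfl

/-- The position of an index of the block decomposition. -/
def blockIdx : (Fin d × V) ⊕ V → (Fin d ⊕ Unit) × V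
  | Sum.inl x => (Sum.inl x.1, x.2)
  | Sum.inr v => (Sum.inr (), v)

theorem blockIdx_injective : Function.Injective (blockIdx : (Fin d × V) ⊕ V → _) := by
  rintro (⟨p, u⟩ | u) (⟨q, v⟩ | v) h <;> simp_all [blockIdx]

/-- The change of basis that splits off the constant vectors. -/
def frameMat (V : Type*) [DecidableEq V] (R : Matrix (Fin (d + 1)) (Fin d ⊕ Unit) ℝ) :
    Matrix (V × Fin (d + 1)) ((Fin d × V) ⊕ V) ℝ :=
  Matrix.of fun x z => if x.1 = (blockIdx z).2 then R x.2 (blockIdx z).1 else 0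

theorem frameMat_conj (M : Matrix (V × Fin (d + 1)) (V × Fin (d + 1)) ℝ)
    (z z' : (Fin d × V) ⊕ V) : ((frameMat V R)ᵀ * M * frameMat V R) z z' =
      ∑ i, ∑ j, R i (blockIdx z).1 * M ((blockIdx z).2, i) ((blockIdx z').2, j) *
        R j (blockIdx z').1 := by
  have h1 : ∀ y : V × Fin (d + 1), ((frameMat V R)ᵀ * M) z y =
      ∑ i, R i (blockIdx z).1 * M ((blockIdx z).2, i) y := by
    intro y
    rw [Matrix.mul_apply, Fintype.sum_prod_type, Finset.sum_eq_single (blockIdx z).2]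
    · simp [frameMat]
    · intro x _ hx; simp [frameMat, hx]
    · simp
  rw [Matrix.mul_apply, Fintype.sum_prod_type, Finset.sum_eq_single (blockIdx z').2,
    Finset.sum_comm]
  · simp only [h1]
    simp [frameMat, Finset.sum_mul]
  · intro x _ hx; simp [frameMat, hx]
  · simp

theorem IsFrame.frameMat_transpose_mul (h : IsFrame R) :
    (frameMat V R)ᵀ * frameMat V R = 1 := by
  ext z z'
  have h0 := frameMat_conj (R := R) (1 : Matrix (V × Fin (d + 1)) (V × Fin (d + 1)) ℝ) z z'
  rw [Matrix.mul_one] at h0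
  rw [h0]
  by_cases h2 : (blockIdx z).2 = (blockIdx z').2
  · have h1 := congrFun (congrFun h.transpose_mul (blockIdx z).1) (blockIdx z').1
    rw [Matrix.mul_apply] at h1
    simp only [transpose_apply] at h1
    have h3 : ∀ i, ∑ j, R i (blockIdx z).1 * (1 : Matrix (V × Fin (d + 1)) (V × Fin (d + 1)) ℝ)
        ((blockIdx z).2, i) ((blockIdx z').2, j) * R j (blockIdx z').1 =
        R i (blockIdx z).1 * R i (blockIdx z').1 := by
      intro i
      simp [Matrix.one_apply, h2]
    rw [Finset.sum_congr rfl fun i _ => h3 i, h1, Matrix.one_apply, Matrix.one_apply]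
    refine if_congr ⟨fun h => blockIdx_injective (Prod.ext h h2), fun h => by rw [h]⟩ rfl rfl
  · have h3 : z ≠ z' := fun h => h2 (by rw [h])
    simp [h2, h3]

open Classical in
-- In the orthonormal basis of the frame, the vectors constant on fibres give the block `sumAdj A`
-- and their complement gives the standard representation; the off-diagonal blocks vanish because
-- the simplex vectors sum to zero. The inverse in the potential makes the block from v to u match
-- positions Q_u k and Q_v k, that is, the permutation Q_u Q_v⁻¹.
theorem IsFrame.charpoly_lift (h : IsFrame R) (A : Fin c → SimpleGraph V)
    (Q : Fin c × V → Equiv.Perm (Fin (d + 1))) :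
    (sumAdj (additiveLift A fun m v => (Q (m, v))⁻¹)).charpoly =
      (∑ m, blockConj (fun j => h.stdRep (Q j)) (atomMat (Fin d) A) m).charpoly *
        (sumAdj A).charpoly := by
  set M := sumAdj (additiveLift A fun m v => (Q (m, v))⁻¹) with hM
  set S : Matrix (V × Fin (d + 1)) ((Fin d × V) ⊕ V) ℝ := frameMat V R with hS
  have hcard : Fintype.card ((Fin d × V) ⊕ V) = Fintype.card (V × Fin (d + 1)) := by
    simp only [Fintype.card_sum, Fintype.card_prod, Fintype.card_fin]; ring
  have h1 : Sᵀ * S = 1 := h.frameMat_transpose_mul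
  have h2 : S * Sᵀ = 1 := (Matrix.mul_eq_one_comm_of_card_eq _ _ _ hcard).1 h1
  have h3 : (Sᵀ * M * S).charpoly = M.charpoly := by
    rw [charpoly_mul_comm_of_le _ _ hcard.ge, hcard, Nat.sub_self, pow_zero, one_mul,
      ← Matrix.mul_assoc, h2, Matrix.one_mul]
  have hentry : ∀ m (a b : Fin d ⊕ Unit) (u v : V),
      ∑ i, ∑ j, R i a * (if (Q (m, v))⁻¹ j = (Q (m, u))⁻¹ i then 1 else 0) * R j b =
      ∑ k, R (Q (m, u) k) a * R (Q (m, v) k) b := by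
    intro m a b u v
    rw [← Equiv.sum_comp (Q (m, u))]
    refine Finset.sum_congr rfl fun k _ => ?_
    rw [← Equiv.sum_comp (Q (m, v))]
    simp
  have h4 : Sᵀ * M * S = fromBlocks
      (∑ m, blockConj (fun j => h.stdRep (Q j)) (atomMat (Fin d) A) m) 0 0 (sumAdj A) := by
    ext z z'
    have h5 : (Sᵀ * M * S) z z' = ∑ m, (A m).adjMatrix ℝ (blockIdx z).2 (blockIdx z').2 *
        ∑ k, R (Q (m, (blockIdx z).2) k) (blockIdx z).1 *
          R (Q (m, (blockIdx z').2) k) (blockIdx z').1 := by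
      rw [hS, frameMat_conj]
      simp only [← hentry]
      simp only [Finset.mul_sum]
      have h6 : ∀ i j, R i (blockIdx z).1 * M ((blockIdx z).2, i) ((blockIdx z').2, j) *
          R j (blockIdx z').1 = ∑ m, (A m).adjMatrix ℝ (blockIdx z).2 (blockIdx z').2 *
            (R i (blockIdx z).1 * (if (Q (m, (blockIdx z').2))⁻¹ j =
              (Q (m, (blockIdx z).2))⁻¹ i then 1 else 0) * R j (blockIdx z').1) := by
        intro i j
        rw [hM, sumAdj, Matrix.sum_apply, Finset.mul_sum, Finset.sum_mul]
        refine Finset.sum_congr rfl fun m _ => ?_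
        have h7 : (additiveLift A (fun m v => (Q (m, v))⁻¹) m).adjMatrix ℝ
            ((blockIdx z).2, i) ((blockIdx z').2, j) =
            (A m).adjMatrix ℝ (blockIdx z).2 (blockIdx z').2 *
              (if (Q (m, (blockIdx z').2))⁻¹ j = (Q (m, (blockIdx z).2))⁻¹ i then 1 else 0) := by
          rw [SimpleGraph.adjMatrix_apply, SimpleGraph.adjMatrix_apply,
            ite_zero_mul_ite_zero, one_mul]
          exact if_congr Iff.rfl rfl rfl
        rw [h7]
        ring
      simp only [h6]
      rw [Finset.sum_comm' (t' := Finset.univ) (s' := fun _ => Finset.univ) (by simp)]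
      rw [Finset.sum_congr rfl fun j _ => Finset.sum_comm]
      rw [Finset.sum_comm]
      exact Finset.sum_congr rfl fun m _ => Finset.sum_comm
    rw [h5]
    rcases z with ⟨p, u⟩ | u <;> rcases z' with ⟨q, v⟩ | v
    · rw [fromBlocks_apply₁₁, Matrix.sum_apply]
      refine Finset.sum_congr rfl fun m _ => ?_
      rw [blockConj_atomMat, h.stdRep_mul_transpose]
      rfl
    · rw [fromBlocks_apply₁₂, Matrix.zero_apply]
      refine Finset.sum_eq_zero fun m _ => ?_
      have := congrFun h.sum_eq_zero p
      simp only [Finset.sum_apply, simplexVec, Pi.zero_apply] at this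
      simp only [blockIdx, h.const, ← Finset.sum_mul]
      rw [Equiv.sum_comp (Q (m, u)) fun k => R k (Sum.inl p), this, zero_mul, mul_zero]
    · rw [fromBlocks_apply₂₁, Matrix.zero_apply]
      refine Finset.sum_eq_zero fun m _ => ?_
      have := congrFun h.sum_eq_zero q
      simp only [Finset.sum_apply, simplexVec, Pi.zero_apply] at this
      simp only [blockIdx, h.const, ← Finset.mul_sum]
      rw [Equiv.sum_comp (Q (m, v)) fun k => R k (Sum.inl q), this, mul_zero, mul_zero]
    · rw [fromBlocks_apply₂₂, sumAdj, Matrix.sum_apply]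
      refine Finset.sum_congr rfl fun m _ => ?_
      have h7 : (1 / √(d + 1 : ℕ) : ℝ) * (1 / √(d + 1 : ℕ)) = 1 / (d + 1 : ℕ) := by
        rw [div_mul_div_comm, one_mul, Real.mul_self_sqrt (Nat.cast_nonneg _)]
      simp only [blockIdx, h.const, h7, Finset.sum_const, Finset.card_univ, Fintype.card_fin,
        nsmul_eq_mul]
      rw [mul_one_div_cancel (by positivity), mul_one]
  rw [← h3, h4, charpoly_fromBlocks_zero₁₂]

end LiftSpectrum

end AdditiveProduct

/-! ### Conclusion -/

theorem mainTheorem2 {V : Type*} [Fintype V] [DecidableEq V] {c : ℕ}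
    (A : Fin c → SimpleGraph V) (hA : AdditiveProduct.IsConnectedSumGraph A)
    (N : ℕ) (hN : 1 ≤ N) :
    ∃ Q : Fin c → V → Equiv.Perm (Fin N),
      ∀ μ ∈ AdditiveProduct.sumSpec (AdditiveProduct.additiveLift A Q) -
          AdditiveProduct.sumSpec A,
        ∀ (r : V) (u v : AdditiveProduct.Word A r),
          μ ≤ AdditiveProduct.rho (AdditiveProduct.additiveProduct A r) u v := by
  obtain ⟨d, rfl⟩ : ∃ d, N = d + 1 := ⟨N - 1, by omega⟩
  obtain ⟨R, hR⟩ := AdditiveProduct.exists_isFrame d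
  obtain ⟨Q, hQ⟩ := AdditiveProduct.exists_rootsDominated_expect hR.stdRep
    (fun a b hab => ⟨_, hR.rootVec_unit hab, hR.stdRep_swap hab⟩)
    AdditiveProduct.isRealStable_charpoly
    (AdditiveProduct.atomMat_isSymm (κ := Fin d) A)
  -- The lift is determined by the averaged polynomial alone, before r, u and v are given, so it
  -- serves all of them.
  refine ⟨fun m v => (Q (m, v))⁻¹, fun μ hμ r u v => ?_⟩
  rw [AdditiveProduct.sumSpec, AdditiveProduct.sumSpec, hR.charpoly_lift,
    Polynomial.roots_mul (mul_ne_zero (Matrix.charpoly_monic _).ne_zero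
      (Matrix.charpoly_monic _).ne_zero), Multiset.add_sub_cancel_right] at hμ
  -- Once the spectrum of the base is cancelled, μ is a root of the standard part, hence at most
  -- some root z of the average. If z exceeded ρ, the average computed with signed permutations
  -- would be positive at z.
  obtain ⟨z, hz, hroot⟩ := hQ μ (Polynomial.isRoot_of_mem_roots hμ)
  refine hz.trans (le_of_not_gt fun hlt => ?_)
  have hpos := AdditiveProduct.expect_signedPerm_pos (κ := Fin d) hA hlt
  rw [← hR.expect_stdRep_eq] at hpos
  exact hpos.ne' hroot
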